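/- Definitions. For a random variable $X$ let $\|X\|_{\psi_2}=\inf\{s>0:\mathsf E\exp((X/s)^2)\le 2\}$. For $T\ge 1$, $G_d(T)$ is the class of random vectors in $\mathbb R^d$ with independent coordinates, each of mean $0$, variance $1$ and $\psi_2$-norm at most $T$. For a random vector $\eta$ in $\mathbb R^N$, $\Phi_\nu(N,\eta)$ is the class of random vectors with the law of $(\delta_1\eta_1,\dots,\delta_N\eta_N)$, where $\delta_1,\dots,\delta_N$ are i.i.d. with $\mathsf P(\delta_i=1)=\nu=1-\mathsf P(\delta_i=0)$ and are independent of $\eta$. For a random vector $\xi$ in $\mathbb R^d$ with independent copy $\xi'$, and $x\in\mathbb R^d$, put $\|x\|_\xi=\big(\mathsf E\,\mathrm{dist}^2((x_i(\xi_i-\xi_i'))_{i\le d},\mathbb Z^d)\big)^{1/2}$. For $L>0$, $\alpha\in(0,1)$ and $v\in\mathbb R^d$ the log-RLCD is $$\mathrm{RlogD}^{\xi}_{L,\alpha}(v)=\inf\Big\{\theta>0:\ \|\theta v\|_\xi<L\sqrt{\log_+\frac{\alpha\|\theta v\|_2}{L}}\Big\},\qquad \log_+ s=\max(\log s,0)\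 (\log_+0=0),\quad \inf\emptyset=\infty.$$ $\sigma_1(A)\ge\sigma_2(A)\ge\cdots$ are the singular values of a matrix $A$, with $\sigma_i(A)=0$ when $i$ exceeds the number of rows or of columns of $A$. Proposition (Mixed rank estimation via log-RLCD). There exist absolute positive constants $c,c',D,C$ such that the following holds. Let $T\ge1$, $t>0$, $\alpha\in(0,1)$, $\nu\le 1/4$, let $n\ge m\ge d\ge k\ge 0$ be integers, and let $c_0,\gamma$ be real numbers with $$0<c_0\le cT^{-4}\nu,\qquad \gamma\ge D\,T^2\nu^{-1/2},\qquad d\le 2c_0^2m,\qquad t\ge c'\alpha\gamma^{-1}e^{-d/8}.$$ Let $X\in\mathbb R^d$ satisfy $\|X\|_2\ge 32\sqrt n\,c_0^{-1}t^{-1}$. Let $\xi_1,\dots,\xi_{m-d}\in G_d(T)$ be independent and let $H$ be a random $(m-d)\times 2d$ matrix with independent rows such that $\mathrm{row}_j(H)\in\Phi_\nu(2d,(\xi_j,\xi_j'))$ for all $j\in[m-d]$, where $\xi_j'$ is an independent copy of $\xi_j$. Put $r_n=\frac{c_0}{32\sqrt n}$ and $R=C\gamma/\alpha$, and let $H_1$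 and $H_2$ be the submatrices of $H$ formed by its first $d$ and its last $d$ columns. If $\mathrm{RlogD}^{\xi_j}_{\gamma,\alpha}(r_nX)>16$ for all $j\in[m-d]$, then $$\mathsf P\Big(\sigma_{2d-k+1}(H)\le\frac{c_0\sqrt m}{16}\ \text{ and }\ \|H_1X\|_2\le m,\ \|H_2X\|_2\le m\Big)\le e^{-c_0mk/4}\,(Rt)^{2m-2d}.$$ -/

import Mathlib

open MeasureTheory ProbabilityTheory
open scoped ENNReal Matrix

namespace MixedRank

noncomputable section

/-- The `ψ₂`-norm `inf {s > 0 : E exp ((X / s) ^ 2) ≤ 2}` of a random variable, with value `∞` if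
there is no such `s`. -/
def psi2Norm {Ω : Type*} [MeasurableSpace Ω] (P : Measure Ω) (X : Ω → ℝ) : ℝ≥0∞ :=
  ⨅ s ∈ {s : ℝ | 0 < s ∧ ∫⁻ ω, ENNReal.ofReal (Real.exp ((X ω / s) ^ 2)) ∂P ≤ 2},
    ENNReal.ofReal s

/-- The class `S₂(T)`: mean zero, variance one, `ψ₂`-norm at most `T`. -/
structure MemS2 {Ω : Type*} [MeasurableSpace Ω] (P : Measure Ω) (T : ℝ) (X : Ω → ℝ) : Prop where
  aemeasurable : AEMeasurable X P
  mean_zero : ∫ ω, X ω ∂P = 0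
  variance_one : Var[X; P] = 1
  psi2Norm_le : psi2Norm P X ≤ ENNReal.ofReal T

/-- The class `G_d(T)`: random vectors with independent coordinates, each in `S₂(T)`. -/
structure MemG {Ω : Type*} [MeasurableSpace Ω] (P : Measure Ω) {d : ℕ} (T : ℝ)
    (ξ : Ω → Fin d → ℝ) : Prop where
  indep : iIndepFun (fun i ω => ξ ω i) P
  memS2 : ∀ i, MemS2 P T (fun ω => ξ ω i)

/-- The law on `ℝ` of a variable that is `1` with probability `ν` and `0` with probability
`1 - ν` (for `ν ∈ [0, 1]`). -/
def bernoulliLaw (ν : ℝ) : Measure ℝ :=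
  ENNReal.ofReal (1 - ν) • Measure.dirac 0 + ENNReal.ofReal ν • Measure.dirac 1

/-- The law `Φ_ν(ι, η)` of the vector `(δ_i η_i)_i`, where `η` has law `Q` and the `δ_i` are
independent Bernoulli variables with parameter `ν`, jointly independent of `η`. -/
def sparseLaw {ι : Type*} [Fintype ι] (ν : ℝ) (Q : Measure (ι → ℝ)) : Measure (ι → ℝ) :=
  ((Measure.pi fun _ : ι => bernoulliLaw ν).prod Q).map fun p i => p.1 i * p.2 i

/-- The law of `(ξ, ξ')`, where `ξ'` is an independent copy of `ξ`. The `2 d` coordinates are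
indexed by `Fin d ⊕ Fin d`: the left block carries `ξ`, the right block `ξ'`. -/
def pairLaw {Ω : Type*} [MeasurableSpace Ω] (P : Measure Ω) {d : ℕ} (ξ : Ω → Fin d → ℝ) :
    Measure (Fin d ⊕ Fin d → ℝ) :=
  ((P.map ξ).prod (P.map ξ)).map fun p => Sum.elim p.1 p.2

/-- Euclidean distance from `x` to the integer lattice `ℤ^d`. -/
def distZ {d : ℕ} (x : EuclideanSpace ℝ (Fin d)) : ℝ :=
  Metric.infDist x {z | ∀ i, ∃ a : ℤ, z i = a}

/-- `‖x‖_ξ = (E dist² (x ⋆ (ξ - ξ'), ℤ^d))^{1/2}`, where `ξ'` is an independent copy of `ξ` and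
`⋆` is the coordinatewise product. -/
def xiNorm {Ω : Type*} [MeasurableSpace Ω] (P : Measure Ω) {d : ℕ} (ξ : Ω → Fin d → ℝ)
    (x : EuclideanSpace ℝ (Fin d)) : ℝ :=
  √(∫ ω, distZ (WithLp.toLp 2 fun i => x i * (ξ ω.1 i - ξ ω.2 i)) ^ 2 ∂(P.prod P))

/-- The randomized logarithmic least common denominator `RlogD_{L,α}^ξ(v)` of a vector `v`, with
value `∞` if no `θ` is admissible; `Real.posLog s = max 0 (log s)`. -/
def RlogD {Ω : Type*} [MeasurableSpace Ω] (P : Measure Ω) {d : ℕ} (L α : ℝ)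
    (ξ : Ω → Fin d → ℝ) (v : EuclideanSpace ℝ (Fin d)) : ℝ≥0∞ :=
  ⨅ θ ∈ {θ : ℝ | 0 < θ ∧ xiNorm P ξ (θ • v) < L * √(Real.posLog (α * ‖θ • v‖ / L))},
    ENNReal.ofReal θ

/-- The `i`-th largest singular value of a matrix, for `i ≥ 1`, with multiplicity; it is `0` when
`i` exceeds the number of columns (Mathlib's sequence starts at the index `0`). -/
def sigma {ι κ : Type*} [Fintype ι] [Fintype κ] [DecidableEq κ] (A : Matrix ι κ ℝ) (i : ℕ) : ℝ :=
  (Matrix.toEuclideanLin A).singularValues (i - 1)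

end

end MixedRank

/-! The bound on `sigma` says that some `k` orthonormal vectors `W_l` are almost annihilated by `H`;
the other two conditions say that `H₁ Y` and `H₂ Y` are small, where `Y = r_n X`. The event is
therefore a small ball event with two sources of smallness. The arithmetic of `Y` should give `ρ²`
per row (one `ρ` per block), with `ρ = γ / (α ‖Y‖)`. The `k` extra directions should give a further
factor `exp (-c ν k)` per row, with `c` depending on `T`.

For fixed `W`, Chernoff's inequality reduces this to one row. There the Laplace transform of the
quadratic form is rewritten, by Gaussian linearisation, as an integral over `θ ∈ ℝ²` and a Gaussian
`g ∈ ℝᵏ` of a product of characteristic functions of the entries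
(`lintegral_exp_neg_le_lintegral_lazyChar`). Each factor is dominated by a positive function
`lazyChar`, used in two ways. First, it decays exponentially in the lattice energy, and the LCD
hypothesis says that, inside a unit box, points of low energy are close in `θ`; integrating in `θ`
gives `ρ²`. Second, it is itself the characteristic function of a symmetrised lazy variable, so for
fixed `θ` the integral in `g` is again a Laplace transform, bounded by `exp (-ν lam k / 16)`
uniformly in `θ` (`lintegral_exp_neg_norm_sq_sum_le`). `lintegral_box_le` obtains both savings at
once by separating a core, where energy and `‖g‖` are small, from the rest. `lintegral_row_le` is
the outcome.

The vectors `W` depend on `H`. Instead of a net, `W` is averaged over Lebesgue measure on a ball of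
operators: every orthonormal tuple has, in proportion about `(r/2) ^ (2 d k)`, perturbations that
still work, provided the Hilbert–Schmidt norm of `H` is not too large (`volume_opBall_two_le`,
`measure_le_of_fiber_measure`). Since `d ≤ 2 c₀² m`, this loss is at most `exp (O(c₀ m k))` and is
absorbed by the gain from the `k` directions. The Hilbert–Schmidt exception has probability at most
`exp (-2 d (m - d))`, which the lower bound on `t` makes admissible. -/

namespace MixedRank

/-! ### Sub-Gaussian laws: moments and Laplace transforms of lazy symmetrised variables. -/

/-- A law on `ℝ` with mean zero, variance one and `E exp ((x / T) ^ 2) ≤ 2`. -/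
structure IsSubG (μ : Measure ℝ) (T : ℝ) : Prop where
  prob : IsProbabilityMeasure μ
  pos : 0 < T
  mean_zero : ∫ x, x ∂μ = 0
  sq_one : ∫ x, x ^ 2 ∂μ = 1
  exp_le : ∫⁻ x, ENNReal.ofReal (Real.exp ((x / T) ^ 2)) ∂μ ≤ 2

/-- The law of `x - x'` for independent `x`, `x'` with law `μ`. -/
noncomputable def symLaw (μ : Measure ℝ) : Measure ℝ := (μ.prod μ).map fun p => p.1 - p.2

/-- The mixture of a Dirac mass at `0` and `μ` with weights `1 - β` and `β`. -/
noncomputable def lazyLaw (β : ℝ) (μ : Measure ℝ) : Measure ℝ :=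
  ENNReal.ofReal (1 - β) • Measure.dirac 0 + ENNReal.ofReal β • μ

theorem isProbabilityMeasure_symLaw (μ : Measure ℝ) [IsProbabilityMeasure μ] :
    IsProbabilityMeasure (symLaw μ) :=
  Measure.isProbabilityMeasure_map (by fun_prop)

theorem isProbabilityMeasure_lazyLaw {β : ℝ} (h0 : 0 ≤ β) (h1 : β ≤ 1) (μ : Measure ℝ)
    [IsProbabilityMeasure μ] : IsProbabilityMeasure (lazyLaw β μ) := by
  constructor
  simp only [lazyLaw, Measure.coe_add, Measure.coe_smul, Pi.add_apply, Pi.smul_apply, measure_univ,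
    smul_eq_mul, mul_one]
  rw [← ENNReal.ofReal_add (by linarith) h0]
  simp

theorem integrable_lazyLaw {E : Type*} [NormedAddCommGroup E] {β : ℝ} {μ : Measure ℝ}
    {f : ℝ → E} (hf : Integrable f μ) : Integrable f (lazyLaw β μ) := by
  refine Integrable.add_measure ?_ ?_
  · exact (integrable_dirac (by simp)).smul_measure (by simp)
  · exact hf.smul_measure (by simp)

theorem integral_lazyLaw {E : Type*} [NormedAddCommGroup E] [NormedSpace ℝ E] [CompleteSpace E]
    {β : ℝ} (h0 : 0 ≤ β) (h1 : β ≤ 1) {μ : Measure ℝ} {f : ℝ → E} (hf : Integrable f μ) :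
    ∫ x, f x ∂(lazyLaw β μ) = (1 - β) • f 0 + β • ∫ x, f x ∂μ := by
  rw [lazyLaw, integral_add_measure ((integrable_dirac (by simp)).smul_measure (by simp))
    (hf.smul_measure (by simp)), integral_smul_measure, integral_smul_measure, integral_dirac,
    ENNReal.toReal_ofReal (by linarith), ENNReal.toReal_ofReal h0]

theorem lintegral_lazyLaw {β : ℝ} {μ : Measure ℝ} (f : ℝ → ℝ≥0∞) :
    ∫⁻ x, f x ∂(lazyLaw β μ) =
      ENNReal.ofReal (1 - β) * f 0 + ENNReal.ofReal β * ∫⁻ x, f x ∂μ := by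
  simp [lazyLaw, lintegral_add_measure, lintegral_smul_measure, lintegral_dirac]

namespace IsSubG

variable {μ : Measure ℝ} {T : ℝ}

theorem integrable_exp (h : IsSubG μ T) : Integrable (fun x => Real.exp ((x / T) ^ 2)) μ := by
  refine ⟨by fun_prop, ?_⟩
  rw [hasFiniteIntegral_iff_ofReal (ae_of_all _ fun x => (Real.exp_pos _).le)]
  exact h.exp_le.trans_lt (by simp)

theorem integral_exp_le (h : IsSubG μ T) : ∫ x, Real.exp ((x / T) ^ 2) ∂μ ≤ 2 := by
  rw [integral_eq_lintegral_of_nonneg_ae (ae_of_all _ fun x => (Real.exp_pos _).le) (by fun_prop)]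
  exact ENNReal.toReal_le_of_le_ofReal (by norm_num) (by simpa using h.exp_le)

theorem sq_le_exp (h : IsSubG μ T) (x : ℝ) : x ^ 2 ≤ T ^ 2 * Real.exp ((x / T) ^ 2) := by
  have h1 := Real.add_one_le_exp ((x / T) ^ 2)
  have hT := h.pos
  have h2 : x ^ 2 = T ^ 2 * (x / T) ^ 2 := by field_simp
  rw [h2]
  gcongr
  linarith

theorem fourth_le_exp (h : IsSubG μ T) (x : ℝ) :
    x ^ 4 ≤ 2 * T ^ 4 * Real.exp ((x / T) ^ 2) := by
  have h1 := Real.quadratic_le_exp_of_nonneg (sq_nonneg (x / T))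
  have hT := h.pos
  have h2 : x ^ 4 = 2 * T ^ 4 * (((x / T) ^ 2) ^ 2 / 2) := by field_simp
  rw [h2]
  gcongr
  nlinarith [sq_nonneg (x / T)]

theorem integrable_sq (h : IsSubG μ T) : Integrable (fun x => x ^ 2) μ :=
  (h.integrable_exp.const_mul (T ^ 2)).mono' (by fun_prop)
    (ae_of_all _ fun x => by simpa using h.sq_le_exp x)

theorem integrable_id (h : IsSubG μ T) : Integrable (fun x => x) μ := by
  have := h.prob
  refine (h.integrable_sq.add (integrable_const (1 : ℝ))).mono' (by fun_prop)
    (ae_of_all _ fun x => ?_)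
  simp only [Real.norm_eq_abs, Pi.add_apply]
  nlinarith [sq_abs x, sq_nonneg (|x| - 1)]

theorem integrable_fourth (h : IsSubG μ T) : Integrable (fun x => x ^ 4) μ :=
  (h.integrable_exp.const_mul (2 * T ^ 4)).mono' (by fun_prop)
    (ae_of_all _ fun x => by
      rw [Real.norm_of_nonneg (by positivity)]
      exact h.fourth_le_exp x)

theorem integral_fourth_le (h : IsSubG μ T) : ∫ x, x ^ 4 ∂μ ≤ 4 * T ^ 4 := by
  calc ∫ x, x ^ 4 ∂μ ≤ ∫ x, 2 * T ^ 4 * Real.exp ((x / T) ^ 2) ∂μ :=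
        integral_mono h.integrable_fourth (h.integrable_exp.const_mul _) h.fourth_le_exp
    _ ≤ 4 * T ^ 4 := by
        rw [integral_const_mul]
        nlinarith [h.integral_exp_le, pow_pos h.pos 4]

/-- Convexity of `exp` between `0` and `(x / T) ^ 2`, with weight `c T²`. Interpolating in this way
gives a constant tending to `1` as `c → 0`. -/
theorem exp_mul_sq_le (h : IsSubG μ T) {c : ℝ} (h0 : 0 ≤ c) (h1 : c * T ^ 2 ≤ 1) (x : ℝ) :
    Real.exp (c * x ^ 2) ≤ 1 - c * T ^ 2 + c * T ^ 2 * Real.exp ((x / T) ^ 2) := by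
  have hT := h.pos
  have key := convexOn_exp.2 (Set.mem_univ 0) (Set.mem_univ ((x / T) ^ 2))
    (show 0 ≤ 1 - c * T ^ 2 by linarith) (show 0 ≤ c * T ^ 2 by positivity) (by ring)
  have h2 : c * T ^ 2 * (x / T) ^ 2 = c * x ^ 2 := by field_simp
  simpa [h2] using key

theorem integrable_exp_mul_sq (h : IsSubG μ T) {c : ℝ} (h0 : 0 ≤ c) (h1 : c * T ^ 2 ≤ 1) :
    Integrable (fun x => Real.exp (c * x ^ 2)) μ := by
  have := h.prob
  refine ((integrable_const (1 - c * T ^ 2)).add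
    (h.integrable_exp.const_mul (c * T ^ 2))).mono' (by fun_prop) (ae_of_all _ fun x => ?_)
  simpa using h.exp_mul_sq_le h0 h1 x

theorem integral_exp_mul_sq_le (h : IsSubG μ T) {c : ℝ} (h0 : 0 ≤ c) (h1 : c * T ^ 2 ≤ 1) :
    ∫ x, Real.exp (c * x ^ 2) ∂μ ≤ Real.exp (c * T ^ 2) := by
  have := h.prob
  have hT := h.pos
  have h3 : 0 ≤ c * T ^ 2 := by positivity
  calc ∫ x, Real.exp (c * x ^ 2) ∂μ
      ≤ ∫ x, (1 - c * T ^ 2 + c * T ^ 2 * Real.exp ((x / T) ^ 2)) ∂μ :=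
        integral_mono (h.integrable_exp_mul_sq h0 h1)
          ((integrable_const _).add (h.integrable_exp.const_mul _)) (h.exp_mul_sq_le h0 h1)
    _ = 1 - c * T ^ 2 + c * T ^ 2 * ∫ x, Real.exp ((x / T) ^ 2) ∂μ := by
        rw [integral_add (integrable_const _) (h.integrable_exp.const_mul _), integral_const_mul]
        simp
    _ ≤ 1 + c * T ^ 2 := by nlinarith [h.integral_exp_le]
    _ ≤ _ := by linarith [Real.add_one_le_exp (c * T ^ 2)]

theorem cosh_sub_le_of_small {s x y : ℝ} :
    Real.cosh (2 * s * (x - y)) ≤ Real.exp (4 * s ^ 2 * x ^ 2) * Real.exp (4 * s ^ 2 * y ^ 2) := by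
  refine (Real.cosh_le_exp_half_sq _).trans ?_
  rw [← Real.exp_add]
  gcongr
  nlinarith [mul_nonneg (sq_nonneg s) (sq_nonneg (x + y))]

theorem exp_two_mul_le (h : IsSubG μ T) (s x : ℝ) :
    Real.exp (2 * |s| * |x|) ≤ Real.exp (s ^ 2 * T ^ 2) * Real.exp ((x / T) ^ 2) := by
  rw [← Real.exp_add]
  gcongr
  have hT := h.pos
  have h1 : 2 * |s| * |x| = 2 * (|s| * T) * (|x| / T) := by field_simp
  have h2 : (x / T) ^ 2 = (|x| / T) ^ 2 := by rw [div_pow, div_pow, sq_abs]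
  have h3 : s ^ 2 * T ^ 2 = (|s| * T) ^ 2 := by rw [mul_pow, sq_abs]
  rw [h1, h2, h3]
  exact two_mul_le_add_sq _ _

theorem cosh_sub_le (h : IsSubG μ T) (s x y : ℝ) :
    Real.cosh (2 * s * (x - y)) ≤ (Real.exp (s ^ 2 * T ^ 2) * Real.exp ((x / T) ^ 2)) *
      (Real.exp (s ^ 2 * T ^ 2) * Real.exp ((y / T) ^ 2)) := by
  calc Real.cosh (2 * s * (x - y)) ≤ Real.exp (|2 * s * (x - y)|) := by
        rw [← Real.cosh_abs, Real.cosh_eq]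
        have : Real.exp (-|2 * s * (x - y)|) ≤ Real.exp (|2 * s * (x - y)|) := by
          gcongr; linarith [abs_nonneg (2 * s * (x - y))]
        linarith
    _ ≤ Real.exp (2 * |s| * |x|) * Real.exp (2 * |s| * |y|) := by
        rw [← Real.exp_add, abs_mul, abs_mul, abs_two]
        gcongr
        nlinarith [abs_sub x y, abs_nonneg s, mul_le_mul_of_nonneg_left (abs_sub x y) (abs_nonneg s)]
    _ ≤ _ := mul_le_mul (h.exp_two_mul_le s x) (h.exp_two_mul_le s y) (by positivity)
        (by positivity)

theorem integrable_cosh (h : IsSubG μ T) (s : ℝ) :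
    Integrable (fun p : ℝ × ℝ => Real.cosh (2 * s * (p.1 - p.2))) (μ.prod μ) := by
  have := h.prob
  have hi := (h.integrable_exp.const_mul (Real.exp (s ^ 2 * T ^ 2)))
  refine (hi.mul_prod hi).mono' ?_ (ae_of_all _ fun p => ?_)
  · exact Continuous.aestronglyMeasurable
      (Real.continuous_cosh.comp (by fun_prop))
  · rw [Real.norm_eq_abs, abs_of_pos (Real.cosh_pos _)]
    exact h.cosh_sub_le s p.1 p.2

/-- For small `s`, `cosh u ≤ exp (u² / 2)` and `(x - y)² ≤ 2 x² + 2 y²` separate the variables. For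
large `s`, the AM-GM bound loses a factor `4`, which is at most `exp (3/2) ≤ exp (6 s² T²)`. -/
theorem integral_cosh_le (h : IsSubG μ T) (s : ℝ) :
    ∫ p : ℝ × ℝ, Real.cosh (2 * s * (p.1 - p.2)) ∂(μ.prod μ) ≤ Real.exp (8 * T ^ 2 * s ^ 2) := by
  have := h.prob
  have hT := h.pos
  rcases le_total (4 * s ^ 2 * T ^ 2) 1 with hs | hs
  · have hi := h.integrable_exp_mul_sq (by positivity) hs
    have hb := h.integral_exp_mul_sq_le (by positivity) hs
    calc _ ≤ ∫ p : ℝ × ℝ, Real.exp (4 * s ^ 2 * p.1 ^ 2) * Real.exp (4 * s ^ 2 * p.2 ^ 2)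
          ∂(μ.prod μ) :=
          integral_mono (h.integrable_cosh s) (hi.mul_prod hi) fun p => cosh_sub_le_of_small
      _ = (∫ x, Real.exp (4 * s ^ 2 * x ^ 2) ∂μ) * (∫ x, Real.exp (4 * s ^ 2 * x ^ 2) ∂μ) :=
          integral_prod_mul (fun x => Real.exp (4 * s ^ 2 * x ^ 2))
            (fun x => Real.exp (4 * s ^ 2 * x ^ 2))
      _ ≤ Real.exp (4 * s ^ 2 * T ^ 2) * Real.exp (4 * s ^ 2 * T ^ 2) := by
          gcongr
      _ = _ := by rw [← Real.exp_add]; ring_nf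
  · have hi := (h.integrable_exp.const_mul (Real.exp (s ^ 2 * T ^ 2)))
    calc _ ≤ ∫ p : ℝ × ℝ, (Real.exp (s ^ 2 * T ^ 2) * Real.exp ((p.1 / T) ^ 2)) *
          (Real.exp (s ^ 2 * T ^ 2) * Real.exp ((p.2 / T) ^ 2)) ∂(μ.prod μ) :=
          integral_mono (h.integrable_cosh s) (hi.mul_prod hi) fun p => h.cosh_sub_le s p.1 p.2
      _ = (∫ x, Real.exp (s ^ 2 * T ^ 2) * Real.exp ((x / T) ^ 2) ∂μ) *
          (∫ x, Real.exp (s ^ 2 * T ^ 2) * Real.exp ((x / T) ^ 2) ∂μ) :=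
          integral_prod_mul (fun x => Real.exp (s ^ 2 * T ^ 2) * Real.exp ((x / T) ^ 2))
            (fun x => Real.exp (s ^ 2 * T ^ 2) * Real.exp ((x / T) ^ 2))
      _ ≤ (Real.exp (s ^ 2 * T ^ 2) * 2) * (Real.exp (s ^ 2 * T ^ 2) * 2) := by
          have hb : ∫ x, Real.exp (s ^ 2 * T ^ 2) * Real.exp ((x / T) ^ 2) ∂μ ≤
              Real.exp (s ^ 2 * T ^ 2) * 2 := by
            rw [integral_const_mul]
            gcongr
            exact h.integral_exp_le
          have h0 : 0 ≤ ∫ x, Real.exp (s ^ 2 * T ^ 2) * Real.exp ((x / T) ^ 2) ∂μ :=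
            integral_nonneg fun x => by positivity
          gcongr
      _ = Real.exp (2 * (s ^ 2 * T ^ 2)) * 4 := by
          rw [show 2 * (s ^ 2 * T ^ 2) = s ^ 2 * T ^ 2 + s ^ 2 * T ^ 2 by ring, Real.exp_add]
          ring
      _ ≤ Real.exp (2 * (s ^ 2 * T ^ 2)) * Real.exp (6 * (s ^ 2 * T ^ 2)) := by
          gcongr
          have h1 : Real.exp (3 / 2) ≤ Real.exp (6 * (s ^ 2 * T ^ 2)) := by
            gcongr; linarith
          have h2 : (4 : ℝ) ≤ Real.exp (3 / 2) := by
            have h3 := Real.exp_one_gt_d9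
            have h4 := Real.add_one_le_exp (1 / 2 : ℝ)
            have h5 : Real.exp (3 / 2) = Real.exp 1 * Real.exp (1 / 2) := by
              rw [← Real.exp_add]; norm_num
            rw [h5]
            nlinarith
          linarith
      _ = _ := by rw [← Real.exp_add]; ring_nf

theorem integrable_sub_sq (h : IsSubG μ T) :
    Integrable (fun p : ℝ × ℝ => (p.1 - p.2) ^ 2) (μ.prod μ) := by
  have := h.prob
  refine (((h.integrable_sq.comp_fst μ).add (h.integrable_sq.comp_snd μ)).const_mul 2).mono'
    (by fun_prop) (ae_of_all _ fun p => ?_)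
  simp only [Real.norm_eq_abs, abs_pow, sq_abs, Pi.add_apply]
  nlinarith [sq_nonneg (p.1 + p.2)]

theorem integral_sub_sq (h : IsSubG μ T) : ∫ p : ℝ × ℝ, (p.1 - p.2) ^ 2 ∂(μ.prod μ) = 2 := by
  have := h.prob
  have e : ∀ p : ℝ × ℝ, (p.1 - p.2) ^ 2 = (p.1 ^ 2 + p.2 ^ 2) - 2 * (p.1 * p.2) := fun p => by ring
  simp_rw [e]
  have hA : Integrable (fun p : ℝ × ℝ => p.1 ^ 2 + p.2 ^ 2) (μ.prod μ) :=
    (h.integrable_sq.comp_fst μ).add (h.integrable_sq.comp_snd μ)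
  rw [integral_sub hA
      ((h.integrable_id.mul_prod h.integrable_id).const_mul 2),
    integral_add (h.integrable_sq.comp_fst μ) (h.integrable_sq.comp_snd μ), integral_const_mul,
    integral_prod_mul (fun x : ℝ => x) (fun x : ℝ => x), h.mean_zero,
    integral_fun_fst (fun x : ℝ => x ^ 2), integral_fun_snd (fun x : ℝ => x ^ 2), h.sq_one]
  norm_num

theorem integrable_sub_fourth (h : IsSubG μ T) :
    Integrable (fun p : ℝ × ℝ => (p.1 - p.2) ^ 4) (μ.prod μ) := by
  have := h.prob
  refine (((h.integrable_fourth.comp_fst μ).add (h.integrable_fourth.comp_snd μ)).const_mul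
    8).mono' (by fun_prop) (ae_of_all _ fun p => ?_)
  rw [Real.norm_of_nonneg (by positivity)]
  simp only [Pi.add_apply]
  nlinarith [sq_nonneg (p.1 + p.2), sq_nonneg (p.1 ^ 2 - p.2 ^ 2), sq_nonneg (p.1 - p.2),
    mul_nonneg (sq_nonneg (p.1 + p.2)) (sq_nonneg (p.1 - p.2)),
    sq_nonneg ((p.1 + p.2) ^ 2), sq_nonneg (p.1 ^ 2 + p.2 ^ 2)]

theorem integral_sub_fourth_le (h : IsSubG μ T) :
    ∫ p : ℝ × ℝ, (p.1 - p.2) ^ 4 ∂(μ.prod μ) ≤ 64 * T ^ 4 := by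
  have := h.prob
  calc _ ≤ ∫ p : ℝ × ℝ, 8 * (p.1 ^ 4 + p.2 ^ 4) ∂(μ.prod μ) := by
        refine integral_mono h.integrable_sub_fourth
          (((h.integrable_fourth.comp_fst μ).add (h.integrable_fourth.comp_snd μ)).const_mul 8)
          fun p => ?_
        show (p.1 - p.2) ^ 4 ≤ 8 * (p.1 ^ 4 + p.2 ^ 4)
        nlinarith [sq_nonneg (p.1 + p.2), sq_nonneg (p.1 ^ 2 - p.2 ^ 2), sq_nonneg (p.1 - p.2),
          mul_nonneg (sq_nonneg (p.1 + p.2)) (sq_nonneg (p.1 - p.2)),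
          sq_nonneg ((p.1 + p.2) ^ 2), sq_nonneg (p.1 ^ 2 + p.2 ^ 2)]
    _ ≤ _ := by
        rw [integral_const_mul, integral_add (h.integrable_fourth.comp_fst μ)
          (h.integrable_fourth.comp_snd μ), integral_fun_fst (fun x : ℝ => x ^ 4),
          integral_fun_snd (fun x : ℝ => x ^ 4)]
        simp only [probReal_univ, one_smul]
        linarith [h.integral_fourth_le]

theorem integrable_exp_neg_symLaw (h : IsSubG μ T) {b : ℝ} (hb : 0 ≤ b) (s : ℝ) :
    Integrable (fun p : ℝ × ℝ => Real.exp (-(2 * (p.1 - p.2) * s) - (p.1 - p.2) ^ 2 * b))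
      (μ.prod μ) := by
  refine ((h.integrable_cosh s).const_mul 2).mono' (by fun_prop) (ae_of_all _ fun p => ?_)
  rw [Real.norm_of_nonneg (Real.exp_pos _).le, Real.cosh_eq]
  have h1 : Real.exp (-(2 * (p.1 - p.2) * s) - (p.1 - p.2) ^ 2 * b) ≤
      Real.exp (-(2 * s * (p.1 - p.2))) := by
    gcongr
    nlinarith [mul_nonneg (sq_nonneg (p.1 - p.2)) hb]
  linarith [Real.exp_pos (2 * s * (p.1 - p.2))]

/-- Symmetry replaces the linear exponential by `cosh (2 s z)`, where `z = x - x'`. With `y = b z²`,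
the bounds `cosh ≥ 1` and `exp (-y) ≤ 1 - y + y² / 2` give `cosh · exp (-y) ≤ cosh - y + y² / 2`. As
`E z² = 2` and `E z⁴ ≤ 64 T⁴`, the last two terms contribute at most `-2 b + 32 T⁴ b² ≤ -b`. -/
theorem integral_exp_neg_symLaw_le (h : IsSubG μ T) {b : ℝ} (hb : 0 ≤ b)
    (hbT : 32 * T ^ 4 * b ≤ 1) (s : ℝ) :
    ∫ p : ℝ × ℝ, Real.exp (-(2 * (p.1 - p.2) * s) - (p.1 - p.2) ^ 2 * b) ∂(μ.prod μ) ≤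
      Real.exp (8 * T ^ 2 * s ^ 2) - b := by
  have := h.prob
  set F : ℝ × ℝ → ℝ := fun p => Real.exp (-(2 * (p.1 - p.2) * s) - (p.1 - p.2) ^ 2 * b) with hF
  have hFi : Integrable F (μ.prod μ) := h.integrable_exp_neg_symLaw hb s
  have hswap : ∫ p, F p ∂(μ.prod μ) = ∫ p, F p.swap ∂(μ.prod μ) :=
    (integral_prod_swap F).symm
  have hJ : Integrable (fun p : ℝ × ℝ => Real.cosh (2 * s * (p.1 - p.2)) - b * (p.1 - p.2) ^ 2)
      (μ.prod μ) := (h.integrable_cosh s).sub (h.integrable_sub_sq.const_mul b)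
  have hI := hJ.add (h.integrable_sub_fourth.const_mul (b ^ 2 / 2))
  have hmain : ∫ p, (F p + F p.swap) / 2 ∂(μ.prod μ) ≤
      ∫ p : ℝ × ℝ, (Real.cosh (2 * s * (p.1 - p.2)) - b * (p.1 - p.2) ^ 2 +
        b ^ 2 / 2 * (p.1 - p.2) ^ 4) ∂(μ.prod μ) := by
    refine integral_mono ((hFi.add hFi.swap).div_const 2) hI fun p => ?_
    have e1 : (F p + F p.swap) / 2 =
        Real.cosh (2 * s * (p.1 - p.2)) * Real.exp (-((p.1 - p.2) ^ 2 * b)) := by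
      simp only [hF, Prod.fst_swap, Prod.snd_swap, Real.cosh_eq]
      rw [div_mul_eq_mul_div, add_mul, ← Real.exp_add, ← Real.exp_add, add_comm]
      ring_nf
    rw [e1]
    have h1 := Real.one_le_cosh (2 * s * (p.1 - p.2))
    have hz : 0 ≤ (p.1 - p.2) ^ 2 * b := by positivity
    have h2 : Real.exp (-((p.1 - p.2) ^ 2 * b)) ≤ 1 := Real.exp_le_one_iff.2 (by linarith)
    have h3 : Real.exp (-((p.1 - p.2) ^ 2 * b)) ≤
        1 - (p.1 - p.2) ^ 2 * b + ((p.1 - p.2) ^ 2 * b) ^ 2 / 2 := by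
      have h4 := Real.quadratic_le_exp_of_nonneg hz
      rw [Real.exp_neg]
      set y := (p.1 - p.2) ^ 2 * b
      have h5 : 0 < 1 + y + y ^ 2 / 2 := by positivity
      calc (Real.exp y)⁻¹ ≤ (1 + y + y ^ 2 / 2)⁻¹ := by gcongr
        _ ≤ _ := by
          rw [inv_le_iff_one_le_mul₀ h5]
          nlinarith [pow_nonneg hz 4]
    simp only
    nlinarith
  have e2 : ∫ p, (F p + F p.swap) / 2 ∂(μ.prod μ) = ∫ p, F p ∂(μ.prod μ) := by
    have h7 : Integrable (fun p => F p.swap) (μ.prod μ) := hFi.swap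
    rw [integral_div, integral_add hFi h7, ← hswap]
    ring
  rw [e2, integral_add hJ
    (h.integrable_sub_fourth.const_mul (b ^ 2 / 2)),
    integral_sub (h.integrable_cosh s) (h.integrable_sub_sq.const_mul b), integral_const_mul,
    integral_const_mul, h.integral_sub_sq] at hmain
  have h4 := h.integral_sub_fourth_le
  have h5 := h.integral_cosh_le s
  have h6 : b ^ 2 / 2 * ∫ p : ℝ × ℝ, (p.1 - p.2) ^ 4 ∂(μ.prod μ) ≤ b ^ 2 / 2 * (64 * T ^ 4) := by
    gcongr
  nlinarith

theorem integrable_exp_neg_lazyLaw (h : IsSubG μ T) {b : ℝ} (hb : 0 ≤ b) (β s : ℝ) :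
    Integrable (fun z : ℝ => Real.exp (-(2 * z * s) - z ^ 2 * b)) (lazyLaw β (symLaw μ)) := by
  refine integrable_lazyLaw ?_
  rw [symLaw, integrable_map_measure (by fun_prop) (by fun_prop)]
  exact h.integrable_exp_neg_symLaw hb s

/-- With `y = exp (8 T² s²) ≥ 1`, the mixture is at most `(1 - β) + β (y - b)`. This is below `y (1
- β b)` because the difference is `(y - 1) (1 - β - β b) ≥ 0`. -/
theorem integral_exp_neg_lazyLaw_le (h : IsSubG μ T) {b : ℝ} (hb : 0 ≤ b)
    (hbT : 32 * T ^ 4 * b ≤ 1) (hb1 : b ≤ 1) {β : ℝ} (h0 : 0 ≤ β) (h1 : β ≤ 1 / 2) (s : ℝ) :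
    ∫ z : ℝ, Real.exp (-(2 * z * s) - z ^ 2 * b) ∂(lazyLaw β (symLaw μ)) ≤
      Real.exp (8 * T ^ 2 * s ^ 2 - β * b) := by
  have hi : Integrable (fun z : ℝ => Real.exp (-(2 * z * s) - z ^ 2 * b)) (symLaw μ) := by
    rw [symLaw, integrable_map_measure (by fun_prop) (by fun_prop)]
    exact h.integrable_exp_neg_symLaw hb s
  rw [integral_lazyLaw h0 (by linarith) hi, symLaw, integral_map (by fun_prop) (by fun_prop)]
  have key := h.integral_exp_neg_symLaw_le hb hbT s
  set I := ∫ p : ℝ × ℝ, Real.exp (-(2 * (p.1 - p.2) * s) - (p.1 - p.2) ^ 2 * b) ∂(μ.prod μ)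
  rw [sub_eq_add_neg (8 * T ^ 2 * s ^ 2), Real.exp_add]
  have hy : 1 ≤ Real.exp (8 * T ^ 2 * s ^ 2) := Real.one_le_exp (by positivity)
  have he := Real.add_one_le_exp (-(β * b))
  set y := Real.exp (8 * T ^ 2 * s ^ 2)
  have hbb : β * b ≤ 1 / 2 := by nlinarith
  simp only [mul_zero, zero_mul, neg_zero, ne_eq, OfNat.ofNat_ne_zero, not_false_eq_true, zero_pow,
    sub_zero, Real.exp_zero, smul_eq_mul, mul_one]
  have h7 : β * I ≤ β * (y - b) := by gcongr
  have h8 : y * (-(β * b) + 1) ≤ y * Real.exp (-(β * b)) := by gcongr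
  nlinarith

end IsSubG

/-! ### Laplace transform of a random quadratic form, one coordinate at a time. -/

section Sequential

variable {ι E : Type*} [Fintype ι] [DecidableEq ι] [NormedAddCommGroup E] [InnerProductSpace ℝ E]

/-- Integrating out the coordinate `i` turns the current form `B` into `B - K B(w i, ·)²` and gains
`β B(w i, w i)`. The gain must not degenerate as `B` shrinks. The third property is the dual form of
`B ≥ (1 / lam + 2 K ∑ w_j w_jᵀ)⁻¹`; since `2 K M lam ≤ 1`, it keeps `B ≥ lam / 2` throughout. -/
theorem exists_form_lmarginal_le {η : ι → Measure ℝ} [∀ i, SigmaFinite (η i)] {w : ι → E}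
    {lam K M β : ℝ} (hlam : 0 < lam) (hK : 0 < K)
    (hw : ∀ p, ∑ i, (inner ℝ (w i) p) ^ 2 ≤ M * ‖p‖ ^ 2) (hwM : ∀ i, ‖w i‖ ^ 2 ≤ M)
    (hKM : 2 * K * M * lam ≤ 1) (hβ : 0 ≤ β)
    (hstep : ∀ i (b s : ℝ), 0 ≤ b → b ≤ lam * M →
      ∫⁻ z, ENNReal.ofReal (Real.exp (-(2 * z * s) - z ^ 2 * b)) ∂(η i) ≤
        ENNReal.ofReal (Real.exp (K * s ^ 2 - β * b))) (S : Finset ι) :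
    ∃ B : E →ₗ[ℝ] E →ₗ[ℝ] ℝ, (∀ u v, B u v = B v u) ∧ (∀ v, B v v ≤ lam * ‖v‖ ^ 2) ∧
      (∀ v p, 2 * inner ℝ p v - (‖p‖ ^ 2 / lam + 2 * K * ∑ j ∈ S, (inner ℝ (w j) p) ^ 2) ≤ B v v) ∧
      ∀ x : ι → ℝ, (∫⋯∫⁻_S, (fun z => ENNReal.ofReal (Real.exp (-(lam * ‖∑ i, z i • w i‖ ^ 2))))
        ∂η) x ≤ ENNReal.ofReal (Real.exp (-(B (∑ i ∈ Sᶜ, x i • w i) (∑ i ∈ Sᶜ, x i • w i)) -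
          β * (lam / 2) * ∑ i ∈ S, ‖w i‖ ^ 2)) := by
  have hmeas : Measurable
      (fun z : ι → ℝ => ENNReal.ofReal (Real.exp (-(lam * ‖∑ i, z i • w i‖ ^ 2)))) := by
    refine ENNReal.measurable_ofReal.comp (Continuous.measurable ?_)
    fun_prop
  induction S using Finset.induction_on with
  | empty =>
    refine ⟨lam • innerₗ E, fun u v => by simp [real_inner_comm], fun v => by simp, fun v p => ?_,
      fun x => ?_⟩
    swap
    · simp only [lmarginal_empty, Finset.compl_empty, LinearMap.smul_apply, innerₗ_apply_apply,
        smul_eq_mul, real_inner_self_eq_norm_sq, Finset.sum_empty, mul_zero, sub_zero, le_refl]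
    simp only [Finset.sum_empty, mul_zero, add_zero, LinearMap.smul_apply, innerₗ_apply_apply,
      smul_eq_mul, real_inner_self_eq_norm_sq]
    have h1 : 0 ≤ ‖lam • v - p‖ ^ 2 / lam := by positivity
    rw [@norm_sub_sq_real, inner_smul_left, norm_smul, Real.norm_of_nonneg hlam.le,
      real_inner_comm] at h1
    have h2 : ((lam * ‖v‖) ^ 2 - 2 * ((starRingEnd ℝ) lam * inner ℝ p v) + ‖p‖ ^ 2) / lam =
      lam * ‖v‖ ^ 2 - 2 * inner ℝ p v + ‖p‖ ^ 2 / lam := by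
      simp only [conj_trivial]
      field_simp
    linarith
  | insert i S hi ih =>
    obtain ⟨B, hsymm, hupper, hlower, hbound⟩ := ih
    have hb0 : 0 ≤ B (w i) (w i) := by simpa using hlower (w i) 0
    have hbM : B (w i) (w i) ≤ lam * M := (hupper _).trans (by gcongr; exact hwM i)
    -- The dual bound is tested at `p = (lam / 2) w i`, which would be optimal if the dual form were
    -- `2 ‖p‖² / lam`.
    have hbl : lam / 2 * ‖w i‖ ^ 2 ≤ B (w i) (w i) := by
      have h1 := hlower (w i) ((lam / 2) • w i)
      have h2 : ∑ j ∈ S, (inner ℝ (w j) ((lam / 2) • w i)) ^ 2 ≤ M * ‖(lam / 2) • w i‖ ^ 2 :=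
        (Finset.sum_le_sum_of_subset_of_nonneg (Finset.subset_univ _)
          fun _ _ _ => sq_nonneg _).trans (hw _)
      rw [inner_smul_left, real_inner_self_eq_norm_sq, norm_smul,
        Real.norm_of_nonneg (by positivity)] at h1
      rw [norm_smul, Real.norm_of_nonneg (by positivity)] at h2
      simp only [conj_trivial] at h1
      have h3 : (lam / 2 * ‖w i‖) ^ 2 / lam = lam / 4 * ‖w i‖ ^ 2 := by field_simp; ring
      rw [h3] at h1
      have h4 : 2 * K * ∑ j ∈ S, (inner ℝ (w j) ((lam / 2) • w i)) ^ 2 ≤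
          2 * K * (M * (lam / 2 * ‖w i‖) ^ 2) := by gcongr
      have h5 : 2 * K * (M * (lam / 2 * ‖w i‖) ^ 2) =
        (2 * K * M * lam) * (lam / 4 * ‖w i‖ ^ 2) := by ring
      have h6 : (2 * K * M * lam) * (lam / 4 * ‖w i‖ ^ 2) ≤ 1 * (lam / 4 * ‖w i‖ ^ 2) := by
        gcongr
      linarith
    refine ⟨B - K • (B (w i)).smulRight (B (w i)), fun u v => ?_, fun v => ?_, fun v p => ?_,
      fun x => ?_⟩
    · simp [hsymm u v, mul_comm]
    · simp only [LinearMap.sub_apply, LinearMap.smul_apply, LinearMap.smulRight_apply, smul_eq_mul]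
      nlinarith [hupper v, mul_nonneg hK.le (mul_self_nonneg (B (w i) v))]
    · rw [Finset.sum_insert hi]
      set s := B (w i) v with hs
      set q := inner ℝ (w i) p with hq
      set b := B (w i) (w i) with hb
      -- Shifting `v` by `-K s w i` reproduces the rank-one update up to the term `K² s² b`, where
      -- `K b ≤ 1/2`. The remaining defect is controlled by `(2 q - s)² ≥ 0`, whence the factor `2`
      -- in front of `K` in the dual form.
      have h1 := hlower (v + (-(K * s)) • w i) p
      have h2 : B (v + (-(K * s)) • w i) (v + (-(K * s)) • w i) =
          B v v - 2 * K * s ^ 2 + K ^ 2 * s ^ 2 * b := by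
        simp only [map_add, map_smul, LinearMap.add_apply, LinearMap.smul_apply, smul_eq_mul,
          hsymm v (w i), ← hs, ← hb]
        ring
      have h3 : inner ℝ p (v + (-(K * s)) • w i) = inner ℝ p v - K * s * q := by
        rw [inner_add_right, inner_smul_right, real_inner_comm (w i) p]
        ring
      rw [h2, h3] at h1
      simp only [LinearMap.sub_apply, LinearMap.smul_apply, LinearMap.smulRight_apply, smul_eq_mul,
        ← hs]
      have h4 : K * b ≤ 1 / 2 := by nlinarith
      have h5 : K * s ^ 2 * (K * b) ≤ K * s ^ 2 * (1 / 2) := by gcongr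
      nlinarith [mul_nonneg hK.le (sq_nonneg (2 * q - s))]
    · rw [lmarginal_insert _ hmeas hi]
      set v := ∑ j ∈ (insert i S)ᶜ, x j • w j with hv
      have hsum : ∀ z : ℝ, ∑ j ∈ Sᶜ, Function.update x i z j • w j = v + z • w i := by
        intro z
        have h1 : Sᶜ = insert i (insert i S)ᶜ := by
          ext j
          by_cases hj : j = i <;> simp [hj, hi]
        rw [h1, Finset.sum_insert (by simp), Function.update_self, add_comm, hv]
        congr 1
        refine Finset.sum_congr rfl fun j hj => ?_
        rw [Function.update_of_ne]
        rintro rfl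
        simp at hj
      calc _ ≤ ∫⁻ z, ENNReal.ofReal (Real.exp (-(B v v) -
            β * (lam / 2) * ∑ i ∈ S, ‖w i‖ ^ 2)) * ENNReal.ofReal
              (Real.exp (-(2 * z * B (w i) v) - z ^ 2 * B (w i) (w i))) ∂(η i) := by
            refine lintegral_mono fun z => (hbound _).trans_eq ?_
            rw [hsum, ← ENNReal.ofReal_mul (Real.exp_pos _).le, ← Real.exp_add]
            congr 2
            simp only [map_add, map_smul, LinearMap.add_apply, LinearMap.smul_apply, smul_eq_mul,
              hsymm v (w i)]
            ring
        _ ≤ ENNReal.ofReal (Real.exp (-(B v v) -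
            β * (lam / 2) * ∑ i ∈ S, ‖w i‖ ^ 2)) *
              ENNReal.ofReal (Real.exp (K * (B (w i) v) ^ 2 - β * B (w i) (w i))) := by
            rw [lintegral_const_mul' _ _ ENNReal.ofReal_ne_top]
            gcongr
            exact hstep i _ _ hb0 hbM
        _ ≤ _ := by
            rw [← ENNReal.ofReal_mul (Real.exp_pos _).le, ← Real.exp_add]
            refine ENNReal.ofReal_le_ofReal (Real.exp_le_exp.2 ?_)
            rw [Finset.sum_insert hi]
            simp only [LinearMap.sub_apply, LinearMap.smul_apply, LinearMap.smulRight_apply,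
              smul_eq_mul]
            have := mul_le_mul_of_nonneg_left hbl hβ
            nlinarith

theorem lintegral_exp_neg_norm_sq_sum_le {η : ι → Measure ℝ} [∀ i, SigmaFinite (η i)] {w : ι → E}
    {lam K M β : ℝ} (hlam : 0 < lam) (hK : 0 < K) (hM : 0 ≤ M)
    (hw : ∀ p, ∑ i, (inner ℝ (w i) p) ^ 2 ≤ M * ‖p‖ ^ 2) (hKM : 2 * K * M * lam ≤ 1)
    (hβ : 0 ≤ β)
    (hstep : ∀ i (b s : ℝ), 0 ≤ b → b ≤ lam * M →
      ∫⁻ z, ENNReal.ofReal (Real.exp (-(2 * z * s) - z ^ 2 * b)) ∂(η i) ≤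
        ENNReal.ofReal (Real.exp (K * s ^ 2 - β * b))) :
    ∫⁻ z, ENNReal.ofReal (Real.exp (-(lam * ‖∑ i, z i • w i‖ ^ 2))) ∂(Measure.pi η) ≤
      ENNReal.ofReal (Real.exp (-(β * (lam / 2) * ∑ i, ‖w i‖ ^ 2))) := by
  have hwM : ∀ i, ‖w i‖ ^ 2 ≤ M := by
    intro i
    have h1 : (inner ℝ (w i) (w i)) ^ 2 ≤ M * ‖w i‖ ^ 2 :=
      (Finset.single_le_sum (f := fun j => (inner ℝ (w j) (w i)) ^ 2) (fun _ _ => sq_nonneg _)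
        (Finset.mem_univ i)).trans (hw _)
    rw [real_inner_self_eq_norm_sq] at h1
    by_contra hc
    push Not at hc
    nlinarith
  obtain ⟨B, -, -, -, h⟩ := exists_form_lmarginal_le hlam hK hw hwM hKM hβ hstep Finset.univ
  rw [lintegral_eq_lmarginal_univ 0]
  refine (h 0).trans_eq ?_
  simp

end Sequential

theorem IsSubG.lintegral_exp_neg_lazyLaw_le {μ : Measure ℝ} {T : ℝ} (h : IsSubG μ T) {b : ℝ}
    (hb : 0 ≤ b) (hbT : 32 * T ^ 4 * b ≤ 1) (hb1 : b ≤ 1) {β : ℝ} (h0 : 0 ≤ β) (h1 : β ≤ 1 / 2)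
    (s : ℝ) :
    ∫⁻ z : ℝ, ENNReal.ofReal (Real.exp (-(2 * z * s) - z ^ 2 * b)) ∂(lazyLaw β (symLaw μ)) ≤
      ENNReal.ofReal (Real.exp (8 * T ^ 2 * s ^ 2 - β * b)) := by
  rw [← ofReal_integral_eq_lintegral_ofReal (h.integrable_exp_neg_lazyLaw hb β s)
    (ae_of_all _ fun z => (Real.exp_pos _).le)]
  exact ENNReal.ofReal_le_ofReal (h.integral_exp_neg_lazyLaw_le hb hbT hb1 h0 h1 s)

/-! ### Characteristic functions of lazy variables and the lattice energy. -/

/-- The (real, positive) characteristic function of `lazyLaw β (symLaw μ)`. -/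
noncomputable def lazyChar (β : ℝ) (μ : Measure ℝ) (u : ℝ) : ℝ := 1 - β + β * ‖charFun μ u‖ ^ 2

/-- The energy `E dist² (u (x - x'), ℤ)` for independent `x`, `x'` with law `μ`. -/
noncomputable def latticeEnergy (μ : Measure ℝ) (u : ℝ) : ℝ :=
  ∫ p : ℝ × ℝ, (u * (p.1 - p.2) - round (u * (p.1 - p.2))) ^ 2 ∂(μ.prod μ)

theorem charFun_symLaw (μ : Measure ℝ) [IsProbabilityMeasure μ] (u : ℝ) :
    charFun (symLaw μ) u = ((‖charFun μ u‖ ^ 2 : ℝ) : ℂ) := by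
  have h1 : charFun (symLaw μ) u = charFun μ u * charFun μ (-u) := by
    rw [charFun_apply_real, symLaw, integral_map (by fun_prop) (by fun_prop), charFun_apply_real,
      charFun_apply_real, ← integral_prod_mul]
    refine integral_congr_ae (ae_of_all _ fun p => ?_)
    simp only
    rw [← Complex.exp_add]
    push_cast
    ring_nf
  rw [h1, charFun_neg, Complex.mul_conj, Complex.normSq_eq_norm_sq]

theorem norm_charFun_sq_eq (μ : Measure ℝ) [IsProbabilityMeasure μ] (u : ℝ) :
    ‖charFun μ u‖ ^ 2 = ∫ p : ℝ × ℝ, Real.cos (u * (p.1 - p.2)) ∂(μ.prod μ) := by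
  have h := congrArg Complex.re (charFun_symLaw μ u)
  rw [Complex.ofReal_re, charFun_apply_real, symLaw,
    integral_map (by fun_prop) (by fun_prop)] at h
  rw [← h]
  have hi : Integrable (fun p : ℝ × ℝ => Complex.exp ((u : ℂ) * ((p.1 - p.2 : ℝ) : ℂ) * Complex.I))
      (μ.prod μ) := by
    refine (integrable_const (1 : ℝ)).mono' (by fun_prop) (ae_of_all _ fun p => ?_)
    rw [← Complex.ofReal_mul, Complex.norm_exp_ofReal_mul_I]
  rw [← Complex.reCLM_apply, ← Complex.reCLM.integral_comp_comm hi]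
  refine integral_congr_ae (ae_of_all _ fun p => ?_)
  simp only [Complex.reCLM_apply]
  rw [← Complex.ofReal_mul, Complex.exp_ofReal_mul_I_re]

theorem charFun_lazyLaw {β : ℝ} (h0 : 0 ≤ β) (h1 : β ≤ 1) (μ : Measure ℝ)
    [IsProbabilityMeasure μ] (u : ℝ) :
    charFun (lazyLaw β μ) u = (1 - β) + β * charFun μ u := by
  have hi : Integrable (fun x : ℝ => Complex.exp ((u : ℂ) * (x : ℂ) * Complex.I)) μ := by
    refine (integrable_const (1 : ℝ)).mono' (by fun_prop) (ae_of_all _ fun p => ?_)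
    rw [← Complex.ofReal_mul, Complex.norm_exp_ofReal_mul_I]
  rw [charFun_apply_real, charFun_apply_real, integral_lazyLaw h0 h1 hi]
  simp

theorem charFun_lazyLaw_symLaw {β : ℝ} (h0 : 0 ≤ β) (h1 : β ≤ 1) (μ : Measure ℝ)
    [IsProbabilityMeasure μ] (u : ℝ) :
    charFun (lazyLaw β (symLaw μ)) u = (lazyChar β μ u : ℂ) := by
  have := isProbabilityMeasure_symLaw μ
  rw [charFun_lazyLaw h0 h1, charFun_symLaw, lazyChar]
  push_cast
  ring

theorem lazyChar_nonneg {β : ℝ} (h0 : 0 ≤ β) (h1 : β ≤ 1) (μ : Measure ℝ) (u : ℝ) :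
    0 ≤ lazyChar β μ u := by
  have := mul_nonneg h0 (sq_nonneg ‖charFun μ u‖)
  unfold lazyChar
  linarith

theorem measurable_lazyChar (β : ℝ) (μ : Measure ℝ) [IsProbabilityMeasure μ] :
    Measurable (lazyChar β μ) := by
  unfold lazyChar
  have : Measurable (charFun μ) := measurable_charFun
  fun_prop

theorem lazyChar_le_one {β : ℝ} (h0 : 0 ≤ β) (μ : Measure ℝ) [IsProbabilityMeasure μ] (u : ℝ) :
    lazyChar β μ u ≤ 1 := by
  have h := norm_charFun_le_one (μ := μ) u
  have h2 : ‖charFun μ u‖ ^ 2 ≤ 1 := by nlinarith [norm_nonneg (charFun μ u)]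
  unfold lazyChar
  nlinarith

/-- From `2 |φ| ≤ 1 + |φ|²`. Halving the parameter buys a bound which is again a characteristic
function, that of a symmetrised lazy law. -/
theorem norm_charFun_lazyLaw_le {ν : ℝ} (h0 : 0 ≤ ν) (h1 : ν ≤ 1) (μ : Measure ℝ)
    [IsProbabilityMeasure μ] (u : ℝ) :
    ‖charFun (lazyLaw ν μ) u‖ ≤ lazyChar (ν / 2) μ u := by
  rw [charFun_lazyLaw h0 h1]
  refine (norm_add_le _ _).trans ?_
  have e1 : ‖(1 - (ν : ℂ))‖ = 1 - ν := by
    rw [← Complex.ofReal_one, ← Complex.ofReal_sub, Complex.norm_real,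
      Real.norm_of_nonneg (by linarith)]
  rw [e1, norm_mul, Complex.norm_real, Real.norm_of_nonneg h0, lazyChar]
  nlinarith [sq_nonneg (‖charFun μ u‖ - 1)]

/-- By periodicity the argument may be reduced to `[-π, π]`, where `cos x ≤ 1 - 2 x² / π²`. -/
theorem cos_two_pi_mul_le (y : ℝ) : Real.cos (2 * Real.pi * y) ≤ 1 - 8 * (y - round y) ^ 2 := by
  have h1 : Real.cos (2 * Real.pi * y) = Real.cos (2 * Real.pi * (y - round y)) := by
    rw [mul_sub, mul_comm (2 * Real.pi) (round y : ℝ), Real.cos_sub_int_mul_two_pi]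
  have h2 := abs_sub_round y
  have hpi := Real.pi_pos
  have h3 : |2 * Real.pi * (y - round y)| ≤ Real.pi := by
    rw [abs_mul, abs_of_pos (by positivity)]
    nlinarith
  rw [h1]
  refine (Real.cos_le_one_sub_mul_cos_sq h3).trans_eq ?_
  field_simp
  ring

theorem integrable_latticeEnergy (μ : Measure ℝ) [IsProbabilityMeasure μ] (u : ℝ) :
    Integrable (fun p : ℝ × ℝ => (u * (p.1 - p.2) - round (u * (p.1 - p.2))) ^ 2) (μ.prod μ) := by
  have hm : Measurable (fun p : ℝ × ℝ => (u * (p.1 - p.2) - round (u * (p.1 - p.2))) ^ 2) := by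
    simp_rw [round_eq]
    fun_prop
  refine (integrable_const (1 : ℝ)).mono' hm.aestronglyMeasurable (ae_of_all _ fun p => ?_)
  rw [Real.norm_of_nonneg (sq_nonneg _)]
  have := abs_sub_round (u * (p.1 - p.2))
  rw [← sq_abs]
  nlinarith [abs_nonneg (u * (p.1 - p.2) - round (u * (p.1 - p.2)))]

theorem latticeEnergy_nonneg (μ : Measure ℝ) (u : ℝ) : 0 ≤ latticeEnergy μ u :=
  integral_nonneg fun _ => sq_nonneg _

theorem lazyChar_two_pi_mul_le {β : ℝ} (h0 : 0 ≤ β) (μ : Measure ℝ)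
    [IsProbabilityMeasure μ] (u : ℝ) :
    lazyChar β μ (2 * Real.pi * u) ≤ Real.exp (-(8 * β * latticeEnergy μ u)) := by
  have h1 : ‖charFun μ (2 * Real.pi * u)‖ ^ 2 ≤ 1 - 8 * latticeEnergy μ u := by
    rw [norm_charFun_sq_eq, latticeEnergy]
    have hi := integrable_latticeEnergy μ u
    calc _ ≤ ∫ p : ℝ × ℝ, (1 - 8 * (u * (p.1 - p.2) - round (u * (p.1 - p.2))) ^ 2)
          ∂(μ.prod μ) := by
          refine integral_mono ?_ ((integrable_const 1).sub (hi.const_mul 8)) fun p => ?_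
          · refine (integrable_const (1 : ℝ)).mono' (Continuous.aestronglyMeasurable (by fun_prop))
              (ae_of_all _ fun p => ?_)
            rw [Real.norm_eq_abs]
            exact Real.abs_cos_le_one _
          · simp only
            rw [mul_assoc]
            exact cos_two_pi_mul_le _
      _ = _ := by
          rw [integral_sub (integrable_const 1) (hi.const_mul 8), integral_const_mul]
          simp
  have h2 := Real.add_one_le_exp (-(8 * β * latticeEnergy μ u))
  unfold lazyChar
  nlinarith

theorem measurable_inner_add {ι E : Type*} [NormedAddCommGroup E] [InnerProductSpace ℝ E]
    [MeasurableSpace E] [BorelSpace E] (w : ι → E) (x : ι → ℝ) :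
    Measurable fun (g : E) (i : ι) => inner ℝ (w i) g + x i := by
  refine measurable_pi_iff.2 fun i => Continuous.measurable ?_
  fun_prop

/-! ### Gaussian linearisation of quadratic exponents. -/

section Gaussian

variable {ι : Type*} [Fintype ι]

theorem integral_prod_charFun {E : Type*} [MeasurableSpace E] {G : Measure E}
    [IsProbabilityMeasure G] {η : ι → Measure ℝ} [∀ i, IsProbabilityMeasure (η i)]
    {L : E → ι → ℝ} (hL : Measurable L) :
    ∫ g, ∏ i, charFun (η i) (L g i) ∂G =
      ∫ z, ∫ g, Complex.exp ((∑ i, L g i * z i : ℝ) * Complex.I) ∂G ∂(Measure.pi η) := by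
  rw [integral_integral_swap]
  · refine integral_congr_ae (ae_of_all _ fun g => ?_)
    simp only [charFun_apply_real]
    rw [← integral_fintype_prod_eq_prod (fun i (x : ℝ) =>
      Complex.exp ((L g i : ℂ) * (x : ℂ) * Complex.I))]
    refine integral_congr_ae (ae_of_all _ fun z => ?_)
    simp only
    rw [← Complex.exp_sum, ← Finset.sum_mul]
    push_cast
    rfl
  · refine (integrable_const (1 : ℝ)).mono' ?_ (ae_of_all _ fun p => ?_)
    · refine Measurable.aestronglyMeasurable ?_
      have : ∀ i, Measurable fun a : (ι → ℝ) × E => L a.2 i := fun i =>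
        (measurable_pi_apply i).comp (hL.comp measurable_snd)
      fun_prop
    · simp only [Function.uncurry]
      rw [Complex.norm_exp_ofReal_mul_I]

theorem integral_gaussianReal_exp (a : ℝ) :
    ∫ θ, Complex.exp ((θ * a : ℝ) * Complex.I) ∂(gaussianReal 0 1) =
      (Real.exp (-(a ^ 2 / 2)) : ℂ) := by
  have h := charFun_gaussianReal (μ := 0) (v := 1) a
  rw [charFun_apply_real] at h
  simp only [NNReal.coe_one, Complex.ofReal_one, Complex.ofReal_zero, mul_zero, zero_mul, zero_sub,
    one_mul] at h
  push_cast
  rw [← h]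
  simp_rw [mul_comm (a : ℂ)]

variable {E : Type*} [NormedAddCommGroup E] [InnerProductSpace ℝ E] [FiniteDimensional ℝ E]
  [MeasurableSpace E] [BorelSpace E]

theorem integral_stdGaussian_exp (t : E) :
    ∫ g, Complex.exp ((inner ℝ t g : ℝ) * Complex.I) ∂(stdGaussian E) =
      (Real.exp (-(‖t‖ ^ 2 / 2)) : ℂ) := by
  have h := charFun_stdGaussian t
  rw [charFun_apply] at h
  simp_rw [real_inner_comm t] at h
  rw [h]
  push_cast
  ring_nf

theorem ofReal_norm_integral_le_lintegral {α F : Type*} [MeasurableSpace α] [NormedAddCommGroup F]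
    [NormedSpace ℝ F] {G : Measure α} {f : α → F} {g : α → ℝ} (h : ∀ a, ‖f a‖ ≤ g a) :
    ENNReal.ofReal ‖∫ a, f a ∂G‖ ≤ ∫⁻ a, ENNReal.ofReal (g a) ∂G := by
  rw [ofReal_norm]
  refine (enorm_integral_le_lintegral_enorm _).trans (lintegral_mono fun a => ?_)
  rw [← ofReal_norm]
  exact ENNReal.ofReal_le_ofReal (h a)

/-- `exp (-|a|² / 2)` is the characteristic function of a standard Gaussian. By Fubini, averaging
first over `z` yields a product of characteristic functions, to which absolute values are applied.
-/
theorem lintegral_exp_neg_le_lintegral_lazyChar {ν : ℝ} (h0 : 0 ≤ ν) (h1 : ν ≤ 1)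
    (μ : ι → Measure ℝ) [∀ i, IsProbabilityMeasure (μ i)] (w : ι → E) (y₁ y₂ : ι → ℝ) :
    ∫⁻ z, ENNReal.ofReal (Real.exp (-((‖∑ i, z i • w i‖ ^ 2 + (∑ i, z i * y₁ i) ^ 2 +
      (∑ i, z i * y₂ i) ^ 2) / 2))) ∂(Measure.pi fun i => lazyLaw ν (μ i)) ≤
    ∫⁻ p, ENNReal.ofReal (∏ i, lazyChar (ν / 2) (μ i)
      (inner ℝ (w i) p.2 + p.1.1 * y₁ i + p.1.2 * y₂ i))
      ∂(((gaussianReal 0 1).prod (gaussianReal 0 1)).prod (stdGaussian E)) := by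
  have := fun i => isProbabilityMeasure_lazyLaw h0 h1 (μ i)
  set G := ((gaussianReal 0 1).prod (gaussianReal 0 1)).prod (stdGaussian E)
  have hL : Measurable fun (p : (ℝ × ℝ) × E) (i : ι) =>
      inner ℝ (w i) p.2 + p.1.1 * y₁ i + p.1.2 * y₂ i := by
    refine measurable_pi_iff.2 fun i => Continuous.measurable ?_
    fun_prop
  have key := integral_prod_charFun (G := G) (η := fun i => lazyLaw ν (μ i)) hL
  have hin : ∀ z : ι → ℝ, ∫ p : (ℝ × ℝ) × E, Complex.exp ((∑ i, (inner ℝ (w i) p.2 + p.1.1 * y₁ i +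
      p.1.2 * y₂ i) * z i : ℝ) * Complex.I) ∂G =
      ((Real.exp (-((‖∑ i, z i • w i‖ ^ 2 + (∑ i, z i * y₁ i) ^ 2 +
      (∑ i, z i * y₂ i) ^ 2) / 2)) : ℝ) : ℂ) := by
    intro z
    have e1 : ∀ p : (ℝ × ℝ) × E, Complex.exp ((∑ i, (inner ℝ (w i) p.2 + p.1.1 * y₁ i +
      p.1.2 * y₂ i) * z i : ℝ) * Complex.I) =
        (Complex.exp ((p.1.1 * (∑ i, z i * y₁ i) : ℝ) * Complex.I) *
          Complex.exp ((p.1.2 * (∑ i, z i * y₂ i) : ℝ) * Complex.I)) *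
          Complex.exp ((inner ℝ (∑ i, z i • w i) p.2 : ℝ) * Complex.I) := by
      intro p
      rw [← Complex.exp_add, ← Complex.exp_add, ← add_mul, ← add_mul, ← Complex.ofReal_add,
        ← Complex.ofReal_add, sum_inner, Finset.mul_sum, Finset.mul_sum, ← Finset.sum_add_distrib,
        ← Finset.sum_add_distrib]
      congr 3
      refine Finset.sum_congr rfl fun i _ => ?_
      rw [real_inner_smul_left]
      ring
    simp_rw [e1]
    rw [integral_prod_mul (fun q : ℝ × ℝ => Complex.exp ((q.1 * (∑ i, z i * y₁ i) : ℝ) * Complex.I) *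
          Complex.exp ((q.2 * (∑ i, z i * y₂ i) : ℝ) * Complex.I))
        (fun g : E => Complex.exp ((inner ℝ (∑ i, z i • w i) g : ℝ) * Complex.I)),
      integral_prod_mul (fun q : ℝ => Complex.exp ((q * (∑ i, z i * y₁ i) : ℝ) * Complex.I))
        (fun q : ℝ => Complex.exp ((q * (∑ i, z i * y₂ i) : ℝ) * Complex.I)),
      integral_gaussianReal_exp, integral_gaussianReal_exp, integral_stdGaussian_exp,
      ← Complex.ofReal_mul, ← Complex.ofReal_mul, ← Real.exp_add, ← Real.exp_add]
    congr 2
    ring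
  simp_rw [hin] at key
  rw [integral_complex_ofReal] at key
  have hint : Integrable (fun z : ι → ℝ => Real.exp (-((‖∑ i, z i • w i‖ ^ 2 +
      (∑ i, z i * y₁ i) ^ 2 + (∑ i, z i * y₂ i) ^ 2) / 2)))
      (Measure.pi fun i => lazyLaw ν (μ i)) := by
    refine (integrable_const (1 : ℝ)).mono' (Continuous.aestronglyMeasurable (by fun_prop))
      (ae_of_all _ fun z => ?_)
    rw [Real.norm_of_nonneg (Real.exp_pos _).le, Real.exp_le_one_iff]
    have : 0 ≤ (‖∑ i, z i • w i‖ ^ 2 + (∑ i, z i * y₁ i) ^ 2 + (∑ i, z i * y₂ i) ^ 2) / 2 := by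
      positivity
    linarith
  rw [← ofReal_integral_eq_lintegral_ofReal hint (ae_of_all _ fun z => (Real.exp_pos _).le)]
  calc _ = ENNReal.ofReal ‖((∫ z : ι → ℝ, Real.exp (-((‖∑ i, z i • w i‖ ^ 2 +
      (∑ i, z i * y₁ i) ^ 2 + (∑ i, z i * y₂ i) ^ 2) / 2))
      ∂(Measure.pi fun i => lazyLaw ν (μ i)) : ℝ) : ℂ)‖ := by
        rw [Complex.norm_real, Real.norm_of_nonneg (integral_nonneg fun z => (Real.exp_pos _).le)]
    _ ≤ _ := by
      rw [← key]
      refine ofReal_norm_integral_le_lintegral fun p => ?_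
      rw [norm_prod]
      exact Finset.prod_le_prod (fun _ _ => norm_nonneg _) fun i _ =>
        norm_charFun_lazyLaw_le h0 h1 _ _

/-- The same linearisation read backwards. The shift `x` contributes only the unimodular phase `exp
(i ∑ x_i z_i)`, so the bound does not depend on `x`. -/
theorem lintegral_lazyChar_le_lintegral_exp_neg {β : ℝ} (h0 : 0 ≤ β) (h1 : β ≤ 1)
    (μ : ι → Measure ℝ) [∀ i, IsProbabilityMeasure (μ i)] (w : ι → E) (x : ι → ℝ) :
    ∫⁻ g, ENNReal.ofReal (∏ i, lazyChar β (μ i) (inner ℝ (w i) g + x i)) ∂(stdGaussian E) ≤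
    ∫⁻ z, ENNReal.ofReal (Real.exp (-(‖∑ i, z i • w i‖ ^ 2 / 2)))
      ∂(Measure.pi fun i => lazyLaw β (symLaw (μ i))) := by
  have := fun i => isProbabilityMeasure_symLaw (μ i)
  have := fun i => isProbabilityMeasure_lazyLaw h0 h1 (symLaw (μ i))
  have key := integral_prod_charFun (G := stdGaussian E) (η := fun i => lazyLaw β (symLaw (μ i)))
    (measurable_inner_add w x)
  have hin : ∀ z : ι → ℝ, ∫ g : E, Complex.exp ((∑ i, (inner ℝ (w i) g + x i) * z i : ℝ) *
      Complex.I) ∂(stdGaussian E) = Complex.exp ((∑ i, x i * z i : ℝ) * Complex.I) *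
        ((Real.exp (-(‖∑ i, z i • w i‖ ^ 2 / 2)) : ℝ) : ℂ) := by
    intro z
    have e1 : ∀ g : E, Complex.exp ((∑ i, (inner ℝ (w i) g + x i) * z i : ℝ) * Complex.I) =
        Complex.exp ((∑ i, x i * z i : ℝ) * Complex.I) *
          Complex.exp ((inner ℝ (∑ i, z i • w i) g : ℝ) * Complex.I) := by
      intro g
      rw [← Complex.exp_add, ← add_mul, ← Complex.ofReal_add, sum_inner, ← Finset.sum_add_distrib]
      congr 3
      refine Finset.sum_congr rfl fun i _ => ?_
      rw [real_inner_smul_left]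
      ring
    simp_rw [e1]
    rw [integral_const_mul, integral_stdGaussian_exp]
  simp_rw [hin, charFun_lazyLaw_symLaw h0 h1, ← Complex.ofReal_prod] at key
  rw [integral_complex_ofReal] at key
  have hnn : ∀ g : E, 0 ≤ ∏ i, lazyChar β (μ i) (inner ℝ (w i) g + x i) := fun g =>
    Finset.prod_nonneg fun i _ => lazyChar_nonneg h0 h1 _ _
  have hint : Integrable (fun g : E => ∏ i, lazyChar β (μ i) (inner ℝ (w i) g + x i))
      (stdGaussian E) := by
    refine (integrable_const (1 : ℝ)).mono' ?_ (ae_of_all _ fun g => ?_)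
    · refine Measurable.aestronglyMeasurable (Finset.measurable_prod _ fun i _ => ?_)
      exact (measurable_lazyChar β (μ i)).comp
        ((measurable_pi_apply i).comp (measurable_inner_add w x))
    · rw [Real.norm_of_nonneg (hnn g)]
      exact Finset.prod_le_one (fun i _ => lazyChar_nonneg h0 h1 _ _)
        fun i _ => lazyChar_le_one h0 _ _
  rw [← ofReal_integral_eq_lintegral_ofReal hint (ae_of_all _ hnn)]
  calc _ = ENNReal.ofReal ‖((∫ g : E, ∏ i, lazyChar β (μ i) (inner ℝ (w i) g + x i)
      ∂(stdGaussian E) : ℝ) : ℂ)‖ := by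
        rw [Complex.norm_real, Real.norm_of_nonneg (integral_nonneg hnn)]
    _ ≤ _ := by
      rw [key]
      refine ofReal_norm_integral_le_lintegral fun p => ?_
      rw [norm_mul, Complex.norm_exp_ofReal_mul_I, one_mul, Complex.norm_real,
        Real.norm_of_nonneg (Real.exp_pos _).le]

end Gaussian

/-! ### Integrals over sublevel-type functions, unit boxes and Gaussian moments. -/

theorem lintegral_pi_prod_eq_prod {ι : Type*} [Fintype ι] {X : ι → Type*}
    [∀ i, MeasurableSpace (X i)] {μ : ∀ i, Measure (X i)} [∀ i, IsProbabilityMeasure (μ i)]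
    {f : ∀ i, X i → ℝ≥0∞} (hf : ∀ i, Measurable (f i)) :
    ∫⁻ x, ∏ i, f i (x i) ∂(Measure.pi μ) = ∏ i, ∫⁻ y, f i y ∂(μ i) := by
  have hind := iIndepFun_pi (μ := μ) (X := f) fun i => (hf i).aemeasurable
  rw [lintegral_prod_eq_prod_lintegral_of_indepFun (μ := Measure.pi μ) Finset.univ
    (fun i (x : ∀ i, X i) => f i (x i)) hind fun i => (hf i).comp (measurable_pi_apply i)]
  refine Finset.prod_congr rfl fun i _ => ?_
  exact (measurePreserving_eval μ i).lintegral_comp (hf i)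

theorem lintegral_two_div_one_add_sq {a : ℝ} (ha : 0 < a) (t : ℝ) :
    ∫⁻ x, ENNReal.ofReal (2 * (1 + ((x - t) / a) ^ 2)⁻¹) = ENNReal.ofReal (2 * Real.pi * a) := by
  have h1 : Integrable fun x : ℝ => 2 * (1 + ((x - t) / a) ^ 2)⁻¹ :=
    (((integrable_inv_one_add_sq.comp_div ha.ne').comp_sub_right t)).const_mul 2
  rw [← ofReal_integral_eq_lintegral_ofReal h1 (ae_of_all _ fun x => by positivity)]
  congr 1
  rw [integral_const_mul, integral_sub_right_eq_self (fun x : ℝ => (1 + (x / a) ^ 2)⁻¹) t,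
    Measure.integral_comp_div (fun x : ℝ => (1 + x ^ 2)⁻¹) a, integral_univ_inv_one_add_sq,
    abs_of_pos ha, smul_eq_mul]
  ring

/-- If the sublevel sets of `f` on `I` have exponentially growing diameter, then `exp (-2 ν f)` has
small integral over `I`. -/
theorem setLIntegral_exp_neg_le {I : Set ℝ} (hI : MeasurableSet I) {f : ℝ → ℝ} (hf : ∀ x, 0 ≤ f x)
    {ρ c ν : ℝ} (hρ : 0 < ρ) (hc : 0 < c) (hν : 2 * c ≤ ν)
    (h : ∀ x ∈ I, ∀ y ∈ I, |x - y| ≤ ρ * Real.exp (c * (f x + f y))) :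
    ∫⁻ x in I, ENNReal.ofReal (Real.exp (-(2 * ν * f x))) ≤ ENNReal.ofReal (9 * ρ) := by
  rcases I.eq_empty_or_nonempty with rfl | hne
  · simp
  -- The infimum of `f` need not be attained. The slack `1 / (4 c)` costs only `exp (1/2) ≤ 2`
  -- below, and this `2` is the reason for the width `√2 ρ`.
  obtain ⟨t, htI, ht⟩ : ∃ t ∈ I, ∀ x ∈ I, f t ≤ f x + 1 / (4 * c) := by
    have hbdd : BddBelow (f '' I) := ⟨0, by rintro _ ⟨x, -, rfl⟩; exact hf x⟩
    obtain ⟨_, ⟨t, htI, rfl⟩, ht⟩ := exists_lt_of_csInf_lt (hne.image f)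
      (lt_add_of_pos_right (sInf (f '' I)) (show 0 < 1 / (4 * c) by positivity))
    exact ⟨t, htI, fun x hx => ht.le.trans (by gcongr; exact csInf_le hbdd ⟨x, hx, rfl⟩)⟩
  have hs : 0 < √2 * ρ := by positivity
  -- Comparison with a Cauchy profile centred at `t`: the diameter bound says that `((x - t) / (√2
  -- ρ))²` is at most `exp (2 ν f x)`. The profile has integral `2 π √2 ρ < 9 ρ`.
  have key : ∀ x ∈ I, Real.exp (-(2 * ν * f x)) ≤ 2 * (1 + ((x - t) / (√2 * ρ)) ^ 2)⁻¹ := by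
    intro x hx
    have hfx := hf x
    have h1 : Real.exp (-(2 * ν * f x)) ≤ 1 := Real.exp_le_one_iff.2 (by nlinarith)
    have h2 : (x - t) ^ 2 ≤ (ρ * Real.exp (c * (f x + f t))) ^ 2 := by
      rw [← sq_abs]
      gcongr
      exact h x hx t htI
    have h3 : (ρ * Real.exp (c * (f x + f t))) ^ 2 ≤ 2 * ρ ^ 2 * Real.exp (2 * ν * f x) := by
      have h5 : Real.exp (1 / 2) ≤ 2 := by
        have := Real.exp_one_lt_d9
        have h6 : Real.exp (1 / 2) ^ 2 = Real.exp 1 := by rw [← Real.exp_nat_mul]; norm_num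
        nlinarith [Real.exp_pos (1 / 2)]
      rw [mul_pow, ← Real.exp_nat_mul]
      have h4 : Real.exp ((2 : ℕ) * (c * (f x + f t))) ≤ Real.exp (1 / 2) * Real.exp (2 * ν * f x) := by
        rw [← Real.exp_add]
        gcongr
        have h7 := ht x hx
        have h8 : c * f t ≤ c * (f x + 1 / (4 * c)) := by gcongr
        have h9 : c * (f x + 1 / (4 * c)) = c * f x + 1 / 4 := by field_simp
        push_cast
        nlinarith
      calc _ ≤ ρ ^ 2 * (2 * Real.exp (2 * ν * f x)) := by
            gcongr
            exact h4.trans (by gcongr)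
        _ = _ := by ring
    have h10 : ((x - t) / (√2 * ρ)) ^ 2 ≤ Real.exp (2 * ν * f x) := by
      rw [div_pow, mul_pow, Real.sq_sqrt (by norm_num), div_le_iff₀ (by positivity)]
      linarith
    rw [← div_eq_mul_inv, le_div_iff₀ (by positivity), mul_add, mul_one]
    have h11 : Real.exp (-(2 * ν * f x)) * ((x - t) / (√2 * ρ)) ^ 2 ≤
        Real.exp (-(2 * ν * f x)) * Real.exp (2 * ν * f x) := by gcongr
    rw [← Real.exp_add, neg_add_cancel, Real.exp_zero] at h11
    linarith
  calc _ ≤ ∫⁻ x in I, ENNReal.ofReal (2 * (1 + ((x - t) / (√2 * ρ)) ^ 2)⁻¹) :=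
        setLIntegral_mono' hI fun x hx => ENNReal.ofReal_le_ofReal (key x hx)
    _ ≤ ∫⁻ x, ENNReal.ofReal (2 * (1 + ((x - t) / (√2 * ρ)) ^ 2)⁻¹) := setLIntegral_le_lintegral _ _
    _ = ENNReal.ofReal (2 * Real.pi * (√2 * ρ)) := lintegral_two_div_one_add_sq hs t
    _ ≤ _ := by
      refine ENNReal.ofReal_le_ofReal ?_
      have h1 := Real.pi_lt_d2
      have h2 : √2 < 1.415 := by
        rw [Real.sqrt_lt' (by norm_num)]; norm_num
      have h3 : Real.pi * √2 ≤ 3.15 * 1.415 := by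
        have := Real.pi_pos
        gcongr
      nlinarith

theorem gaussianPDFReal_le_of_mem_Ico {j : ℤ} {x : ℝ} (hx : x ∈ Set.Ico (j : ℝ) (j + 1)) :
    gaussianPDFReal 0 1 x ≤ Real.exp (2 - |(j : ℝ)|) := by
  rw [gaussianPDFReal]
  have h1 : (√(2 * Real.pi * ((1 : NNReal) : ℝ)))⁻¹ ≤ 1 := by
    refine inv_le_one_of_one_le₀ ?_
    rw [Real.one_le_sqrt]
    have := Real.pi_gt_three
    simp only [NNReal.coe_one]
    linarith
  have h2 : Real.exp (-(x - 0) ^ 2 / (2 * ((1 : NNReal) : ℝ))) ≤ Real.exp (2 - |(j : ℝ)|) := by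
    gcongr
    simp only [NNReal.coe_one]
    have h3 : |(j : ℝ)| ≤ |x| + 1 := by
      have h4 : |(j : ℝ) - x| ≤ 1 := by rw [abs_le]; constructor <;> linarith [hx.1, hx.2]
      linarith [abs_sub_abs_le_abs_sub (j : ℝ) x]
    nlinarith [sq_nonneg (|x| - 1), sq_abs x]
  calc _ ≤ 1 * Real.exp (2 - |(j : ℝ)|) := by gcongr
    _ = _ := one_mul _

theorem tsum_exp_two_sub_abs_ne_top :
    ∑' j : ℤ, ENNReal.ofReal (Real.exp (2 - |(j : ℝ)|)) ≠ ∞ := by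
  have h : Summable fun j : ℤ => Real.exp (2 - |(j : ℝ)|) := by
    have h1 : Summable fun n : ℕ => Real.exp (2 - (n : ℝ)) := by
      simp_rw [sub_eq_add_neg, Real.exp_add]
      exact Real.summable_exp_neg_nat.mul_left _
    refine Summable.of_nat_of_neg ?_ ?_ <;> simpa using h1
  exact h.tsum_ofReal_ne_top

/-- A bound for the supremum over all unit boxes controls the Gaussian integral. -/
theorem lintegral_gaussian_prod_le_of_box {F : ℝ × ℝ → ℝ≥0∞} (hF : Measurable F) {B : ℝ≥0∞}
    (h : ∀ i j : ℤ, ∫⁻ p in Set.Ico (i : ℝ) (i + 1) ×ˢ Set.Ico (j : ℝ) (j + 1), F p ≤ B) :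
    ∫⁻ p, F p ∂((gaussianReal 0 1).prod (gaussianReal 0 1)) ≤
      (∑' j : ℤ, ENNReal.ofReal (Real.exp (2 - |(j : ℝ)|))) ^ 2 * B := by
  rw [gaussianReal_of_var_ne_zero 0 one_ne_zero, prod_withDensity (by fun_prop) (by fun_prop),
    lintegral_withDensity_eq_lintegral_mul _ (by fun_prop) hF, ← Measure.volume_eq_prod]
  set box : ℤ × ℤ → Set (ℝ × ℝ) := fun q =>
    Set.Ico (q.1 : ℝ) (q.1 + 1) ×ˢ Set.Ico (q.2 : ℝ) (q.2 + 1) with hbox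
  have hcover : (⋃ q, box q) = Set.univ := by
    refine Set.eq_univ_of_forall fun p => Set.mem_iUnion.2 ⟨(⌊p.1⌋, ⌊p.2⌋), ?_⟩
    exact ⟨⟨Int.floor_le _, Int.lt_floor_add_one _⟩, ⟨Int.floor_le _, Int.lt_floor_add_one _⟩⟩
  rw [← setLIntegral_univ, ← hcover]
  refine (lintegral_iUnion_le _ _).trans ?_
  calc _ ≤ ∑' q : ℤ × ℤ, ENNReal.ofReal (Real.exp (2 - |(q.1 : ℝ)|)) *
        ENNReal.ofReal (Real.exp (2 - |(q.2 : ℝ)|)) * B := by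
        refine ENNReal.tsum_le_tsum fun q => ?_
        calc _ ≤ ∫⁻ p in box q, ENNReal.ofReal (Real.exp (2 - |(q.1 : ℝ)|)) *
              ENNReal.ofReal (Real.exp (2 - |(q.2 : ℝ)|)) * F p := by
              refine setLIntegral_mono' (measurableSet_Ico.prod measurableSet_Ico) fun p hp => ?_
              simp only [Pi.mul_apply, gaussianPDF]
              gcongr
              · exact gaussianPDFReal_le_of_mem_Ico hp.1
              · exact gaussianPDFReal_le_of_mem_Ico hp.2
          _ ≤ _ := by
              rw [lintegral_const_mul _ hF]
              gcongr
              exact h q.1 q.2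
    _ = _ := by
        rw [ENNReal.tsum_mul_right, ENNReal.tsum_prod (f := fun i j : ℤ =>
          ENNReal.ofReal (Real.exp (2 - |(i : ℝ)|)) * ENNReal.ofReal (Real.exp (2 - |(j : ℝ)|)))]
        simp_rw [ENNReal.tsum_mul_left]
        rw [ENNReal.tsum_mul_right, sq]

theorem lintegral_exp_sq_div_four_gaussianReal_le :
    ∫⁻ x, ENNReal.ofReal (Real.exp (x ^ 2 / 4)) ∂(gaussianReal 0 1) ≤ 2 := by
  rw [gaussianReal_of_var_ne_zero 0 one_ne_zero,
    lintegral_withDensity_eq_lintegral_mul _ (by fun_prop) (by fun_prop)]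
  have h1 : ∀ x : ℝ, (gaussianPDF 0 1 * fun x => ENNReal.ofReal (Real.exp (x ^ 2 / 4))) x =
      ENNReal.ofReal ((√(2 * Real.pi))⁻¹ * Real.exp (-(1 / 4) * x ^ 2)) := by
    intro x
    simp only [Pi.mul_apply, gaussianPDF, gaussianPDFReal]
    rw [← ENNReal.ofReal_mul (by positivity), mul_assoc, ← Real.exp_add]
    congr 3
    · simp
    · simp only [NNReal.coe_one]; ring
  simp_rw [h1]
  have hi : Integrable fun x : ℝ => (√(2 * Real.pi))⁻¹ * Real.exp (-(1 / 4) * x ^ 2) :=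
    (integrable_exp_neg_mul_sq (by norm_num)).const_mul _
  rw [← ofReal_integral_eq_lintegral_ofReal hi (ae_of_all _ fun x => by positivity),
    integral_const_mul, integral_gaussian]
  refine ENNReal.ofReal_le_of_le_toReal ?_
  have hpi := Real.pi_pos
  rw [← Real.sqrt_inv, ← Real.sqrt_mul (by positivity),
    show (2 * Real.pi)⁻¹ * (Real.pi / (1 / 4)) = 2 by field_simp; norm_num]
  simp only [ENNReal.toReal_ofNat]
  rw [Real.sqrt_le_left (by norm_num)]
  norm_num

theorem lintegral_exp_norm_sq_div_four_stdGaussian_le (k : ℕ) :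
    ∫⁻ g, ENNReal.ofReal (Real.exp (‖g‖ ^ 2 / 4)) ∂(stdGaussian (EuclideanSpace ℝ (Fin k))) ≤
      2 ^ k := by
  rw [← map_pi_eq_stdGaussian, lintegral_map (by fun_prop) (by fun_prop)]
  have h1 : ∀ x : Fin k → ℝ, ENNReal.ofReal (Real.exp (‖(WithLp.toLp 2 x)‖ ^ 2 / 4)) =
      ∏ i, ENNReal.ofReal (Real.exp (x i ^ 2 / 4)) := by
    intro x
    rw [EuclideanSpace.real_norm_sq_eq, ← ENNReal.ofReal_prod_of_nonneg
      (fun i _ => (Real.exp_pos _).le), ← Real.exp_sum, Finset.sum_div]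
  simp_rw [h1]
  rw [lintegral_pi_prod_eq_prod (f := fun _ (y : ℝ) => ENNReal.ofReal (Real.exp (y ^ 2 / 4)))
    (fun _ => by fun_prop)]
  calc _ ≤ ∏ _i : Fin k, (2 : ℝ≥0∞) := by
        gcongr
        exact lintegral_exp_sq_div_four_gaussianReal_le
    _ = _ := by simp

/-! ### Combining the two savings on a unit box. -/

section Box

variable {E : Type*} [MeasurableSpace E]

/-- For fixed `g` the integrand is a product in `θ.1` and `θ.2`, and each one-dimensional integral
is at most `9 ρ`; the weight `h` is integrated afterwards. -/
theorem lintegral_box_offcore_le {G : Measure E} [IsProbabilityMeasure G] {I J : Set ℝ}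
    (hI : MeasurableSet I) (hJ : MeasurableSet J) {e₁ e₂ : ℝ → E → ℝ}
    (he₁ : Measurable (Function.uncurry e₁)) (he₂ : Measurable (Function.uncurry e₂))
    (h₁ : ∀ x g, 0 ≤ e₁ x g) (h₂ : ∀ x g, 0 ≤ e₂ x g) {ρ c ν : ℝ} (hρ : 0 < ρ) (hc : 0 < c)
    (hν : 2 * c ≤ ν)
    (hs₁ : ∀ g, ∀ x ∈ I, ∀ y ∈ I, |x - y| ≤ ρ * Real.exp (c * (e₁ x g + e₁ y g)))
    (hs₂ : ∀ g, ∀ x ∈ J, ∀ y ∈ J, |x - y| ≤ ρ * Real.exp (c * (e₂ x g + e₂ y g)))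
    {h : E → ℝ≥0∞} (hh : Measurable h) :
    ∫⁻ θ in I ×ˢ J, ∫⁻ g, h g * (ENNReal.ofReal (Real.exp (-(2 * ν * e₁ θ.1 g))) *
        ENNReal.ofReal (Real.exp (-(2 * ν * e₂ θ.2 g)))) ∂G ≤
      (∫⁻ g, h g ∂G) * ENNReal.ofReal (81 * ρ ^ 2) := by
  have hm₁ : Measurable fun p : ℝ × E => ENNReal.ofReal (Real.exp (-(2 * ν * e₁ p.1 p.2))) := by
    have : Measurable fun p : ℝ × E => e₁ p.1 p.2 := he₁
    fun_prop
  have hm₂ : Measurable fun p : ℝ × E => ENNReal.ofReal (Real.exp (-(2 * ν * e₂ p.1 p.2))) := by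
    have : Measurable fun p : ℝ × E => e₂ p.1 p.2 := he₂
    fun_prop
  rw [lintegral_lintegral_swap]
  · rw [← lintegral_mul_const _ hh]
    refine lintegral_mono fun g => ?_
    have hg₁ : Measurable fun x => ENNReal.ofReal (Real.exp (-(2 * ν * e₁ x g))) :=
      hm₁.comp (measurable_id.prodMk measurable_const)
    have hg₂ : Measurable fun x => ENNReal.ofReal (Real.exp (-(2 * ν * e₂ x g))) :=
      hm₂.comp (measurable_id.prodMk measurable_const)
    simp only
    have hg₁₂ : Measurable fun θ : ℝ × ℝ => ENNReal.ofReal (Real.exp (-(2 * ν * e₁ θ.1 g))) *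
        ENNReal.ofReal (Real.exp (-(2 * ν * e₂ θ.2 g))) :=
      (hg₁.comp measurable_fst).mul (hg₂.comp measurable_snd)
    rw [lintegral_const_mul _ hg₁₂,
      Measure.volume_eq_prod, ← Measure.prod_restrict,
      lintegral_prod_mul hg₁.aemeasurable hg₂.aemeasurable]
    gcongr
    calc _ ≤ ENNReal.ofReal (9 * ρ) * ENNReal.ofReal (9 * ρ) := by
          gcongr
          · exact setLIntegral_exp_neg_le hI (fun x => h₁ x g) hρ hc hν (hs₁ g)
          · exact setLIntegral_exp_neg_le hJ (fun x => h₂ x g) hρ hc hν (hs₂ g)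
      _ = _ := by
          rw [← ENNReal.ofReal_mul (by positivity)]
          ring_nf
  · refine Measurable.aemeasurable ?_
    have h3 : Measurable fun p : (ℝ × ℝ) × E =>
        ENNReal.ofReal (Real.exp (-(2 * ν * e₁ p.1.1 p.2))) :=
      hm₁.comp ((measurable_fst.comp measurable_fst).prodMk measurable_snd)
    have h4 : Measurable fun p : (ℝ × ℝ) × E =>
        ENNReal.ofReal (Real.exp (-(2 * ν * e₂ p.1.2 p.2))) :=
      hm₂.comp ((measurable_snd.comp measurable_fst).prodMk measurable_snd)
    exact (hh.comp measurable_snd).mul (h3.mul h4)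

/-- All points of `A` above the box have `θ` in a square of side `2 s` about any one of them; this
area multiplies a bound in `g` that is uniform in `θ`. -/
theorem lintegral_box_core_le {G : Measure E} [IsProbabilityMeasure G] {I J : Set ℝ}
    {Ψ : (ℝ × ℝ) × E → ℝ} {A : Set ((ℝ × ℝ) × E)} {s : ℝ} (hs : 0 ≤ s)
    (hA₁ : ∀ p ∈ A, ∀ q ∈ A, p.1.1 ∈ I → q.1.1 ∈ I → |p.1.1 - q.1.1| ≤ s)
    (hA₂ : ∀ p ∈ A, ∀ q ∈ A, p.1.2 ∈ J → q.1.2 ∈ J → |p.1.2 - q.1.2| ≤ s)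
    (hIJ : MeasurableSet (I ×ˢ J)) {b : ℝ}
    (hq : ∀ θ, ∫⁻ g, ENNReal.ofReal (Ψ (θ, g)) ∂G ≤ ENNReal.ofReal b) :
    ∫⁻ θ in I ×ˢ J, ∫⁻ g, A.indicator (fun p => ENNReal.ofReal (Ψ p)) (θ, g) ∂G ≤
      ENNReal.ofReal (4 * s ^ 2 * b) := by
  by_cases hne : ∃ p ∈ A, p.1 ∈ I ×ˢ J
  · obtain ⟨p, hpA, hp⟩ := hne
    set K : Set (ℝ × ℝ) := Set.Icc (p.1.1 - s) (p.1.1 + s) ×ˢ Set.Icc (p.1.2 - s) (p.1.2 + s)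
    have hK : MeasurableSet K := measurableSet_Icc.prod measurableSet_Icc
    calc _ ≤ ∫⁻ θ in I ×ˢ J, K.indicator (fun _ => ENNReal.ofReal b) θ := by
          refine setLIntegral_mono' hIJ fun θ hθ => ?_
          by_cases hθK : θ ∈ K
          · rw [Set.indicator_of_mem hθK]
            refine (lintegral_mono fun g => ?_).trans (hq θ)
            exact Set.indicator_le_self _ _ _
          · rw [Set.indicator_of_notMem hθK, nonpos_iff_eq_zero]
            convert lintegral_zero with g
            refine Set.indicator_of_notMem (fun hg => hθK ?_) _
            have h1 := abs_le.1 (hA₁ _ hg _ hpA hθ.1 hp.1)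
            have h2 := abs_le.1 (hA₂ _ hg _ hpA hθ.2 hp.2)
            simp only at h1 h2
            exact ⟨⟨by linarith, by linarith⟩, ⟨by linarith, by linarith⟩⟩
      _ ≤ ∫⁻ θ, K.indicator (fun _ => ENNReal.ofReal b) θ := setLIntegral_le_lintegral _ _
      _ = ENNReal.ofReal (4 * s ^ 2 * b) := by
          rw [lintegral_indicator_const hK, Measure.volume_eq_prod, Measure.prod_prod,
            Real.volume_Icc, Real.volume_Icc, ← ENNReal.ofReal_mul (by linarith),
            mul_comm, ← ENNReal.ofReal_mul (by nlinarith)]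
          ring_nf
  · push Not at hne
    calc _ ≤ ∫⁻ θ in I ×ˢ J, (0 : ℝ≥0∞) := by
          refine setLIntegral_mono' hIJ fun θ hθ => ?_
          rw [nonpos_iff_eq_zero]
          convert lintegral_zero with g
          exact Set.indicator_of_notMem (fun hg => hne _ hg hθ) _
      _ ≤ _ := by simp

/-- Off the core, the integrand has enough decay to pay for both savings separately. On the core,
comparing different values of `g` enlarges the admissible `θ`-square by `exp (54 c lam k)`; since
`54 · 32 = 1728`, this uses only half of the exponent `ν lam k / 16`. -/
theorem lintegral_box_le [NormedAddCommGroup E] [BorelSpace E] {G : Measure E} [IsProbabilityMeasure G] {I J : Set ℝ}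
    (hI : MeasurableSet I) (hJ : MeasurableSet J) {e₁ e₂ : ℝ → E → ℝ}
    (he₁ : Measurable (Function.uncurry e₁)) (he₂ : Measurable (Function.uncurry e₂))
    (h₁ : ∀ x g, 0 ≤ e₁ x g) (h₂ : ∀ x g, 0 ≤ e₂ x g) {ρ c ν lam : ℝ} (hρ : 0 < ρ) (hc : 0 < c)
    (hν : 1728 * c ≤ ν) (hlam : 0 < lam) (hνlam : ν * lam ≤ 32) {k : ℕ}
    (hs₁ : ∀ g, ∀ x ∈ I, ∀ y ∈ I, |x - y| ≤ ρ * Real.exp (c * (e₁ x g + e₁ y g)))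
    (hs₂ : ∀ g, ∀ x ∈ J, ∀ y ∈ J, |x - y| ≤ ρ * Real.exp (c * (e₂ x g + e₂ y g)))
    (hc₁ : ∀ g g', ∀ x ∈ I, ∀ y ∈ I, |x - y| ≤
      ρ * Real.exp (3 / 2 * c * (e₁ x g + e₁ y g' + lam * (‖g‖ ^ 2 + ‖g'‖ ^ 2))))
    (hc₂ : ∀ g g', ∀ x ∈ J, ∀ y ∈ J, |x - y| ≤
      ρ * Real.exp (3 / 2 * c * (e₂ x g + e₂ y g' + lam * (‖g‖ ^ 2 + ‖g'‖ ^ 2))))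
    {Ψ : (ℝ × ℝ) × E → ℝ} (hΨ : ∀ p, Ψ p ≤ Real.exp (-(4 * ν * (e₁ p.1.1 p.2 + e₂ p.1.2 p.2))))
    (hΨm : Measurable Ψ)
    (hq : ∀ θ, ∫⁻ g, ENNReal.ofReal (Ψ (θ, g)) ∂G ≤ ENNReal.ofReal (Real.exp (-(ν * lam * k / 16))))
    (hG : ∫⁻ g, ENNReal.ofReal (Real.exp (‖g‖ ^ 2 / 4)) ∂G ≤ 2 ^ k) :
    ∫⁻ θ in I ×ˢ J, ∫⁻ g, ENNReal.ofReal (Ψ (θ, g)) ∂G ≤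
      ENNReal.ofReal (166 * ρ ^ 2 * Real.exp (-(ν * lam * k / 32))) := by
  have hνpos : 0 < ν := by linarith
  set A : Set ((ℝ × ℝ) × E) :=
    {p | e₁ p.1.1 p.2 + e₂ p.1.2 p.2 ≤ lam * k ∧ ‖p.2‖ ^ 2 ≤ 8 * k} with hA
  -- Half of the decay `4 ν (e₁ + e₂)` is kept for the `θ`-integration. The other half gives the
  -- first summand if the energy exceeds `lam k`. The second summand exceeds `1` if `‖g‖² > 8 k`,
  -- and its Gaussian mean is at most `exp (-2 k) 2 ^ k`.
  set h : E → ℝ≥0∞ := fun g => ENNReal.ofReal (Real.exp (-(2 * ν * lam * k))) +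
    ENNReal.ofReal (Real.exp (-(2 * k))) * ENNReal.ofReal (Real.exp (‖g‖ ^ 2 / 4)) with hh
  have hhm : Measurable h := by
    rw [hh]
    fun_prop
  have hk : (0 : ℝ) ≤ k := k.cast_nonneg
  have hm₁' : Measurable fun p : (ℝ × ℝ) × E => e₁ p.1.1 p.2 :=
    he₁.comp ((measurable_fst.comp measurable_fst).prodMk measurable_snd)
  have hm₂' : Measurable fun p : (ℝ × ℝ) × E => e₂ p.1.2 p.2 :=
    he₂.comp ((measurable_snd.comp measurable_fst).prodMk measurable_snd)
  have hAm : MeasurableSet A := by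
    refine MeasurableSet.inter ?_ ?_
    · exact measurableSet_le (hm₁'.add hm₂') measurable_const
    · have : Measurable fun p : (ℝ × ℝ) × E => ‖p.2‖ ^ 2 := by fun_prop
      exact measurableSet_le this measurable_const
  have hpt : ∀ p : (ℝ × ℝ) × E, ENNReal.ofReal (Ψ p) ≤
      A.indicator (fun p => ENNReal.ofReal (Ψ p)) p +
      h p.2 * (ENNReal.ofReal (Real.exp (-(2 * ν * e₁ p.1.1 p.2))) *
        ENNReal.ofReal (Real.exp (-(2 * ν * e₂ p.1.2 p.2)))) := by
    intro p
    by_cases hp : p ∈ A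
    · rw [Set.indicator_of_mem hp]
      exact le_self_add
    · rw [Set.indicator_of_notMem hp, zero_add]
      have hp : lam * k < e₁ p.1.1 p.2 + e₂ p.1.2 p.2 ∨ 8 * (k : ℝ) < ‖p.2‖ ^ 2 := by
        by_contra hcon
        push Not at hcon
        exact hp hcon
      refine (ENNReal.ofReal_le_ofReal (hΨ p)).trans ?_
      have ha := mul_nonneg hνpos.le (h₁ p.1.1 p.2)
      have hb := mul_nonneg hνpos.le (h₂ p.1.2 p.2)
      rcases hp with hp | hp
      · refine le_trans ?_ (mul_le_mul_left (le_self_add : _ ≤ h p.2) _)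
        rw [← ENNReal.ofReal_mul (Real.exp_pos _).le, ← ENNReal.ofReal_mul (Real.exp_pos _).le,
          ← Real.exp_add, ← Real.exp_add]
        gcongr
        nlinarith
      · refine le_trans ?_ (mul_le_mul_left (le_add_self : _ ≤ h p.2) _)
        rw [← ENNReal.ofReal_mul (Real.exp_pos _).le, ← ENNReal.ofReal_mul (Real.exp_pos _).le,
          ← Real.exp_add, ← Real.exp_add, ← ENNReal.ofReal_mul (Real.exp_pos _).le, ← Real.exp_add]
        gcongr
        nlinarith
  have hexp : Real.exp (-(2 * ν * lam * k)) ≤ Real.exp (-(ν * lam * k / 32)) := by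
    gcongr
    have : 0 ≤ ν * lam * k := by positivity
    linarith
  have hexp2 : Real.exp (-(2 * k)) * 2 ^ k ≤ Real.exp (-(ν * lam * k / 32)) := by
    have h3 : (2 : ℝ) ^ k ≤ Real.exp k := by
      rw [← Real.exp_one_pow]
      gcongr
      linarith [Real.exp_one_gt_d9]
    calc _ ≤ Real.exp (-(2 * k)) * Real.exp k := by gcongr
      _ = Real.exp (-(k : ℝ)) := by rw [← Real.exp_add]; ring_nf
      _ ≤ _ := by
        gcongr
        nlinarith
  have hint : ∫⁻ g, h g ∂G ≤ ENNReal.ofReal (2 * Real.exp (-(ν * lam * k / 32))) := by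
    rw [hh, lintegral_add_left measurable_const, lintegral_const, measure_univ, mul_one,
      lintegral_const_mul' _ _ ENNReal.ofReal_ne_top, two_mul (Real.exp (-(ν * lam * k / 32))),
      ENNReal.ofReal_add (Real.exp_pos _).le (Real.exp_pos _).le]
    gcongr
    calc _ ≤ ENNReal.ofReal (Real.exp (-(2 * k))) * 2 ^ k := by gcongr
      _ = ENNReal.ofReal (Real.exp (-(2 * k)) * 2 ^ k) := by
        rw [ENNReal.ofReal_mul (Real.exp_pos _).le, ENNReal.ofReal_pow (by norm_num)]
        simp
      _ ≤ _ := ENNReal.ofReal_le_ofReal hexp2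
  have hAs : ∀ p ∈ A, ∀ q ∈ A, e₁ p.1.1 p.2 + e₁ q.1.1 q.2 + lam * (‖p.2‖ ^ 2 + ‖q.2‖ ^ 2) ≤
      18 * (lam * k) ∧ e₂ p.1.2 p.2 + e₂ q.1.2 q.2 + lam * (‖p.2‖ ^ 2 + ‖q.2‖ ^ 2) ≤
      18 * (lam * k) := by
    intro p hp q hq
    have h3 : lam * (‖p.2‖ ^ 2 + ‖q.2‖ ^ 2) ≤ lam * (8 * k + 8 * k) := by
      gcongr
      · exact hp.2
      · exact hq.2
    constructor
    · linarith [hp.1, hq.1, h₂ p.1.2 p.2, h₂ q.1.2 q.2]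
    · linarith [hp.1, hq.1, h₁ p.1.1 p.2, h₁ q.1.1 q.2]
  have hcore := lintegral_box_core_le (G := G) (I := I) (J := J) (Ψ := Ψ) (A := A)
    (s := ρ * Real.exp (27 * c * (lam * k))) (by positivity)
    (fun p hp q hq hpI hqI => (hc₁ p.2 q.2 _ hpI _ hqI).trans (by
      have h3 := mul_le_mul_of_nonneg_left (hAs p hp q hq).1 (show 0 ≤ 3 / 2 * c by positivity)
      have h4 : 3 / 2 * c * (18 * (lam * k)) = 27 * c * (lam * k) := by ring
      rw [← h4]
      exact mul_le_mul_of_nonneg_left (Real.exp_le_exp.2 h3) hρ.le))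
    (fun p hp q hq hpJ hqJ => (hc₂ p.2 q.2 _ hpJ _ hqJ).trans (by
      have h3 := mul_le_mul_of_nonneg_left (hAs p hp q hq).2 (show 0 ≤ 3 / 2 * c by positivity)
      have h4 : 3 / 2 * c * (18 * (lam * k)) = 27 * c * (lam * k) := by ring
      rw [← h4]
      exact mul_le_mul_of_nonneg_left (Real.exp_le_exp.2 h3) hρ.le))
    (hI.prod hJ) hq
  have hoff := lintegral_box_offcore_le (G := G) hI hJ he₁ he₂ h₁ h₂ hρ hc
    (show 2 * c ≤ ν by linarith) hs₁ hs₂ hhm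
  have hAim : Measurable (A.indicator fun p => ENNReal.ofReal (Ψ p)) :=
    (hΨm.ennreal_ofReal).indicator hAm
  calc _ ≤ ∫⁻ θ in I ×ˢ J, ((∫⁻ g, A.indicator (fun p => ENNReal.ofReal (Ψ p)) (θ, g) ∂G) +
        ∫⁻ g, h g * (ENNReal.ofReal (Real.exp (-(2 * ν * e₁ θ.1 g))) *
        ENNReal.ofReal (Real.exp (-(2 * ν * e₂ θ.2 g)))) ∂G) := by
        refine lintegral_mono fun θ => ?_
        have h3 : Measurable fun g => A.indicator (fun p => ENNReal.ofReal (Ψ p)) (θ, g) :=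
          hAim.comp (measurable_const.prodMk measurable_id)
        rw [← lintegral_add_left h3]
        exact lintegral_mono fun g => hpt (θ, g)
    _ = (∫⁻ θ in I ×ˢ J, ∫⁻ g, A.indicator (fun p => ENNReal.ofReal (Ψ p)) (θ, g) ∂G) +
        ∫⁻ θ in I ×ˢ J, ∫⁻ g, h g * (ENNReal.ofReal (Real.exp (-(2 * ν * e₁ θ.1 g))) *
        ENNReal.ofReal (Real.exp (-(2 * ν * e₂ θ.2 g)))) ∂G := by
        rw [lintegral_add_left hAim.lintegral_prod_right']
    _ ≤ ENNReal.ofReal (4 * (ρ * Real.exp (27 * c * (lam * k))) ^ 2 *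
          Real.exp (-(ν * lam * k / 16))) +
        ENNReal.ofReal (2 * Real.exp (-(ν * lam * k / 32))) * ENNReal.ofReal (81 * ρ ^ 2) :=
        add_le_add hcore (hoff.trans (by gcongr))
    _ ≤ ENNReal.ofReal (4 * ρ ^ 2 * Real.exp (-(ν * lam * k / 32))) +
        ENNReal.ofReal (162 * ρ ^ 2 * Real.exp (-(ν * lam * k / 32))) := by
        rw [← ENNReal.ofReal_mul (by positivity)]
        refine add_le_add (ENNReal.ofReal_le_ofReal ?_) (ENNReal.ofReal_le_ofReal (by linarith))
        rw [mul_pow, ← Real.exp_nat_mul, ← mul_assoc, mul_assoc _ (Real.exp _), ← Real.exp_add]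
        gcongr
        push_cast
        have h5 : 0 ≤ lam * k := by positivity
        nlinarith
    _ = _ := by
        rw [← ENNReal.ofReal_add (by positivity) (by positivity)]
        ring_nf

end Box

/-! ### Quasi-triangle inequalities for the lattice energy. -/

theorem abs_sub_round_add_three_le (x y z : ℝ) :
    |x - y + z - round (x - y + z)| ≤ |x - round x| + |y - round y| + |z - round z| := by
  have h := round_le (x - y + z) (round x - round y + round z)
  push_cast at h
  refine h.trans ?_
  calc |x - y + z - (round x - round y + round z)|
      = |(x - round x) - (y - round y) + (z - round z)| := by ring_nf
    _ ≤ _ := (abs_add_le _ _).trans (by gcongr; exact abs_sub _ _)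

theorem sq_sub_round_add_three_le (x y z : ℝ) :
    (x - y + z - round (x - y + z)) ^ 2 ≤
      3 * ((x - round x) ^ 2 + (y - round y) ^ 2 + (z - round z) ^ 2) := by
  rw [← sq_abs (x - y + z - _), ← sq_abs (x - round x), ← sq_abs (y - round y),
    ← sq_abs (z - round z)]
  have h := abs_sub_round_add_three_le x y z
  have h0 := abs_nonneg (x - y + z - round (x - y + z))
  set a := |x - round x|
  set b := |y - round y|
  set c := |z - round z|
  nlinarith [sq_nonneg (a - b), sq_nonneg (b - c), sq_nonneg (a - c)]

theorem sq_sub_round_sub_le (x y : ℝ) :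
    (x - y - round (x - y)) ^ 2 ≤ 2 * ((x - round x) ^ 2 + (y - round y) ^ 2) := by
  rw [← sq_abs (x - y - _), ← sq_abs (x - round x), ← sq_abs (y - round y)]
  have h := abs_sub_round_add_three_le x y 0
  simp only [add_zero, round_zero, Int.cast_zero, sub_zero, abs_zero] at h
  have h0 := abs_nonneg (x - y - round (x - y))
  set a := |x - round x|
  set b := |y - round y|
  nlinarith [sq_nonneg (a - b)]

theorem latticeEnergy_sub_le (μ : Measure ℝ) [IsProbabilityMeasure μ] (x y : ℝ) :
    latticeEnergy μ (x - y) ≤ 2 * (latticeEnergy μ x + latticeEnergy μ y) := by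
  have hx := integrable_latticeEnergy μ x
  have hy := integrable_latticeEnergy μ y
  unfold latticeEnergy
  rw [← integral_add hx hy, ← integral_const_mul]
  refine integral_mono (integrable_latticeEnergy μ _) ((hx.add hy).const_mul 2) fun p => ?_
  simp only [sub_mul x y]
  exact sq_sub_round_sub_le _ _

theorem latticeEnergy_sub_add_le (μ : Measure ℝ) [IsProbabilityMeasure μ] (x y z : ℝ) :
    latticeEnergy μ (x - y + z) ≤
      3 * (latticeEnergy μ x + latticeEnergy μ y + latticeEnergy μ z) := by
  have hx := integrable_latticeEnergy μ x
  have hy := integrable_latticeEnergy μ y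
  have hz := integrable_latticeEnergy μ z
  have hxy : Integrable (fun p : ℝ × ℝ => (x * (p.1 - p.2) - round (x * (p.1 - p.2))) ^ 2 +
    (y * (p.1 - p.2) - round (y * (p.1 - p.2))) ^ 2) (μ.prod μ) := hx.add hy
  unfold latticeEnergy
  rw [← integral_add hx hy, ← integral_add hxy hz, ← integral_const_mul]
  refine integral_mono (integrable_latticeEnergy μ _) ((hxy.add hz).const_mul 3) fun p => ?_
  simp only [add_mul (x - y) z, sub_mul x y]
  exact sq_sub_round_add_three_le _ _ _

theorem IsSubG.latticeEnergy_le {μ : Measure ℝ} {T : ℝ} (h : IsSubG μ T) (u : ℝ) :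
    latticeEnergy μ u ≤ 2 * u ^ 2 := by
  have := h.prob
  calc latticeEnergy μ u ≤ ∫ p : ℝ × ℝ, u ^ 2 * (p.1 - p.2) ^ 2 ∂(μ.prod μ) := by
        refine integral_mono (integrable_latticeEnergy μ u) (h.integrable_sub_sq.const_mul _)
          fun p => ?_
        simp only
        have h1 := round_le (u * (p.1 - p.2)) 0
        rw [Int.cast_zero, sub_zero] at h1
        rw [← mul_pow]
        exact sq_le_sq.2 h1
    _ = 2 * u ^ 2 := by rw [integral_const_mul, h.integral_sub_sq]; ring

theorem measurable_latticeEnergy (μ : Measure ℝ) [IsProbabilityMeasure μ] :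
    Measurable (latticeEnergy μ) := by
  have h : Measurable fun q : ℝ × (ℝ × ℝ) =>
      (q.1 * (q.2.1 - q.2.2) - round (q.1 * (q.2.1 - q.2.2))) ^ 2 := by
    simp_rw [round_eq]
    fun_prop
  exact (h.stronglyMeasurable.integral_prod_right').measurable

/-- An absolute constant: the total weight in the comparison of a Gaussian with unit boxes. -/
noncomputable def boxConst : ℝ := (∑' j : ℤ, ENNReal.ofReal (Real.exp (2 - |(j : ℝ)|))).toReal

/-! ### The Laplace transform of a single row. -/

section Row

variable {κ : Type*} [Fintype κ] [DecidableEq κ]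

/-- `hY` is the LCD hypothesis with the logarithm exponentiated; it is needed only for `|θ| ≤ 1`
because the box estimate is made on unit boxes. The Gaussian mass of the boxes is summable and only
costs `boxConst ^ 2`. -/
theorem lintegral_row_le {m : κ → Measure ℝ} {T : ℝ} (hm : ∀ i, IsSubG (m i) T) (hT : 1 ≤ T)
    {ν lam ρ γ : ℝ} (hν0 : 0 < ν) (hν1 : ν ≤ 1) (hlam : 0 < lam) (hlamT : 128 * T ^ 4 * lam ≤ 1)
    (hρ : 0 < ρ) (hγ0 : 0 < γ) (hγ : 3456 ≤ ν * γ ^ 2) {k : ℕ}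
    {w : κ ⊕ κ → EuclideanSpace ℝ (Fin k)}
    (hw : ∀ p, ∑ i, (inner ℝ (w i) p) ^ 2 ≤ 4 * ‖p‖ ^ 2) (hwk : (k : ℝ) / 4 ≤ ∑ i, ‖w i‖ ^ 2)
    {Y : κ → ℝ} (hY : ∀ θ : ℝ, |θ| ≤ 1 →
      |θ| ≤ ρ * Real.exp (1 / γ ^ 2 * ∑ i, latticeEnergy (m i) (θ * Y i))) :
    ∫⁻ z, ENNReal.ofReal (Real.exp (-(lam * ‖∑ i, z i • w i‖ ^ 2 +
      2 * Real.pi ^ 2 * ((∑ i, z (Sum.inl i) * Y i) ^ 2 + (∑ i, z (Sum.inr i) * Y i) ^ 2))))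
      ∂(Measure.pi fun i : κ ⊕ κ => lazyLaw ν (Sum.elim m m i)) ≤
    ENNReal.ofReal (boxConst ^ 2 * (166 * ρ ^ 2 * Real.exp (-(ν * lam * k / 32)))) := by
  set mm : κ ⊕ κ → Measure ℝ := Sum.elim m m with hmm
  have hmmG : ∀ i, IsSubG (mm i) T := by rintro (i | i) <;> exact hm i
  have hprob := fun i => (hmmG i).prob
  have hprob' := fun i => (hm i).prob
  have hpi := Real.pi_pos
  have hT4 : 1 ≤ T ^ 4 := one_le_pow₀ hT
  have hT2 : T ^ 2 ≤ T ^ 4 := by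
    have : 1 ≤ T ^ 2 := one_le_pow₀ hT
    nlinarith
  have hlam1 : 128 * lam ≤ 1 := by nlinarith
  -- This scaling turns `‖r ∑ z_i w_i‖² / 2` into `lam ‖∑ z_i w_i‖²`. Similarly, the vectors `2 π Y`
  -- produce the weight `2 π²`, and dividing by `2 π` in `V₁` and `V₂` passes from characteristic
  -- functions to distances from `ℤ`.
  set r : ℝ := √(2 * lam) with hr
  have hr2 : r ^ 2 = 2 * lam := Real.sq_sqrt (by positivity)
  -- the three functions entering the box estimate
  set V₁ : EuclideanSpace ℝ (Fin k) → κ → ℝ :=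
    fun g i => r / (2 * Real.pi) * inner ℝ (w (Sum.inl i)) g with hV₁
  set V₂ : EuclideanSpace ℝ (Fin k) → κ → ℝ :=
    fun g i => r / (2 * Real.pi) * inner ℝ (w (Sum.inr i)) g with hV₂
  set en : (κ → ℝ) → ℝ := fun x => ∑ i, latticeEnergy (m i) (x i) with hen
  have hen0 : ∀ x, 0 ≤ en x := fun x => Finset.sum_nonneg fun i _ => latticeEnergy_nonneg _ _
  have henm : Measurable en := Finset.measurable_sum _ fun i _ =>
    (measurable_latticeEnergy (m i)).comp (measurable_pi_apply i)
  -- With the same `g` the shifts `v` cancel in the difference, so the two-term inequality suffices.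
  have hpair : ∀ (v : κ → ℝ) (x y : ℝ), |x - y| ≤ 1 → |x - y| ≤
      ρ * Real.exp (2 / γ ^ 2 * (en (fun i => v i + x * Y i) + en (fun i => v i + y * Y i))) := by
    intro v x y hxy
    refine (hY _ hxy).trans ?_
    gcongr ρ * Real.exp ?_
    rw [show 2 / γ ^ 2 * (en (fun i => v i + x * Y i) + en (fun i => v i + y * Y i)) =
      1 / γ ^ 2 * (2 * (en (fun i => v i + x * Y i) + en (fun i => v i + y * Y i))) by ring]
    gcongr
    simp only [hen]
    rw [← Finset.sum_add_distrib, Finset.mul_sum]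
    refine Finset.sum_le_sum fun i _ => ?_
    rw [show (x - y) * Y i = (v i + x * Y i) - (v i + y * Y i) by ring]
    exact latticeEnergy_sub_le _ _ _
  -- With different `g` the difference of the shifts survives. It is treated as a third term, whose
  -- energy is at most twice its square; the constant `3` of the three-term inequality gives the
  -- ratio `3 / 2` to `hpair`.
  have hcross : ∀ (v v' : κ → ℝ) (x y : ℝ), |x - y| ≤ 1 → |x - y| ≤
      ρ * Real.exp (3 / 2 * (2 / γ ^ 2) * (en (fun i => v i + x * Y i) +
        en (fun i => v' i + y * Y i) + 2 * ∑ i, (v' i - v i) ^ 2)) := by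
    intro v v' x y hxy
    refine (hY _ hxy).trans ?_
    gcongr ρ * Real.exp ?_
    rw [show ∀ a : ℝ, 3 / 2 * (2 / γ ^ 2) * a = 1 / γ ^ 2 * (3 * a) from fun a => by ring]
    gcongr
    simp only [hen]
    rw [Finset.mul_sum, ← Finset.sum_add_distrib, ← Finset.sum_add_distrib, Finset.mul_sum]
    refine Finset.sum_le_sum fun i _ => ?_
    rw [show (x - y) * Y i = (v i + x * Y i) - (v' i + y * Y i) + (v' i - v i) by ring]
    refine (latticeEnergy_sub_add_le _ _ _ _).trans ?_
    gcongr
    exact (hm i).latticeEnergy_le _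
  have hVsq : ∀ g g' : EuclideanSpace ℝ (Fin k),
      2 * ∑ i, (V₁ g' i - V₁ g i) ^ 2 ≤ lam * (‖g‖ ^ 2 + ‖g'‖ ^ 2) ∧
      2 * ∑ i, (V₂ g' i - V₂ g i) ^ 2 ≤ lam * (‖g‖ ^ 2 + ‖g'‖ ^ 2) := by
    intro g g'
    have h1 := hw (g' - g)
    have h2 : ‖g' - g‖ ^ 2 ≤ 2 * (‖g‖ ^ 2 + ‖g'‖ ^ 2) := by
      have := norm_sub_le g' g
      nlinarith [norm_nonneg (g' - g), sq_nonneg (‖g‖ - ‖g'‖)]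
    rw [Fintype.sum_sum_type] at h1
    have h3 : (r / (2 * Real.pi)) ^ 2 ≤ lam / 18 := by
      rw [div_pow, hr2, div_le_iff₀ (by positivity)]
      have : 9 ≤ Real.pi ^ 2 := by nlinarith [Real.pi_gt_three]
      nlinarith
    have e1 : ∑ i, (V₁ g' i - V₁ g i) ^ 2 =
        (r / (2 * Real.pi)) ^ 2 * ∑ i, (inner ℝ (w (Sum.inl i)) (g' - g)) ^ 2 := by
      rw [Finset.mul_sum]
      refine Finset.sum_congr rfl fun i _ => ?_
      simp only [hV₁, inner_sub_right]
      ring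
    have e2 : ∑ i, (V₂ g' i - V₂ g i) ^ 2 =
        (r / (2 * Real.pi)) ^ 2 * ∑ i, (inner ℝ (w (Sum.inr i)) (g' - g)) ^ 2 := by
      rw [Finset.mul_sum]
      refine Finset.sum_congr rfl fun i _ => ?_
      simp only [hV₂, inner_sub_right]
      ring
    have s1 : 0 ≤ ∑ i, (inner ℝ (w (Sum.inl i)) (g' - g)) ^ 2 :=
      Finset.sum_nonneg fun i _ => sq_nonneg _
    have s2 : 0 ≤ ∑ i, (inner ℝ (w (Sum.inr i)) (g' - g)) ^ 2 :=
      Finset.sum_nonneg fun i _ => sq_nonneg _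
    rw [e1, e2]
    have hfin : ∀ S : ℝ, 0 ≤ S → S ≤ 8 * (‖g‖ ^ 2 + ‖g'‖ ^ 2) →
        2 * ((r / (2 * Real.pi)) ^ 2 * S) ≤ lam * (‖g‖ ^ 2 + ‖g'‖ ^ 2) := by
      intro S hS0 hS
      have h5 : (r / (2 * Real.pi)) ^ 2 * S ≤ lam / 18 * (8 * (‖g‖ ^ 2 + ‖g'‖ ^ 2)) := by gcongr
      have : 0 ≤ lam * (‖g‖ ^ 2 + ‖g'‖ ^ 2) := by positivity
      linarith
    exact ⟨hfin _ s1 (by linarith), hfin _ s2 (by linarith)⟩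
  set Ψ : (ℝ × ℝ) × EuclideanSpace ℝ (Fin k) → ℝ := fun p => ∏ i, lazyChar (ν / 2) (mm i)
      (inner ℝ (r • w i) p.2 + p.1.1 * Sum.elim (fun i => 2 * Real.pi * Y i) (0 : κ → ℝ) i +
        p.1.2 * Sum.elim (0 : κ → ℝ) (fun i => 2 * Real.pi * Y i) i) with hΨ
  have hΨm : Measurable Ψ := by
    refine Finset.measurable_prod _ fun i _ => (measurable_lazyChar _ _).comp ?_
    exact Continuous.measurable (by fun_prop)
  have hΨle : ∀ p, Ψ p ≤ Real.exp (-(4 * ν * (en (fun i => V₁ p.2 i + p.1.1 * Y i) +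
      en (fun i => V₂ p.2 i + p.1.2 * Y i)))) := by
    intro p
    have hf : ∀ u : κ ⊕ κ → ℝ, ∏ i, lazyChar (ν / 2) (mm i) (2 * Real.pi * u i) ≤
        Real.exp (-(4 * ν * (en (fun i => u (Sum.inl i)) + en (fun i => u (Sum.inr i))))) := by
      intro u
      calc _ ≤ ∏ i, Real.exp (-(8 * (ν / 2) * latticeEnergy (mm i) (u i))) :=
            Finset.prod_le_prod (fun i _ => lazyChar_nonneg (by linarith) (by linarith) _ _)
              fun i _ => lazyChar_two_pi_mul_le (by linarith) _ _
        _ = _ := by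
            rw [← Real.exp_sum, Fintype.sum_sum_type]
            simp only [hen, hmm, Sum.elim_inl, Sum.elim_inr, Finset.mul_sum, mul_add,
              Finset.sum_neg_distrib, neg_add]
            congr 2 <;> ring_nf
    refine le_of_eq_of_le ?_ (hf (Sum.elim (fun i => V₁ p.2 i + p.1.1 * Y i)
      (fun i => V₂ p.2 i + p.1.2 * Y i)))
    simp only [hΨ]
    refine Finset.prod_congr rfl fun i _ => ?_
    congr 1
    rcases i with i | i
    · simp only [Sum.elim_inl, Pi.zero_apply, mul_zero, add_zero, hV₁, real_inner_smul_left]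
      field_simp
    · simp only [Sum.elim_inr, Pi.zero_apply, mul_zero, add_zero, hV₂, real_inner_smul_left]
      field_simp
  have hq : ∀ θ, ∫⁻ g, ENNReal.ofReal (Ψ (θ, g)) ∂(stdGaussian (EuclideanSpace ℝ (Fin k))) ≤
      ENNReal.ofReal (Real.exp (-(ν * lam * k / 16))) := by
    intro θ
    have h1 := lintegral_lazyChar_le_lintegral_exp_neg (β := ν / 2) (by linarith) (by linarith)
      mm (fun i => r • w i) (fun i => θ.1 * Sum.elim (fun i => 2 * Real.pi * Y i) (0 : κ → ℝ) i +
        θ.2 * Sum.elim (0 : κ → ℝ) (fun i => 2 * Real.pi * Y i) i)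
    simp only [hΨ, add_assoc]
    refine h1.trans ?_
    have := fun i => isProbabilityMeasure_symLaw (mm i)
    have := fun i => isProbabilityMeasure_lazyLaw (β := ν / 2) (by linarith) (by linarith)
      (symLaw (mm i))
    -- The condition `128 T⁴ lam ≤ 1` is what makes the one-coordinate estimate, which asks for `32
    -- T⁴ b ≤ 1`, available for all `b ≤ 4 lam`.
    have h2 := lintegral_exp_neg_norm_sq_sum_le (η := fun i => lazyLaw (ν / 2) (symLaw (mm i)))
      (w := w) (lam := lam) (K := 8 * T ^ 2) (M := 4) (β := ν / 2) hlam (by positivity)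
      (by norm_num) hw (by nlinarith) (by linarith) (fun i b s hb0 hb =>
        (hmmG i).lintegral_exp_neg_lazyLaw_le hb0 (by nlinarith) (by nlinarith) (by linarith)
          (by linarith) s)
    refine le_trans (le_of_eq ?_) (h2.trans (ENNReal.ofReal_le_ofReal (Real.exp_le_exp.2 ?_)))
    · refine lintegral_congr fun z => ?_
      congr 2
      have : ∑ i, z i • r • w i = r • ∑ i, z i • w i := by
        rw [Finset.smul_sum]
        exact Finset.sum_congr rfl fun i _ => smul_comm _ _ _
      rw [this, norm_smul, mul_pow, Real.norm_eq_abs, sq_abs, hr2]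
      ring
    · have h5 : ν / 2 * (lam / 2) * (k / 4) ≤ ν / 2 * (lam / 2) * ∑ i, ‖w i‖ ^ 2 := by gcongr
      linarith
  have hVm₁ : ∀ i, Measurable fun g => V₁ g i := fun i => Continuous.measurable (by fun_prop)
  have hVm₂ : ∀ i, Measurable fun g => V₂ g i := fun i => Continuous.measurable (by fun_prop)
  have hbox : ∀ i j : ℤ, ∫⁻ θ in Set.Ico (i : ℝ) (i + 1) ×ˢ Set.Ico (j : ℝ) (j + 1),
      ∫⁻ g, ENNReal.ofReal (Ψ (θ, g)) ∂(stdGaussian (EuclideanSpace ℝ (Fin k))) ≤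
      ENNReal.ofReal (166 * ρ ^ 2 * Real.exp (-(ν * lam * k / 32))) := by
    intro i j
    have hlen : ∀ (i : ℤ), ∀ x ∈ Set.Ico (i : ℝ) (i + 1), ∀ y ∈ Set.Ico (i : ℝ) (i + 1),
        |x - y| ≤ 1 := by
      intro i x hx y hy
      rw [abs_le]
      constructor <;> linarith [hx.1, hx.2, hy.1, hy.2]
    refine lintegral_box_le (e₁ := fun x g => en (fun i => V₁ g i + x * Y i))
      (e₂ := fun x g => en (fun i => V₂ g i + x * Y i)) (c := 2 / γ ^ 2) measurableSet_Ico
      measurableSet_Ico ?_ ?_ (fun _ _ => hen0 _) (fun _ _ => hen0 _) hρ (by positivity) ?_ hlam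
      (by nlinarith) ?_ ?_ ?_ ?_ hΨle hΨm hq (lintegral_exp_norm_sq_div_four_stdGaussian_le k)
    · refine henm.comp (measurable_pi_iff.2 fun i => ?_)
      exact ((hVm₁ i).comp measurable_snd).add (measurable_fst.mul_const _)
    · refine henm.comp (measurable_pi_iff.2 fun i => ?_)
      exact ((hVm₂ i).comp measurable_snd).add (measurable_fst.mul_const _)
    · rw [← mul_div_assoc, div_le_iff₀ (by positivity)]
      linarith
    · exact fun g x hx y hy => hpair (V₁ g) x y (hlen _ x hx y hy)
    · exact fun g x hx y hy => hpair (V₂ g) x y (hlen _ x hx y hy)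
    · intro g g' x hx y hy
      refine (hcross (V₁ g) (V₁ g') x y (hlen _ x hx y hy)).trans ?_
      gcongr _ * Real.exp (_ * (_ + ?_))
      exact (hVsq g g').1
    · intro g g' x hx y hy
      refine (hcross (V₂ g) (V₂ g') x y (hlen _ x hx y hy)).trans ?_
      gcongr _ * Real.exp (_ * (_ + ?_))
      exact (hVsq g g').2
  have hmain := lintegral_exp_neg_le_lintegral_lazyChar hν0.le hν1 mm (fun i => r • w i)
    (Sum.elim (fun i => 2 * Real.pi * Y i) (0 : κ → ℝ)) (Sum.elim (0 : κ → ℝ) (fun i => 2 * Real.pi * Y i))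
  calc _ = ∫⁻ z, ENNReal.ofReal (Real.exp (-((‖∑ i, z i • r • w i‖ ^ 2 +
        (∑ i, z i * Sum.elim (fun i => 2 * Real.pi * Y i) (0 : κ → ℝ) i) ^ 2 +
        (∑ i, z i * Sum.elim (0 : κ → ℝ) (fun i => 2 * Real.pi * Y i) i) ^ 2) / 2)))
        ∂(Measure.pi fun i : κ ⊕ κ => lazyLaw ν (mm i)) := by
        refine lintegral_congr fun z => ?_
        congr 3
        have e0 : ∑ i, z i • r • w i = r • ∑ i, z i • w i := by
          rw [Finset.smul_sum]
          exact Finset.sum_congr rfl fun i _ => smul_comm _ _ _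
        have e1 : ∑ i, z i * Sum.elim (fun i => 2 * Real.pi * Y i) (0 : κ → ℝ) i =
            2 * Real.pi * ∑ i, z (Sum.inl i) * Y i := by
          rw [Fintype.sum_sum_type, Finset.mul_sum]
          simp only [Sum.elim_inl, Sum.elim_inr, Pi.zero_apply, mul_zero, Finset.sum_const_zero,
            add_zero]
          exact Finset.sum_congr rfl fun i _ => by ring
        have e2 : ∑ i, z i * Sum.elim (0 : κ → ℝ) (fun i => 2 * Real.pi * Y i) i =
            2 * Real.pi * ∑ i, z (Sum.inr i) * Y i := by
          rw [Fintype.sum_sum_type, Finset.mul_sum]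
          simp only [Sum.elim_inl, Sum.elim_inr, Pi.zero_apply, mul_zero, Finset.sum_const_zero,
            zero_add]
          exact Finset.sum_congr rfl fun i _ => by ring
        rw [e0, e1, e2, norm_smul, mul_pow, Real.norm_eq_abs, sq_abs, hr2]
        ring
    _ ≤ _ := hmain
    _ = ∫⁻ θ, ∫⁻ g, ENNReal.ofReal (Ψ (θ, g)) ∂(stdGaussian (EuclideanSpace ℝ (Fin k)))
        ∂((gaussianReal 0 1).prod (gaussianReal 0 1)) :=
        lintegral_prod _ hΨm.ennreal_ofReal.aemeasurable
    _ ≤ _ := lintegral_gaussian_prod_le_of_box hΨm.ennreal_ofReal.lintegral_prod_right' hbox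
    _ = _ := by
        rw [ENNReal.ofReal_mul (p := boxConst ^ 2) (by positivity), boxConst,
          ENNReal.ofReal_pow ENNReal.toReal_nonneg, ENNReal.ofReal_toReal tsum_exp_two_sub_abs_ne_top]

end Row

/-! ### Averaging over operator balls in place of a net. -/

section Averaging

open scoped Pointwise

variable {F : Type*} [NormedAddCommGroup F] [InnerProductSpace ℝ F] {k : ℕ}

/-- The tuples of `k` vectors whose synthesis operator `x ↦ ∑ x_l E_l` has norm at most `R`. -/
def opBall (F : Type*) [NormedAddCommGroup F] [InnerProductSpace ℝ F] (k : ℕ) (R : ℝ) :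
    Set (Fin k → F) :=
  {E | ∀ x : EuclideanSpace ℝ (Fin k), ‖∑ l, x l • E l‖ ≤ R * ‖x‖}

theorem isClosed_opBall (R : ℝ) : IsClosed (opBall F k R) := by
  have : opBall F k R = ⋂ x : EuclideanSpace ℝ (Fin k), {E | ‖∑ l, x l • E l‖ ≤ R * ‖x‖} := by
    ext E
    rw [Set.mem_iInter]
    rfl
  rw [this]
  exact isClosed_iInter fun x => isClosed_le (by fun_prop) continuous_const

theorem norm_le_of_mem_opBall {R : ℝ} {E : Fin k → F} (h : E ∈ opBall F k R) (l : Fin k) :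
    ‖E l‖ ≤ R := by
  have h1 := h (EuclideanSpace.single l 1)
  simpa [PiLp.single_apply, ite_smul, Finset.sum_ite_eq'] using h1

theorem smul_mem_opBall {R r : ℝ} (hr : 0 ≤ r) {E : Fin k → F} (h : E ∈ opBall F k R) :
    r • E ∈ opBall F k (r * R) := by
  intro x
  have h1 : ∑ l, x l • (r • E) l = r • ∑ l, x l • E l := by
    rw [Finset.smul_sum]
    exact Finset.sum_congr rfl fun i _ => smul_comm _ _ _
  rw [h1, norm_smul, Real.norm_of_nonneg hr, mul_assoc]
  gcongr
  exact h x

theorem add_mem_opBall {R R' : ℝ} {E E' : Fin k → F} (h : E ∈ opBall F k R)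
    (h' : E' ∈ opBall F k R') : E + E' ∈ opBall F k (R + R') := by
  intro x
  simp only [Pi.add_apply, smul_add, Finset.sum_add_distrib, add_mul]
  exact (norm_add_le _ _).trans (add_le_add (h x) (h' x))

theorem opBall_mono {R R' : ℝ} (h : R ≤ R') : opBall F k R ⊆ opBall F k R' :=
  fun _ hE x => (hE x).trans (by gcongr)

theorem smul_opBall_one {r : ℝ} (hr : 0 < r) : r • opBall F k 1 = opBall F k r := by
  ext E
  constructor
  · rintro ⟨E', hE', rfl⟩
    simpa using smul_mem_opBall hr.le hE'
  · intro hE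
    refine ⟨r⁻¹ • E, ?_, smul_inv_smul₀ hr.ne' E⟩
    simpa [hr.ne'] using smul_mem_opBall (inv_nonneg.2 hr.le) hE

theorem mem_opBall_one_of_orthonormal {W : Fin k → F} (hW : Orthonormal ℝ W) :
    W ∈ opBall F k 1 := by
  intro x
  have h1 : ‖∑ l, x l • W l‖ ^ 2 = ‖x‖ ^ 2 := by
    rw [← real_inner_self_eq_norm_sq, hW.inner_sum, EuclideanSpace.real_norm_sq_eq]
    simp [sq]
  rw [one_mul]
  exact (pow_le_pow_iff_left₀ (norm_nonneg _) (norm_nonneg _) two_ne_zero).1 h1.le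

theorem comp_isometry_mem_opBall (Q : F ≃ₗᵢ[ℝ] F) {R : ℝ} (E : Fin k → F) :
    (fun l => Q (E l)) ∈ opBall F k R ↔ E ∈ opBall F k R := by
  refine forall_congr' fun x => ?_
  have : ∑ l, x l • Q (E l) = Q (∑ l, x l • E l) := by simp [map_sum]
  rw [this, Q.norm_map]

variable [FiniteDimensional ℝ F] [MeasurableSpace F] [BorelSpace F]

theorem volume_opBall_one_ne_top : volume (opBall F k 1) ≠ ∞ := by
  refine ((measure_mono (fun E hE => ?_)).trans_lt
    (measure_closedBall_lt_top (x := (0 : Fin k → F)) (r := 1))).ne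
  rw [mem_closedBall_zero_iff, pi_norm_le_iff_of_nonneg zero_le_one]
  exact norm_le_of_mem_opBall hE

theorem volume_opBall_one_ne_zero : volume (opBall F k 1) ≠ 0 := by
  have hpos : (0 : ℝ) < 1 / (k + 1) := by positivity
  refine (lt_of_lt_of_le (Metric.measure_ball_pos volume (0 : Fin k → F) hpos)
    (measure_mono fun E hE => ?_)).ne'
  rw [mem_ball_zero_iff] at hE
  intro x
  calc ‖∑ l, x l • E l‖ ≤ ∑ l : Fin k, ‖x‖ * (1 / (k + 1)) := by
        refine (norm_sum_le _ _).trans (Finset.sum_le_sum fun l _ => ?_)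
        rw [norm_smul]
        gcongr
        · exact PiLp.norm_apply_le x l
        · exact (norm_le_pi_norm E l).trans hE.le
    _ = ‖x‖ * (k / (k + 1)) := by
        rw [Finset.sum_const, Finset.card_univ, Fintype.card_fin, nsmul_eq_mul]
        ring
    _ ≤ 1 * ‖x‖ := by
        rw [one_mul]
        refine mul_le_of_le_one_right (norm_nonneg _) ?_
        rw [div_le_one (by positivity)]
        linarith

theorem volume_opBall_ne_top {R : ℝ} (hR : 0 < R) : volume (opBall F k R) ≠ ∞ := by
  rw [← smul_opBall_one hR, Measure.addHaar_smul]
  exact ENNReal.mul_ne_top ENNReal.ofReal_ne_top volume_opBall_one_ne_top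

theorem volume_opBall_ne_zero {R : ℝ} (hR : 0 < R) : volume (opBall F k R) ≠ 0 := by
  rw [← smul_opBall_one hR, Measure.addHaar_smul]
  exact mul_ne_zero (by simp [hR.ne']) volume_opBall_one_ne_zero

theorem measurePreserving_comp_isometry (Q : F ≃ₗᵢ[ℝ] F) :
    MeasurePreserving (fun (E : Fin k → F) l => Q (E l)) volume volume :=
  volume_preserving_pi fun _ => Q.measurePreserving

/-- A reflection carries `h` to `h'`, and it preserves both Lebesgue measure and the operator ball.
-/
theorem lintegral_opBall_inner_sq_eq {h h' : F} (hh : ‖h‖ = ‖h'‖) :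
    ∫⁻ E in opBall F k 1, ENNReal.ofReal (∑ l, (inner ℝ h (E l)) ^ 2) =
      ∫⁻ E in opBall F k 1, ENNReal.ofReal (∑ l, (inner ℝ h' (E l)) ^ 2) := by
  set Q := (ℝ ∙ (h - h'))ᗮ.reflection with hQ
  have hQh : Q h = h' := Submodule.reflection_sub hh
  have hmeas : Measurable fun E : Fin k → F => ENNReal.ofReal (∑ l, (inner ℝ h' (E l)) ^ 2) :=
    (Continuous.measurable (by fun_prop)).ennreal_ofReal
  have hpre : (fun (E : Fin k → F) l => Q (E l)) ⁻¹' (opBall F k 1) = opBall F k 1 := by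
    ext E
    exact comp_isometry_mem_opBall Q E
  have key := (measurePreserving_comp_isometry (k := k) Q).setLIntegral_comp_preimage
    (isClosed_opBall (F := F) (k := k) 1).measurableSet hmeas
  rw [hpre] at key
  rw [← key]
  refine lintegral_congr fun E => ?_
  congr 1
  refine Finset.sum_congr rfl fun l _ => ?_
  rw [← hQh, Q.inner_map_map]

/-- By isotropy all unit directions contribute equally; summed over an orthonormal basis they give
`∑ ‖E l‖² ≤ k`. This division by the dimension is what a plain operator norm bound on the
perturbation would miss. -/
theorem finrank_mul_lintegral_opBall_le (h : F) :
    (Module.finrank ℝ F : ℝ≥0∞) *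
      ∫⁻ E in opBall F k 1, ENNReal.ofReal (∑ l, (inner ℝ h (E l)) ^ 2) ≤
      ENNReal.ofReal (k * ‖h‖ ^ 2) * volume (opBall F k 1) := by
  set b := stdOrthonormalBasis ℝ F with hb
  have h1 : ∀ i, ∫⁻ E in opBall F k 1, ENNReal.ofReal (∑ l, (inner ℝ h (E l)) ^ 2) =
      ENNReal.ofReal (‖h‖ ^ 2) *
        ∫⁻ E in opBall F k 1, ENNReal.ofReal (∑ l, (inner ℝ (b i) (E l)) ^ 2) := by
    intro i
    rw [lintegral_opBall_inner_sq_eq (h' := ‖h‖ • b i) (by simp [norm_smul]),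
      ← lintegral_const_mul' _ _ ENNReal.ofReal_ne_top]
    refine lintegral_congr fun E => ?_
    rw [← ENNReal.ofReal_mul (by positivity), Finset.mul_sum]
    congr 1
    refine Finset.sum_congr rfl fun l _ => ?_
    rw [real_inner_smul_left]
    ring
  calc _ = ∑ i, ENNReal.ofReal (‖h‖ ^ 2) *
        ∫⁻ E in opBall F k 1, ENNReal.ofReal (∑ l, (inner ℝ (b i) (E l)) ^ 2) := by
        simp_rw [← h1]
        simp
    _ = ENNReal.ofReal (‖h‖ ^ 2) * ∫⁻ E in opBall F k 1, ENNReal.ofReal (∑ l, ‖E l‖ ^ 2) := by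
        rw [← Finset.mul_sum, ← lintegral_finsetSum]
        · congr 1
          refine lintegral_congr fun E => ?_
          rw [← ENNReal.ofReal_sum_of_nonneg
            (fun i _ => Finset.sum_nonneg fun l _ => sq_nonneg _), Finset.sum_comm]
          congr 1
          refine Finset.sum_congr rfl fun l _ => ?_
          exact b.sum_sq_inner_right (E l)
        · intro i _
          exact (Continuous.measurable (by fun_prop)).ennreal_ofReal
    _ ≤ ENNReal.ofReal (‖h‖ ^ 2) * ∫⁻ _E in opBall F k 1, ENNReal.ofReal k := by
        gcongr ENNReal.ofReal (‖h‖ ^ 2) * ?_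
        refine setLIntegral_mono' (isClosed_opBall (F := F) (k := k) 1).measurableSet
          fun E hE => ENNReal.ofReal_le_ofReal ?_
        calc ∑ l, ‖E l‖ ^ 2 ≤ ∑ _l : Fin k, (1 : ℝ) := by
              refine Finset.sum_le_sum fun l _ => ?_
              exact pow_le_one₀ (norm_nonneg _) (norm_le_of_mem_opBall hE l)
          _ = k := by simp
    _ = _ := by
        rw [setLIntegral_const, ← mul_assoc, ← ENNReal.ofReal_mul (by positivity), mul_comm (k : ℝ)]

/-- Markov's inequality at twice the mean bound `k S / D`. -/
theorem half_volume_opBall_le {N : ℕ} (h : Fin N → F) (hF : 0 < Module.finrank ℝ F) :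
    volume (opBall F k 1) / 2 ≤ volume {E | E ∈ opBall F k 1 ∧
      ∑ j, ∑ l, (inner ℝ (h j) (E l)) ^ 2 ≤ 2 * k * (∑ j, ‖h j‖ ^ 2) / Module.finrank ℝ F} := by
  set D := Module.finrank ℝ F with hD
  have hDpos : (0 : ℝ) < D := by exact_mod_cast hF
  set V := volume (opBall F k 1) with hV
  set S := ∑ j, ‖h j‖ ^ 2 with hS
  have hS0 : 0 ≤ S := Finset.sum_nonneg fun _ _ => sq_nonneg _
  set f : (Fin k → F) → ℝ := fun E => ∑ j, ∑ l, (inner ℝ (h j) (E l)) ^ 2 with hf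
  have hfm : Measurable f := Continuous.measurable (by fun_prop)
  have hBm := (isClosed_opBall (F := F) (k := k) 1).measurableSet
  have hint : ∫⁻ E in opBall F k 1, ENNReal.ofReal (f E) ≤ ENNReal.ofReal (k * S / D) * V := by
    have h1 : (D : ℝ≥0∞) * ∫⁻ E in opBall F k 1, ENNReal.ofReal (f E) ≤
        ENNReal.ofReal (k * S) * V := by
      have h2 : ∫⁻ E in opBall F k 1, ENNReal.ofReal (f E) =
          ∑ j, ∫⁻ E in opBall F k 1, ENNReal.ofReal (∑ l, (inner ℝ (h j) (E l)) ^ 2) := by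
        rw [← lintegral_finsetSum]
        · refine lintegral_congr fun E => ?_
          rw [← ENNReal.ofReal_sum_of_nonneg
            (fun i _ => Finset.sum_nonneg fun l _ => sq_nonneg _)]
        · intro i _
          exact (Continuous.measurable (by fun_prop)).ennreal_ofReal
      rw [h2, Finset.mul_sum]
      refine (Finset.sum_le_sum fun j _ => finrank_mul_lintegral_opBall_le (h j)).trans_eq ?_
      rw [← Finset.sum_mul, ← ENNReal.ofReal_sum_of_nonneg (fun i _ => by positivity),
        ← Finset.mul_sum]
    have hD0 : (D : ℝ≥0∞) ≠ 0 := by exact_mod_cast hF.ne'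
    rw [mul_comm, ← ENNReal.le_div_iff_mul_le (Or.inl hD0) (Or.inl (by simp))] at h1
    refine h1.trans_eq ?_
    rw [ENNReal.ofReal_div_of_pos hDpos, ENNReal.ofReal_natCast, ENNReal.mul_comm_div, mul_div_assoc]
  set t := 2 * k * S / D with ht
  set A := {E | E ∈ opBall F k 1 ∧ f E ≤ t}
  set B := {E | E ∈ opBall F k 1 ∧ t < f E}
  have hBV : volume B ≤ V / 2 := by
    -- For `t = 0` Markov's inequality says nothing, but then the integral vanishes and `f = 0`
    -- almost everywhere on the ball.
    rcases (show 0 ≤ t by positivity).eq_or_lt with ht0 | ht0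
    · have hz : ∫⁻ E in opBall F k 1, ENNReal.ofReal (f E) = 0 := by
        have : k * S / D = 0 := by linarith [show t = 2 * (k * S / D) by rw [ht]; ring]
        rw [this] at hint
        simpa using hint
      rw [lintegral_eq_zero_iff hfm.ennreal_ofReal, Filter.EventuallyEq, ae_restrict_iff' hBm] at hz
      have : volume B = 0 := by
        refine measure_mono_null (fun E hE => ?_) hz
        intro hcon
        have h3 := hcon hE.1
        simp only [Pi.zero_apply, ENNReal.ofReal_eq_zero] at h3
        linarith [hE.2]
      rw [this]
      exact zero_le
    · have h4 := mul_meas_ge_le_lintegral (μ := volume.restrict (opBall F k 1))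
        hfm.ennreal_ofReal (ENNReal.ofReal t)
      have h5 : volume B ≤ (volume.restrict (opBall F k 1))
          {E | ENNReal.ofReal t ≤ ENNReal.ofReal (f E)} := by
        rw [Measure.restrict_apply' hBm]
        exact measure_mono fun E hE => ⟨ENNReal.ofReal_le_ofReal hE.2.le, hE.1⟩
      have h6 : ENNReal.ofReal t * volume B ≤ ENNReal.ofReal t * (V / 2) := by
        calc _ ≤ ENNReal.ofReal (k * S / D) * V :=
              (mul_le_mul_right h5 _).trans (h4.trans hint)
          _ = _ := by
            rw [show t = (k * S / D) * 2 by rw [ht]; ring, ENNReal.ofReal_mul' (by norm_num),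
              mul_assoc, ENNReal.ofReal_ofNat, ENNReal.mul_div_cancel (by norm_num) (by norm_num)]
      exact (ENNReal.mul_le_mul_iff_right (by simpa using ht0) ENNReal.ofReal_ne_top).1 h6
  have hV2 : V ≤ volume A + volume B := by
    refine (measure_mono fun E hE => ?_).trans (measure_union_le A B)
    rcases le_or_gt (f E) t with h7 | h7
    · exact Or.inl ⟨hE, h7⟩
    · exact Or.inr ⟨hE, h7⟩
  have hVtop : V ≠ ∞ := volume_opBall_one_ne_top
  have h8 : V / 2 + V / 2 ≤ volume A + V / 2 := by
    rw [ENNReal.add_halves]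
    exact hV2.trans (by gcongr)
  exact (ENNReal.add_le_add_iff_right (ENNReal.div_ne_top hVtop (by norm_num))).1 h8

/-- Around every point of the unit operator ball, a set of perturbations of proportion at least
`(r / 2) ^ (k D) / 2` changes the images of the given vectors by little. -/
theorem volume_opBall_two_le {N : ℕ} (h : Fin N → F) (hF : 0 < Module.finrank ℝ F)
    {W₀ : Fin k → F} (hW₀ : W₀ ∈ opBall F k 1) {r : ℝ} (hr0 : 0 < r) (hr1 : r ≤ 1) :
    ENNReal.ofReal ((r / 2) ^ (k * Module.finrank ℝ F) / 2) * volume (opBall F k 2) ≤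
      volume {W | W ∈ opBall F k 2 ∧ W - W₀ ∈ opBall F k r ∧
        ∑ j, ∑ l, (inner ℝ (h j) (W l - W₀ l)) ^ 2 ≤
          2 * r ^ 2 * k * (∑ j, ‖h j‖ ^ 2) / Module.finrank ℝ F} := by
  set D := Module.finrank ℝ F with hD
  set A := {E | E ∈ opBall F k 1 ∧
      ∑ j, ∑ l, (inner ℝ (h j) (E l)) ^ 2 ≤ 2 * k * (∑ j, ‖h j‖ ^ 2) / D}
  have hfr : Module.finrank ℝ (Fin k → F) = k * D := by simp [hD, Module.finrank_pi_fintype]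
  have hsub : (fun E => W₀ + E) '' (r • A) ⊆ {W | W ∈ opBall F k 2 ∧ W - W₀ ∈ opBall F k r ∧
        ∑ j, ∑ l, (inner ℝ (h j) (W l - W₀ l)) ^ 2 ≤
          2 * r ^ 2 * k * (∑ j, ‖h j‖ ^ 2) / D} := by
    rintro _ ⟨_, ⟨E, hE, rfl⟩, rfl⟩
    have h1 : r • E ∈ opBall F k r := by simpa using smul_mem_opBall hr0.le hE.1
    refine ⟨opBall_mono (by linarith) (add_mem_opBall hW₀ h1), by simpa using h1, ?_⟩
    simp only [Pi.add_apply, add_sub_cancel_left, Pi.smul_apply, real_inner_smul_right, mul_pow]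
    simp_rw [← Finset.mul_sum]
    calc _ ≤ r ^ 2 * (2 * k * (∑ j, ‖h j‖ ^ 2) / D) := by
          gcongr
          exact hE.2
      _ = _ := by ring
  refine le_trans ?_ (measure_mono hsub)
  -- The ambient ball has radius `2 ≥ 1 + r`, so the proportion is the ratio `(r / 2) ^ (k D)` of
  -- the two scalings, halved by the previous estimate.
  rw [Set.image_add_left, measure_preimage_add, Measure.addHaar_smul, ← smul_opBall_one two_pos,
    Measure.addHaar_smul, hfr, abs_of_pos (by positivity), abs_of_pos (by positivity)]
  calc _ = ENNReal.ofReal (r ^ (k * D)) * (volume (opBall F k 1) / 2) := by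
        rw [← mul_assoc, ← ENNReal.ofReal_mul (by positivity)]
        have h2 : (r / 2) ^ (k * D) / 2 * 2 ^ (k * D) = r ^ (k * D) / 2 := by
          rw [div_pow]
          field_simp
        rw [h2, ENNReal.ofReal_div_of_pos two_pos, ENNReal.ofReal_ofNat, ENNReal.mul_comm_div,
          mul_comm]
    _ ≤ _ := by
        gcongr
        exact half_volume_opBall_le h hF

end Averaging

/-- A union bound by averaging over an auxiliary measure space. -/
theorem measure_le_of_fiber_measure {α β : Type*} [MeasurableSpace α] [MeasurableSpace β]
    {Q : Measure α} [IsProbabilityMeasure Q] {V : Measure β} [SFinite V] {C : Set β}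
    (hC0 : V C ≠ 0) (hCt : V C ≠ ∞) (hCm : MeasurableSet C) {G : Set (α × β)}
    (hG : MeasurableSet G) (hGC : ∀ x ∈ G, x.2 ∈ C) {p δ : ℝ≥0∞} (hδ0 : δ ≠ 0) (hδt : δ ≠ ∞)
    (hp : ∀ b ∈ C, Q {a | (a, b) ∈ G} ≤ p) {B : Set α}
    (hB : ∀ a ∈ B, δ * V C ≤ V {b | (a, b) ∈ G}) : Q B ≤ p / δ := by
  have h1 : (δ * V C) * Q B ≤ V C * p := by
    -- `B` need not be measurable: it is enclosed in a measurable superlevel set, to which Markov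
    -- and Fubini apply.
    calc (δ * V C) * Q B ≤ (δ * V C) * Q {a | δ * V C ≤ V (Prod.mk a ⁻¹' G)} := by
          gcongr
          exact fun a ha => hB a ha
      _ ≤ ∫⁻ a, V (Prod.mk a ⁻¹' G) ∂Q :=
          mul_meas_ge_le_lintegral (measurable_measure_prodMk_left hG) _
      _ = (Q.prod V) G := (Measure.prod_apply hG).symm
      _ = ∫⁻ b, Q ((fun a => (a, b)) ⁻¹' G) ∂V := Measure.prod_apply_symm hG
      _ ≤ ∫⁻ b, C.indicator (fun _ => p) b ∂V := by
          refine lintegral_mono fun b => ?_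
          by_cases hb : b ∈ C
          · rw [Set.indicator_of_mem hb]
            exact hp b hb
          · rw [Set.indicator_of_notMem hb]
            have : (fun a => (a, b)) ⁻¹' G = ∅ :=
              Set.eq_empty_of_forall_notMem fun a ha => hb (hGC _ ha)
            simp [this]
      _ = V C * p := by rw [lintegral_indicator_const hCm, mul_comm]
  rw [ENNReal.le_div_iff_mul_le (Or.inl hδ0) (Or.inl hδt)]
  have h2 : V C * (Q B * δ) ≤ V C * p := by
    calc _ = (δ * V C) * Q B := by ring
      _ ≤ _ := h1
  exact (ENNReal.mul_le_mul_iff_right hC0 hCt).1 h2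

/-! ### From singular values, sparse laws and the LCD to the analytic setting. -/

/-- The right singular vectors of the `k` smallest singular values, with zero-based indices `n - k,
…, n - 1`. -/
theorem exists_orthonormal_norm_le_of_singularValues_le {E F : Type*} [NormedAddCommGroup E]
    [InnerProductSpace ℝ E] [FiniteDimensional ℝ E] [NormedAddCommGroup F] [InnerProductSpace ℝ F]
    [FiniteDimensional ℝ F] (A : E →ₗ[ℝ] F) {n k : ℕ} (hn : Module.finrank ℝ E = n) (hk : k ≤ n)
    {s : ℝ} (hs : A.singularValues (n - k) ≤ s) :
    ∃ W : Fin k → E, Orthonormal ℝ W ∧ ∀ l, ‖A (W l)‖ ≤ s := by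
  set b := A.isSymmetric_adjoint_comp_self.eigenvectorBasis hn with hb
  have hlt : ∀ l : Fin k, n - k + l < n := fun l => by omega
  refine ⟨fun l => b ⟨n - k + l, hlt l⟩, b.orthonormal.comp _ ?_, fun l => ?_⟩
  · intro l l' h
    simp only [Fin.mk.injEq] at h
    exact Fin.ext (by omega)
  · have h1 : ‖A (b ⟨n - k + l, hlt l⟩)‖ ^ 2 = A.singularValues (n - k + l) ^ 2 := by
      rw [A.sq_singularValues_of_lt hn (hlt l), ← real_inner_self_eq_norm_sq,
        ← LinearMap.adjoint_inner_left, ← LinearMap.comp_apply, hb,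
        LinearMap.IsSymmetric.apply_eigenvectorBasis, real_inner_smul_left,
        real_inner_self_eq_norm_sq, OrthonormalBasis.norm_eq_one]
      simp
    have h2 := A.singularValues_antitone (Nat.le_add_right (n - k) l)
    have h0 := A.singularValues_nonneg (n - k + l)
    rw [sq_eq_sq₀ (norm_nonneg _) h0] at h1
    rw [h1]
    exact h2.trans hs

theorem map_mul_bernoulliLaw (ν : ℝ) (μ : Measure ℝ) [IsProbabilityMeasure μ] :
    ((bernoulliLaw ν).prod μ).map (fun p => p.1 * p.2) = lazyLaw ν μ := by
  have hm : Measurable fun p : ℝ × ℝ => p.1 * p.2 := by fun_prop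
  have h0 : ((Measure.dirac (0 : ℝ)).prod μ).map (fun p => p.1 * p.2) = Measure.dirac 0 := by
    rw [Measure.dirac_prod, Measure.map_map hm (by fun_prop)]
    have : ((fun p : ℝ × ℝ => p.1 * p.2) ∘ Prod.mk 0) = fun _ => (0 : ℝ) := by
      ext x
      simp
    rw [this, Measure.map_const, measure_univ, one_smul]
  have h1 : ((Measure.dirac (1 : ℝ)).prod μ).map (fun p => p.1 * p.2) = μ := by
    rw [Measure.dirac_prod, Measure.map_map hm (by fun_prop)]
    have : ((fun p : ℝ × ℝ => p.1 * p.2) ∘ Prod.mk 1) = id := by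
      ext x
      simp
    rw [this, Measure.map_id]
  rw [bernoulliLaw, lazyLaw, Measure.add_prod, Measure.map_add _ _ hm, Measure.prod_smul_left,
    Measure.prod_smul_left, Measure.map_smul, Measure.map_smul, h0, h1]

theorem isProbabilityMeasure_bernoulliLaw {ν : ℝ} (h0 : 0 ≤ ν) (h1 : ν ≤ 1) :
    IsProbabilityMeasure (bernoulliLaw ν) := by
  constructor
  rw [bernoulliLaw]
  simp only [Measure.coe_add, Measure.coe_smul, Pi.add_apply, Pi.smul_apply, measure_univ,
    smul_eq_mul, mul_one]
  rw [← ENNReal.ofReal_add (by linarith) h0]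
  simp

theorem sparseLaw_pi {ι : Type*} [Fintype ι] {ν : ℝ} (h0 : 0 ≤ ν) (h1 : ν ≤ 1)
    (M : ι → Measure ℝ) [∀ i, IsProbabilityMeasure (M i)] :
    sparseLaw ν (Measure.pi M) = Measure.pi fun i => lazyLaw ν (M i) := by
  have hb := isProbabilityMeasure_bernoulliLaw h0 h1
  have hl : ∀ i, IsProbabilityMeasure (lazyLaw ν (M i)) := fun i =>
    isProbabilityMeasure_lazyLaw h0 h1 (M i)
  have hσ : ∀ i, SigmaFinite (((bernoulliLaw ν).prod (M i)).map fun p => p.1 * p.2) := fun i => by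
    rw [map_mul_bernoulliLaw]
    infer_instance
  have h := measurePreserving_arrowProdEquivProdArrow ℝ ℝ ι (fun _ => bernoulliLaw ν) M
  rw [sparseLaw, ← h.map_eq, Measure.map_map (by fun_prop) h.measurable]
  have h2 := Measure.pi_map_pi (μ := fun i => (bernoulliLaw ν).prod (M i))
    (f := fun _ (p : ℝ × ℝ) => p.1 * p.2) (fun i => by fun_prop)
  simp only [map_mul_bernoulliLaw] at h2
  exact h2

theorem pairLaw_eq_pi {Ω : Type*} [MeasurableSpace Ω] (P : Measure Ω) {d : ℕ} (ξ : Ω → Fin d → ℝ)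
    (m : Fin d → Measure ℝ) [∀ i, IsProbabilityMeasure (m i)] (hξ : P.map ξ = Measure.pi m) :
    pairLaw P ξ = Measure.pi (Sum.elim m m) := by
  have : ∀ i, IsProbabilityMeasure (Sum.elim m m i) := fun i => by
    cases i <;> (simp only [Sum.elim_inl, Sum.elim_inr]; infer_instance)
  rw [← (measurePreserving_sumPiEquivProdPi_symm (Sum.elim m m)).map_eq, pairLaw, hξ]
  congr 1

/-- The parameter is doubled because the infimum defining the `ψ₂`-norm is only known to be at most
`T`; an admissible `s` strictly below `2 T` certainly exists. -/
theorem MemS2.isSubG {Ω : Type*} [MeasurableSpace Ω] {P : Measure Ω} [IsProbabilityMeasure P]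
    {T : ℝ} (hT : 1 ≤ T) {X : Ω → ℝ} (h : MemS2 P T X) : IsSubG (P.map X) (2 * T) where
  prob := Measure.isProbabilityMeasure_map h.aemeasurable
  pos := by linarith
  mean_zero := by
    rw [integral_map h.aemeasurable (by fun_prop)]
    exact h.mean_zero
  sq_one := by
    rw [integral_map h.aemeasurable (by fun_prop), ← h.variance_one,
      variance_eq_integral h.aemeasurable, h.mean_zero]
    simp
  exp_le := by
    rw [lintegral_map' (by fun_prop) h.aemeasurable]
    have h1 : psi2Norm P X < ENNReal.ofReal (2 * T) :=
      h.psi2Norm_le.trans_lt ((ENNReal.ofReal_lt_ofReal_iff (by linarith)).2 (by linarith))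
    simp only [psi2Norm, iInf_lt_iff] at h1
    obtain ⟨s, ⟨hs0, hs⟩, hsT⟩ := h1
    rw [ENNReal.ofReal_lt_ofReal_iff (by linarith)] at hsT
    refine le_trans (lintegral_mono fun ω => ENNReal.ofReal_le_ofReal ?_) hs
    rw [div_pow, div_pow]
    gcongr

theorem distZ_sq {d : ℕ} (x : EuclideanSpace ℝ (Fin d)) :
    distZ x ^ 2 = ∑ i, (x i - round (x i)) ^ 2 := by
  set r : EuclideanSpace ℝ (Fin d) := WithLp.toLp 2 fun i => (round (x i) : ℝ) with hr
  have hmem : r ∈ {z : EuclideanSpace ℝ (Fin d) | ∀ i, ∃ a : ℤ, z i = a} :=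
    fun i => ⟨round (x i), rfl⟩
  have h : distZ x = dist x r := by
    refine le_antisymm (Metric.infDist_le_dist_of_mem hmem)
      ((Metric.le_infDist ⟨r, hmem⟩).2 fun z hz => ?_)
    rw [EuclideanSpace.dist_eq, EuclideanSpace.dist_eq]
    refine Real.sqrt_le_sqrt (Finset.sum_le_sum fun i _ => ?_)
    obtain ⟨a, ha⟩ := hz i
    rw [Real.dist_eq, Real.dist_eq, ha]
    exact pow_le_pow_left₀ (abs_nonneg _) (round_le (x i) a) 2
  rw [h, EuclideanSpace.dist_eq, Real.sq_sqrt (by positivity)]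
  exact Finset.sum_congr rfl fun i _ => by rw [Real.dist_eq, sq_abs]

theorem latticeEnergy_neg (μ : Measure ℝ) [IsProbabilityMeasure μ] (u : ℝ) :
    latticeEnergy μ (-u) = latticeEnergy μ u := by
  rw [latticeEnergy, latticeEnergy, ← integral_prod_swap]
  refine integral_congr_ae (.of_forall fun p => ?_)
  have : -u * (p.swap.1 - p.swap.2) = u * (p.1 - p.2) := by
    simp only [Prod.fst_swap, Prod.snd_swap]
    ring
  simp only [this]

theorem integral_sub_round_sq_prod {Ω : Type*} [MeasurableSpace Ω] {P : Measure Ω}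
    [IsProbabilityMeasure P] {X : Ω → ℝ} (hX : AEMeasurable X P) (u : ℝ) :
    Integrable (fun ω : Ω × Ω =>
      (u * (X ω.1 - X ω.2) - round (u * (X ω.1 - X ω.2))) ^ 2) (P.prod P) ∧
    ∫ ω : Ω × Ω, (u * (X ω.1 - X ω.2) - round (u * (X ω.1 - X ω.2))) ^ 2 ∂(P.prod P) =
      latticeEnergy (P.map X) u := by
  have hp : IsProbabilityMeasure (P.map X) := Measure.isProbabilityMeasure_map hX
  have h1 : (P.prod P).map (Prod.map X X) = (P.map X).prod (P.map X) := by
    have e1 : (fun ω : Ω × Ω => X ω.1) =ᵐ[P.prod P] fun ω => hX.mk X ω.1 :=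
      Measure.quasiMeasurePreserving_fst.ae_eq_comp hX.ae_eq_mk
    have e2 : (fun ω : Ω × Ω => X ω.2) =ᵐ[P.prod P] fun ω => hX.mk X ω.2 :=
      Measure.quasiMeasurePreserving_snd.ae_eq_comp hX.ae_eq_mk
    have e3 : Prod.map X X =ᵐ[P.prod P] Prod.map (hX.mk X) (hX.mk X) := by
      filter_upwards [e1, e2] with ω a b
      exact Prod.ext a b
    rw [Measure.map_congr e3, Measure.map_congr hX.ae_eq_mk,
      Measure.map_prod_map _ _ hX.measurable_mk hX.measurable_mk]
  have h2 : AEMeasurable (Prod.map X X) (P.prod P) :=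
    (hX.comp_fst).prodMk (hX.comp_snd)
  have h3 := integrable_latticeEnergy (P.map X) u
  have h4 := h3.aestronglyMeasurable
  rw [← h1] at h3 h4
  refine ⟨(integrable_map_measure h4 h2).1 h3, ?_⟩
  rw [latticeEnergy, ← h1, integral_map h2 h4]
  rfl

/-- The squared distance to `ℤ^d` splits over coordinates, so only the marginals of `ξ` enter. -/
theorem xiNorm_sq {Ω : Type*} [MeasurableSpace Ω] {P : Measure Ω} [IsProbabilityMeasure P] {d : ℕ}
    {ξ : Ω → Fin d → ℝ} (hξ : ∀ i, AEMeasurable (fun ω => ξ ω i) P)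
    (x : EuclideanSpace ℝ (Fin d)) :
    xiNorm P ξ x ^ 2 = ∑ i, latticeEnergy (P.map fun ω => ξ ω i) (x i) := by
  rw [xiNorm, Real.sq_sqrt (integral_nonneg fun _ => by positivity)]
  simp only [distZ_sq]
  rw [integral_finsetSum _ fun i _ => (integral_sub_round_sq_prod (hξ i) (x i)).1]
  exact Finset.sum_congr rfl fun i _ => (integral_sub_round_sq_prod (hξ i) (x i)).2

/-- No `θ ∈ (0, 1]` is admissible in the infimum, so `‖θ v‖_ξ² ≥ L² log (α θ ‖v‖ / L)`;
exponentiate. Negative `θ` follow because the energy is even. -/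
theorem abs_le_of_lt_RlogD {Ω : Type*} [MeasurableSpace Ω] {P : Measure Ω} [IsProbabilityMeasure P]
    {d : ℕ} {ξ : Ω → Fin d → ℝ} (hξ : ∀ i, AEMeasurable (fun ω => ξ ω i) P) {L α : ℝ} (hL : 0 < L)
    (hα : 0 < α) {v : EuclideanSpace ℝ (Fin d)} (hv : 0 < ‖v‖) (h : 16 < RlogD P L α ξ v) {θ : ℝ}
    (hθ : |θ| ≤ 1) :
    |θ| ≤ L / (α * ‖v‖) *
      Real.exp (1 / L ^ 2 * ∑ i, latticeEnergy (P.map fun ω => ξ ω i) (θ * v i)) := by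
  have hp : ∀ i, IsProbabilityMeasure (P.map fun ω => ξ ω i) := fun i =>
    Measure.isProbabilityMeasure_map (hξ i)
  have key : ∀ θ : ℝ, 0 < θ → θ ≤ 1 → θ ≤ L / (α * ‖v‖) *
      Real.exp (1 / L ^ 2 * ∑ i, latticeEnergy (P.map fun ω => ξ ω i) (θ * v i)) := by
    intro θ h0 h1
    have h2 : ¬ xiNorm P ξ (θ • v) < L * √(Real.posLog (α * ‖θ • v‖ / L)) := by
      intro hlt
      have h3 : RlogD P L α ξ v ≤ ENNReal.ofReal θ := iInf₂_le θ ⟨h0, hlt⟩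
      have h4 : ENNReal.ofReal θ ≤ 1 := by
        rw [← ENNReal.ofReal_one]
        exact ENNReal.ofReal_le_ofReal h1
      have h5 := h.trans_le (h3.trans h4)
      exact absurd h5 (by norm_num)
    rw [not_lt] at h2
    have h3 : L ^ 2 * Real.posLog (α * ‖θ • v‖ / L) ≤ xiNorm P ξ (θ • v) ^ 2 := by
      have h4 := pow_le_pow_left₀ (by positivity) h2 2
      rwa [mul_pow, Real.sq_sqrt Real.posLog_nonneg] at h4
    rw [xiNorm_sq hξ, norm_smul, Real.norm_of_nonneg h0.le] at h3
    have h4 : 0 < α * (θ * ‖v‖) / L := by positivity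
    have h5 : Real.log (α * (θ * ‖v‖) / L) ≤
        1 / L ^ 2 * ∑ i, latticeEnergy (P.map fun ω => ξ ω i) (θ * v i) := by
      have h6 : Real.log (α * (θ * ‖v‖) / L) ≤ Real.posLog (α * (θ * ‖v‖) / L) :=
        le_max_right _ _
      refine h6.trans ?_
      rw [one_div, ← div_eq_inv_mul, le_div_iff₀ (by positivity), mul_comm]
      exact h3
    have h6 := Real.exp_le_exp.2 h5
    rw [Real.exp_log h4] at h6
    have h7 : θ = L / (α * ‖v‖) * (α * (θ * ‖v‖) / L) := by
      field_simp
    rw [h7]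
    nth_rewrite 2 [← h7]
    gcongr
  rcases lt_trichotomy θ 0 with h0 | h0 | h0
  · have h1 := key (-θ) (by linarith) (by rwa [abs_of_neg h0] at hθ)
    rw [abs_of_neg h0]
    simpa only [neg_mul, latticeEnergy_neg] using h1
  · rw [h0, abs_zero]
    positivity
  · rw [abs_of_pos h0] at hθ ⊢
    exact key θ h0 hθ

theorem IsSubG.lintegral_exp_sq_lazyLaw_le {μ : Measure ℝ} {T : ℝ} (h : IsSubG μ T) {ν : ℝ}
    (h0 : 0 ≤ ν) (h1 : ν ≤ 1) :
    ∫⁻ x, ENNReal.ofReal (Real.exp ((x / T) ^ 2)) ∂(lazyLaw ν μ) ≤ 2 := by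
  rw [lintegral_lazyLaw]
  calc _ ≤ ENNReal.ofReal (1 - ν) * 2 + ENNReal.ofReal ν * 2 := by
        gcongr
        · simp
        · exact h.exp_le
    _ = 2 := by
        rw [← add_mul, ← ENNReal.ofReal_add (by linarith) h0]
        simp

theorem isProbabilityMeasure_lazyLaw_elim {κ : Type*} {M : κ → Measure ℝ} {T ν : ℝ}
    (hM : ∀ i, IsSubG (M i) T) (h0 : 0 ≤ ν) (h1 : ν ≤ 1) (i : κ ⊕ κ) :
    IsProbabilityMeasure (lazyLaw ν (Sum.elim M M i)) := by
  have : IsProbabilityMeasure (Sum.elim M M i) := by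
    rcases i with i | i <;> exact (hM i).prob
  exact isProbabilityMeasure_lazyLaw h0 h1 _

/-! ### Independent rows: Hilbert–Schmidt tail and small ball for fixed test vectors. -/

section Rows

variable {κ : Type*} [Fintype κ] {N : ℕ}

/-- The law of a matrix with `N` independent rows, the entries of the row `j` being independent and
lazy versions of `M j i`, each used twice. -/
noncomputable def rowsLaw (ν : ℝ) (M : Fin N → κ → Measure ℝ) : Measure (Fin N → κ ⊕ κ → ℝ) :=
  Measure.pi fun j => Measure.pi fun i => lazyLaw ν (Sum.elim (M j) (M j) i)

/-- Chernoff: with `D` the number of entries, `E exp (∑ h² / T²) ≤ 2 ^ D ≤ exp D`, while the event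
forces the exponent to be at least `2 D`. -/
theorem rowsLaw_hilbertSchmidt_ge {M : Fin N → κ → Measure ℝ} {T ν : ℝ}
    (hM : ∀ j i, IsSubG (M j i) T) (hT : 0 < T) (h0 : 0 ≤ ν) (h1 : ν ≤ 1) :
    rowsLaw ν M {h | 2 * T ^ 2 * (2 * Fintype.card κ) * N ≤ ∑ j, ∑ i, h j i ^ 2} ≤
      ENNReal.ofReal (Real.exp (-(2 * Fintype.card κ * N))) := by
  have hp := fun j => isProbabilityMeasure_lazyLaw_elim (hM j) h0 h1
  set D : ℝ := 2 * Fintype.card κ * N with hD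
  have hrow : ∀ j, ∫⁻ z, ∏ i, ENNReal.ofReal (Real.exp ((z i / T) ^ 2))
      ∂(Measure.pi fun i => lazyLaw ν (Sum.elim (M j) (M j) i)) ≤ 2 ^ (2 * Fintype.card κ) := by
    intro j
    rw [lintegral_pi_prod_eq_prod (f := fun _ x => ENNReal.ofReal (Real.exp ((x / T) ^ 2)))
      (fun i => by fun_prop)]
    refine (Finset.prod_le_pow_card _ _ 2 fun i _ => ?_).trans ?_
    · rcases i with i | i <;> exact (hM j i).lintegral_exp_sq_lazyLaw_le h0 h1
    · simp [two_mul]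
  have hall : ∫⁻ h, ∏ j, ∏ i, ENNReal.ofReal (Real.exp ((h j i / T) ^ 2)) ∂(rowsLaw ν M) ≤
      ENNReal.ofReal (Real.exp D) := by
    rw [rowsLaw, lintegral_pi_prod_eq_prod
      (f := fun _ (z : κ ⊕ κ → ℝ) => ∏ i, ENNReal.ofReal (Real.exp ((z i / T) ^ 2)))
      (fun j => Finset.measurable_fun_prod _ fun i _ => by fun_prop)]
    refine (Finset.prod_le_pow_card _ _ _ fun j _ => hrow j).trans ?_
    rw [Finset.card_univ, Fintype.card_fin, ← pow_mul]
    have h2 : (2 : ℝ≥0∞) = ENNReal.ofReal 2 := by simp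
    rw [h2, ← ENNReal.ofReal_pow (by norm_num)]
    refine ENNReal.ofReal_le_ofReal ?_
    have h3 : D = ((2 * Fintype.card κ * N : ℕ) : ℝ) * 1 := by
      rw [hD]
      push_cast
      ring
    rw [h3, Real.exp_nat_mul]
    gcongr
    linarith [Real.add_one_le_exp 1]
  have hsub : {h : Fin N → κ ⊕ κ → ℝ |
      2 * T ^ 2 * (2 * Fintype.card κ) * N ≤ ∑ j, ∑ i, h j i ^ 2} ⊆
      {h | ENNReal.ofReal (Real.exp (2 * D)) ≤
        ∏ j, ∏ i, ENNReal.ofReal (Real.exp ((h j i / T) ^ 2))} := by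
    intro h hh
    have hh' : 2 * T ^ 2 * (2 * Fintype.card κ) * N ≤ ∑ j, ∑ i, h j i ^ 2 := hh
    show ENNReal.ofReal (Real.exp (2 * D)) ≤
        ∏ j, ∏ i, ENNReal.ofReal (Real.exp ((h j i / T) ^ 2))
    have e1 : ∀ j, ∏ i, ENNReal.ofReal (Real.exp ((h j i / T) ^ 2)) =
        ENNReal.ofReal (Real.exp (∑ i, (h j i / T) ^ 2)) := fun j => by
      rw [Real.exp_sum, ENNReal.ofReal_prod_of_nonneg fun _ _ => (Real.exp_pos _).le]
    simp only [e1]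
    rw [← ENNReal.ofReal_prod_of_nonneg fun _ _ => (Real.exp_pos _).le, ← Real.exp_sum]
    refine ENNReal.ofReal_le_ofReal (Real.exp_le_exp.2 ?_)
    simp only [div_pow, ← Finset.sum_div]
    rw [le_div_iff₀ (by positivity), hD]
    linarith
  calc _ ≤ _ := measure_mono hsub
    _ ≤ (∫⁻ h, ∏ j, ∏ i, ENNReal.ofReal (Real.exp ((h j i / T) ^ 2)) ∂(rowsLaw ν M)) /
        ENNReal.ofReal (Real.exp (2 * D)) :=
      meas_ge_le_lintegral_div (Finset.measurable_fun_prod _ fun j _ =>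
        Finset.measurable_fun_prod _ fun i _ => by fun_prop).aemeasurable
        (by simp [Real.exp_pos]) ENNReal.ofReal_ne_top
    _ ≤ ENNReal.ofReal (Real.exp D) / ENNReal.ofReal (Real.exp (2 * D)) := by gcongr
    _ = ENNReal.ofReal (Real.exp (-D)) := by
        rw [← ENNReal.ofReal_div_of_pos (Real.exp_pos _), ← Real.exp_sub]
        congr 2
        ring

/-- The two blocks of `h` applied to `Y` have total squared length at most `q`. -/
def blockBall (Y : κ → ℝ) (q : ℝ) : Set (Fin N → κ ⊕ κ → ℝ) :=
  {h | ∑ j, ((∑ i, h j (Sum.inl i) * Y i) ^ 2 + (∑ i, h j (Sum.inr i) * Y i) ^ 2) ≤ q}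

theorem sum_inner_toLp_sq {ι : Type*} [Fintype ι] {k : ℕ} (W : Fin k → EuclideanSpace ℝ ι)
    (z : ι → ℝ) :
    ‖∑ i, z i • (WithLp.toLp 2 fun l => W l i : EuclideanSpace ℝ (Fin k))‖ ^ 2 =
      ∑ l, (inner ℝ (WithLp.toLp 2 z) (W l)) ^ 2 := by
  rw [EuclideanSpace.norm_sq_eq]
  refine Finset.sum_congr rfl fun l _ => ?_
  rw [Real.norm_eq_abs, sq_abs]
  simp [PiLp.inner_apply, mul_comm]

/-- Chernoff's inequality with the weights of the row estimate; independence of the rows produces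
the `N`-th power. -/
theorem rowsLaw_blockBall_le [DecidableEq κ] {M : Fin N → κ → Measure ℝ} {T : ℝ}
    (hM : ∀ j i, IsSubG (M j i) T) (hT : 1 ≤ T) {ν lam ρ γ : ℝ} (hν0 : 0 < ν) (hν1 : ν ≤ 1)
    (hlam : 0 < lam)
    (hlamT : 128 * T ^ 4 * lam ≤ 1) (hρ : 0 < ρ) (hγ0 : 0 < γ) (hγ : 3456 ≤ ν * γ ^ 2)
    {Y : κ → ℝ} (hY : ∀ j, ∀ θ : ℝ, |θ| ≤ 1 →
      |θ| ≤ ρ * Real.exp (1 / γ ^ 2 * ∑ i, latticeEnergy (M j i) (θ * Y i)))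
    {k : ℕ} {W : Fin k → EuclideanSpace ℝ (κ ⊕ κ)} (hW : W ∈ opBall (EuclideanSpace ℝ (κ ⊕ κ)) k 2)
    (hWk : (k : ℝ) / 4 ≤ ∑ l, ‖W l‖ ^ 2) (s q : ℝ) :
    rowsLaw ν M ({h | ∑ j, ∑ l, (inner ℝ (WithLp.toLp 2 (h j)) (W l)) ^ 2 ≤ s} ∩ blockBall Y q) ≤
      ENNReal.ofReal (Real.exp (lam * s + 2 * Real.pi ^ 2 * q) *
        (boxConst ^ 2 * (166 * ρ ^ 2 * Real.exp (-(ν * lam * k / 32)))) ^ N) := by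
  have hp := fun j => isProbabilityMeasure_lazyLaw_elim (hM j) hν0.le hν1
  -- Transposition: the `w i` are the rows of the matrix with columns `W l`, so `∑_l ⟨z, W l⟩² =
  -- ‖∑_i z_i w_i‖²` and the operator norm bound `2` becomes `M = 4`.
  set w : κ ⊕ κ → EuclideanSpace ℝ (Fin k) := fun i => WithLp.toLp 2 fun l => W l i with hw
  have hw1 : ∀ p, ∑ i, (inner ℝ (w i) p) ^ 2 ≤ 4 * ‖p‖ ^ 2 := by
    intro p
    have h1 : ∑ i, (inner ℝ (w i) p) ^ 2 = ‖∑ l, p l • W l‖ ^ 2 := by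
      rw [EuclideanSpace.norm_sq_eq]
      refine Finset.sum_congr rfl fun i _ => ?_
      rw [Real.norm_eq_abs, sq_abs]
      simp [PiLp.inner_apply, hw]
    rw [h1]
    calc _ ≤ (2 * ‖p‖) ^ 2 := by
          gcongr
          exact hW p
      _ = _ := by ring
  have hwk : (k : ℝ) / 4 ≤ ∑ i, ‖w i‖ ^ 2 := by
    refine hWk.trans (le_of_eq ?_)
    simp only [EuclideanSpace.norm_sq_eq, hw]
    exact Finset.sum_comm
  set f : (κ ⊕ κ → ℝ) → ℝ := fun z => lam * ‖∑ i, z i • w i‖ ^ 2 +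
      2 * Real.pi ^ 2 * ((∑ i, z (Sum.inl i) * Y i) ^ 2 + (∑ i, z (Sum.inr i) * Y i) ^ 2) with hf
  set c : ℝ := lam * s + 2 * Real.pi ^ 2 * q with hc
  set K : ℝ := boxConst ^ 2 * (166 * ρ ^ 2 * Real.exp (-(ν * lam * k / 32))) with hK
  have hfm : Measurable f := by fun_prop
  have hint : ∫⁻ h, ∏ j, ENNReal.ofReal (Real.exp (-f (h j))) ∂(rowsLaw ν M) ≤
      ENNReal.ofReal (K ^ N) := by
    rw [rowsLaw, lintegral_pi_prod_eq_prod (f := fun _ z => ENNReal.ofReal (Real.exp (-f z)))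
      (fun j => by fun_prop)]
    refine (Finset.prod_le_pow_card _ _ (ENNReal.ofReal K) fun j _ => ?_).trans ?_
    · exact lintegral_row_le (hM j) hT hν0 hν1 hlam hlamT hρ hγ0 hγ hw1 hwk (hY j)
    · rw [Finset.card_univ, Fintype.card_fin, ENNReal.ofReal_pow (by positivity)]
  have hsub : ({h | ∑ j, ∑ l, (inner ℝ (WithLp.toLp 2 (h j)) (W l)) ^ 2 ≤ s} ∩ blockBall Y q) ⊆
      {h : Fin N → κ ⊕ κ → ℝ | ENNReal.ofReal (Real.exp (-c)) ≤
        ∏ j, ENNReal.ofReal (Real.exp (-f (h j)))} := by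
    rintro h ⟨h1, h2⟩
    have h1' : ∑ j, ∑ l, (inner ℝ (WithLp.toLp 2 (h j)) (W l)) ^ 2 ≤ s := h1
    have h2' : ∑ j, ((∑ i, h j (Sum.inl i) * Y i) ^ 2 + (∑ i, h j (Sum.inr i) * Y i) ^ 2) ≤ q := h2
    show ENNReal.ofReal (Real.exp (-c)) ≤ ∏ j, ENNReal.ofReal (Real.exp (-f (h j)))
    rw [← ENNReal.ofReal_prod_of_nonneg fun _ _ => (Real.exp_pos _).le, ← Real.exp_sum]
    refine ENNReal.ofReal_le_ofReal (Real.exp_le_exp.2 ?_)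
    rw [Finset.sum_neg_distrib, neg_le_neg_iff]
    simp only [hf, Finset.sum_add_distrib, ← Finset.mul_sum, hw, sum_inner_toLp_sq]
    rw [← Finset.sum_add_distrib, hc]
    gcongr
  calc _ ≤ _ := measure_mono hsub
    _ ≤ (∫⁻ h, ∏ j, ENNReal.ofReal (Real.exp (-f (h j))) ∂(rowsLaw ν M)) /
        ENNReal.ofReal (Real.exp (-c)) :=
      meas_ge_le_lintegral_div (Finset.measurable_fun_prod _ fun j _ =>
        (hfm.comp (measurable_pi_apply j)).neg.exp.ennreal_ofReal).aemeasurable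
        (by simp [Real.exp_pos]) ENNReal.ofReal_ne_top
    _ ≤ ENNReal.ofReal (K ^ N) / ENNReal.ofReal (Real.exp (-c)) := by gcongr
    _ = _ := by
        rw [← ENNReal.ofReal_div_of_pos (Real.exp_pos _), Real.exp_neg, div_inv_eq_mul, mul_comm]

end Rows

/-! ### Removing the dependence of the test vectors on the matrix. -/

section Bad

variable {κ : Type*} [Fintype κ] {N : ℕ}

/-- There are `k` orthonormal vectors which `h` maps to vectors of squared length at most `s`. -/
def smallOn (κ : Type*) [Fintype κ] (N k : ℕ) (s : ℝ) : Set (Fin N → κ ⊕ κ → ℝ) :=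
  {h | ∃ W : Fin k → EuclideanSpace ℝ (κ ⊕ κ), Orthonormal ℝ W ∧
    ∀ l, ∑ j, (inner ℝ (WithLp.toLp 2 (h j)) (W l)) ^ 2 ≤ s}

/-- Each bad `h` comes with its own `W₀`, but a fixed proportion of all `W` near `W₀` is almost as
good for this `h`. The deterministic-`W` bound divided by that proportion is the result. -/
theorem rowsLaw_smallOn_le [DecidableEq κ] [Nonempty κ] {M : Fin N → κ → Measure ℝ} {T : ℝ}
    (hM : ∀ j i, IsSubG (M j i) T) (hT : 1 ≤ T) {ν lam ρ γ : ℝ} (hν0 : 0 < ν) (hν1 : ν ≤ 1)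
    (hlam : 0 < lam) (hlamT : 128 * T ^ 4 * lam ≤ 1) (hρ : 0 < ρ) (hγ0 : 0 < γ)
    (hγ : 3456 ≤ ν * γ ^ 2) {Y : κ → ℝ} (hY : ∀ j, ∀ θ : ℝ, |θ| ≤ 1 →
      |θ| ≤ ρ * Real.exp (1 / γ ^ 2 * ∑ i, latticeEnergy (M j i) (θ * Y i)))
    {k : ℕ} {r : ℝ} (hr0 : 0 < r) (hr1 : r ≤ 1 / 2) (s L q : ℝ) :
    rowsLaw ν M ((smallOn κ N k s ∩ {h | ∑ j, ∑ i, h j i ^ 2 ≤ L}) ∩ blockBall Y q) ≤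
      ENNReal.ofReal (Real.exp (lam * (2 * k * s + 4 * r ^ 2 * k * L / (2 * Fintype.card κ)) +
        2 * Real.pi ^ 2 * q) *
        (boxConst ^ 2 * (166 * ρ ^ 2 * Real.exp (-(ν * lam * k / 32)))) ^ N) /
      ENNReal.ofReal ((r / 2) ^ (k * (2 * Fintype.card κ)) / 2) := by
  have hp := fun j => isProbabilityMeasure_lazyLaw_elim (hM j) hν0.le hν1
  have : IsProbabilityMeasure (rowsLaw ν M) := by
    rw [rowsLaw]
    infer_instance
  let E := EuclideanSpace ℝ (κ ⊕ κ)
  have hfin : Module.finrank ℝ E = 2 * Fintype.card κ := by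
    rw [finrank_euclideanSpace, Fintype.card_sum, two_mul]
  have hd : 0 < Fintype.card κ := Fintype.card_pos
  -- By `a² ≤ 2 b² + 2 (a - b)²`: the first term comes from `W₀`, the second from the averaged size
  -- of the perturbation under the Hilbert–Schmidt bound `L`.
  set S : ℝ := 2 * k * s + 4 * r ^ 2 * k * L / (2 * Fintype.card κ) with hS
  have hC0 : volume (opBall E k 2) ≠ 0 := volume_opBall_ne_zero two_pos
  have hCt : volume (opBall E k 2) ≠ ∞ := volume_opBall_ne_top two_pos
  set G : Set ((Fin N → κ ⊕ κ → ℝ) × (Fin k → E)) := {x | x.2 ∈ opBall E k 2 ∧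
    (k : ℝ) / 4 ≤ ∑ l, ‖x.2 l‖ ^ 2 ∧
    ∑ j, ∑ l, (inner ℝ (WithLp.toLp 2 (x.1 j)) (x.2 l)) ^ 2 ≤ S ∧ x.1 ∈ blockBall Y q} with hG
  have hGm : MeasurableSet G := by
    have m1 : MeasurableSet {x : (Fin N → κ ⊕ κ → ℝ) × (Fin k → E) | x.2 ∈ opBall E k 2} :=
      (isClosed_opBall 2).measurableSet.preimage measurable_snd
    have m2 : MeasurableSet {x : (Fin N → κ ⊕ κ → ℝ) × (Fin k → E) |
        (k : ℝ) / 4 ≤ ∑ l, ‖x.2 l‖ ^ 2} :=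
      (isClosed_le continuous_const (by fun_prop)).measurableSet
    have m3 : MeasurableSet {x : (Fin N → κ ⊕ κ → ℝ) × (Fin k → E) |
        ∑ j, ∑ l, (inner ℝ (WithLp.toLp 2 (x.1 j)) (x.2 l)) ^ 2 ≤ S} :=
      (isClosed_le (by fun_prop) continuous_const).measurableSet
    have m4 : MeasurableSet {x : (Fin N → κ ⊕ κ → ℝ) × (Fin k → E) | x.1 ∈ blockBall Y q} := by
      have : IsClosed (blockBall (N := N) Y q) := isClosed_le (by fun_prop) continuous_const
      exact this.measurableSet.preimage measurable_fst
    exact m1.inter (m2.inter (m3.inter m4))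
  refine measure_le_of_fiber_measure hC0 hCt (isClosed_opBall 2).measurableSet hGm
    (fun x hx => hx.1) (by simpa using by positivity) ENNReal.ofReal_ne_top (fun W hW => ?_)
    (fun h hh => ?_)
  · by_cases hWk : (k : ℝ) / 4 ≤ ∑ l, ‖W l‖ ^ 2
    · refine (measure_mono ?_).trans
        (rowsLaw_blockBall_le hM hT hν0 hν1 hlam hlamT hρ hγ0 hγ hY hW hWk S q)
      exact fun h hh => ⟨hh.2.2.1, hh.2.2.2⟩
    · have : {a | (a, W) ∈ G} = ∅ := Set.eq_empty_of_forall_notMem fun a ha => hWk ha.2.1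
      rw [this, measure_empty]
      exact zero_le
  · obtain ⟨⟨⟨W₀, hW₀, hs⟩, hL⟩, hq⟩ := hh
    have hL' : ∑ j, ∑ i, h j i ^ 2 ≤ L := hL
    have h1 := volume_opBall_two_le (fun j => (WithLp.toLp 2 (h j) : E)) (by rw [hfin]; omega)
      (mem_opBall_one_of_orthonormal hW₀) hr0 (by linarith)
    rw [hfin] at h1
    refine h1.trans (measure_mono ?_)
    rintro W ⟨w1, w2, w3⟩
    refine ⟨w1, ?_, ?_, hq⟩
    -- Perturbed unit vectors keep norm at least `1/2` because `r ≤ 1/2`; orthogonality is no longer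
    -- needed.
    · have h2 : ∀ l, (1 : ℝ) / 4 ≤ ‖W l‖ ^ 2 := by
        intro l
        have h3 := norm_le_of_mem_opBall w2 l
        have h4 := norm_sub_norm_le (W₀ l) (W l)
        rw [norm_sub_rev, hW₀.1 l] at h4
        have h5 : 1 / 2 ≤ ‖W l‖ := by
          have : ‖W l - W₀ l‖ ≤ r := h3
          linarith
        nlinarith
      calc (k : ℝ) / 4 = ∑ l : Fin k, (1 : ℝ) / 4 := by
            simp
            ring
        _ ≤ _ := Finset.sum_le_sum fun l _ => h2 l
    · have hHS : ∑ j, ‖(WithLp.toLp 2 (h j) : E)‖ ^ 2 ≤ L := by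
        refine le_trans (le_of_eq (Finset.sum_congr rfl fun j _ => ?_)) hL'
        rw [EuclideanSpace.norm_sq_eq]
        exact Finset.sum_congr rfl fun i _ => by rw [Real.norm_eq_abs, sq_abs]
      have a1 : ∀ j l, (inner ℝ (WithLp.toLp 2 (h j) : E) (W l)) ^ 2 ≤
          2 * (inner ℝ (WithLp.toLp 2 (h j) : E) (W₀ l)) ^ 2 +
          2 * (inner ℝ (WithLp.toLp 2 (h j) : E) (W l - W₀ l)) ^ 2 := by
        intro j l
        rw [inner_sub_right]
        nlinarith [sq_nonneg (2 * inner ℝ (WithLp.toLp 2 (h j) : E) (W₀ l) -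
          inner ℝ (WithLp.toLp 2 (h j) : E) (W l))]
      have a2 : ∑ j, ∑ l, (inner ℝ (WithLp.toLp 2 (h j) : E) (W₀ l)) ^ 2 ≤ k * s := by
        rw [Finset.sum_comm]
        calc _ ≤ ∑ l : Fin k, s := Finset.sum_le_sum fun l _ => hs l
          _ = k * s := by simp
      calc _ ≤ ∑ j, ∑ l, (2 * (inner ℝ (WithLp.toLp 2 (h j) : E) (W₀ l)) ^ 2 +
          2 * (inner ℝ (WithLp.toLp 2 (h j) : E) (W l - W₀ l)) ^ 2) :=
            Finset.sum_le_sum fun j _ => Finset.sum_le_sum fun l _ => a1 j l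
        _ = 2 * ∑ j, ∑ l, (inner ℝ (WithLp.toLp 2 (h j) : E) (W₀ l)) ^ 2 +
            2 * ∑ j, ∑ l, (inner ℝ (WithLp.toLp 2 (h j) : E) (W l - W₀ l)) ^ 2 := by
            simp only [Finset.sum_add_distrib, Finset.mul_sum]
        _ ≤ 2 * (k * s) + 2 * (2 * r ^ 2 * k * L / (2 * Fintype.card κ : ℕ)) := by
            gcongr
            refine w3.trans ?_
            gcongr
        _ = S := by
            rw [hS]
            push_cast
            ring

end Bad

/-! ### Constants and the final numerical comparison. -/

/-- The absolute constant in the small ball estimate. -/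
noncomputable def rankConst : ℝ := 2 + 4 * Real.exp 2 * (166 * boxConst ^ 2)

theorem two_le_rankConst : 2 ≤ rankConst := by
  rw [rankConst]
  have : 0 ≤ 4 * Real.exp 2 * (166 * boxConst ^ 2) := by positivity
  linarith

theorem le_rankConst_sq : 4 * (Real.exp 2 * (166 * boxConst ^ 2)) ≤ rankConst ^ 2 := by
  have h0 : 0 ≤ 4 * Real.exp 2 * (166 * boxConst ^ 2) := by positivity
  have h1 := two_le_rankConst
  have h2 : 4 * (Real.exp 2 * (166 * boxConst ^ 2)) ≤ rankConst := by
    rw [rankConst]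
    linarith
  nlinarith

/-- The loss of the union bound is absorbed. -/
theorem inv_radius_pow_le {T c₀ : ℝ} (hT : 1 ≤ T) (hc₀ : 0 < c₀) (hcT : c₀ * T ≤ 1) {m d k : ℕ}
    (hd : (d : ℝ) ≤ 2 * c₀ ^ 2 * m) :
    ((c₀ / (64 * T) / 2) ^ (k * (2 * d)))⁻¹ ≤ Real.exp (96 * c₀ * m * k) := by
  -- A crude bound suffices: `128 T / c₀ ≤ (12 / c₀)²` as `c₀ T ≤ 1`, and one factor `1 / c₀` in the
  -- exponent is repaid by `d ≤ 2 c₀² m`.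
  have h1 : (c₀ / (64 * T) / 2)⁻¹ ≤ Real.exp (24 / c₀) := by
    have h2 : (c₀ / (64 * T) / 2)⁻¹ = 128 * T / c₀ := by
      field_simp
      norm_num
    have h3 : 12 / c₀ ≤ Real.exp (12 / c₀) := by linarith [Real.add_one_le_exp (12 / c₀)]
    have h4 : Real.exp (24 / c₀) = Real.exp (12 / c₀) ^ 2 := by
      rw [← Real.exp_nat_mul]
      congr 1
      push_cast
      ring
    rw [h2, h4]
    calc 128 * T / c₀ ≤ (12 / c₀) ^ 2 := by
          rw [div_pow, div_le_div_iff₀ hc₀ (by positivity)]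
          nlinarith
      _ ≤ _ := by gcongr
  rw [← inv_pow]
  calc _ ≤ Real.exp (24 / c₀) ^ (k * (2 * d)) := by gcongr
    _ = Real.exp (48 * k * d / c₀) := by
        rw [← Real.exp_nat_mul]
        congr 1
        push_cast
        ring
    _ ≤ _ := by
        refine Real.exp_le_exp.2 ?_
        rw [div_le_iff₀ hc₀]
        have : (0 : ℝ) ≤ k := k.cast_nonneg
        nlinarith

section Numeric

variable {T ν c₀ : ℝ} {m N d k : ℕ}

/-- The gain `N ν lam k / 32`, at least `m ν lam k / 64`, has to cover the Chernoff weight, the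
averaging loss `96 c₀ m k` and the target `c₀ m k / 4`. The tiny constant in `hc`, equivalent to
`c₀` being a small multiple of `lam ν`, is chosen for this. The weight from `blockBall` is at most
`2 N`, whence `exp 2` in `rankConst`. -/
theorem main_term_le (hT : 1 ≤ T) (hν : ν ≤ 1 / 4) (hc₀ : 0 < c₀)
    (hc : c₀ ≤ 1 / 10 ^ 9 * (T ^ 4)⁻¹ * ν) (hm : m = N + d) (hN : 1 ≤ N)
    (hd : (d : ℝ) ≤ 2 * c₀ ^ 2 * m) {ρ τ : ℝ} (hρ : 0 < ρ) (hρτ : ρ ≤ τ) {S q : ℝ}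
    (hS : S ≤ c₀ ^ 2 * m * k / 64) (hq : q ≤ m / 32) :
    Real.exp (1 / (2048 * T ^ 4) * S + 2 * Real.pi ^ 2 * q) *
      (boxConst ^ 2 * (166 * ρ ^ 2 * Real.exp (-(ν * (1 / (2048 * T ^ 4)) * k / 32)))) ^ N *
      (2 * ((c₀ / (64 * T) / 2) ^ (k * (2 * d)))⁻¹) ≤
    1 / 2 * (Real.exp (-(c₀ * m * k / 4)) * (rankConst * τ) ^ (2 * N)) := by
  set lam : ℝ := 1 / (2048 * T ^ 4) with hlam
  have hT4 : 1 ≤ T ^ 4 := one_le_pow₀ hT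
  have hlam0 : 0 < lam := by positivity
  have hlam1 : lam ≤ 1 / 2048 := by
    rw [hlam]
    gcongr
    linarith
  have hinv : (T ^ 4)⁻¹ = 2048 * lam := by
    rw [hlam]
    field_simp
  rw [hinv] at hc
  have hν0 : 0 < ν := by
    by_contra hcon
    rw [not_lt] at hcon
    nlinarith [mul_nonneg hlam0.le (neg_nonneg.2 hcon)]
  have hlv : 0 < lam * ν := by positivity
  have hc1 : c₀ ≤ lam * ν / 400000 := by linarith
  have hcν : c₀ ≤ ν / 8 := by nlinarith
  have hc01 : c₀ ≤ 1 / 32 := by linarith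
  have hcT : c₀ * T ≤ 1 := by
    have h1 : T ≤ T ^ 4 := by
      calc T = T ^ 1 := (pow_one T).symm
        _ ≤ T ^ 4 := pow_le_pow_right₀ hT (by norm_num)
    have h2 : lam * T ^ 4 = 1 / 2048 := by
      rw [hlam]
      field_simp
    calc c₀ * T ≤ (lam * ν / 400000) * T ^ 4 := by gcongr
      _ = ν * (lam * T ^ 4) / 400000 := by ring
      _ ≤ 1 := by
          rw [h2]
          linarith
  have hk0 : (0 : ℝ) ≤ k := k.cast_nonneg
  have hm0 : (0 : ℝ) ≤ m := m.cast_nonneg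
  have hmR : (m : ℝ) = N + d := by rw [hm]; push_cast; rfl
  have hNm : (m : ℝ) / 2 ≤ N := by
    have : 2 * c₀ ^ 2 * m ≤ m / 2 := by
      have h1 : c₀ ^ 2 ≤ 1 / 4 := by nlinarith
      nlinarith
    linarith
  have hpi : Real.pi ^ 2 ≤ 10 := by
    have := Real.pi_lt_d2
    have := Real.pi_pos
    nlinarith
  have e1 : lam * S ≤ lam * ν * m * k / 512 := by
    have h1 : c₀ ^ 2 ≤ ν / 8 := by nlinarith
    have h2 : c₀ ^ 2 * (m * k) ≤ ν / 8 * (m * k) := by gcongr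
    have h3 : S ≤ ν * m * k / 512 := by linarith
    calc lam * S ≤ lam * (ν * m * k / 512) := by gcongr
      _ = _ := by ring
  have e2 : 2 * Real.pi ^ 2 * q ≤ 2 * N := by
    calc 2 * Real.pi ^ 2 * q ≤ 2 * Real.pi ^ 2 * ((m : ℝ) / 32) := by gcongr
      _ ≤ 2 * 10 * ((m : ℝ) / 32) := by gcongr
      _ ≤ 2 * (N : ℝ) := by linarith
  have e3 := inv_radius_pow_le hT hc₀ hcT (k := k) hd
  have e4 : lam * ν * m * k / 512 + 2 * N + 96 * c₀ * m * k - N * (ν * lam * k / 32) ≤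
      2 * N - c₀ * m * k / 4 := by
    have h1 : c₀ * (m * k) ≤ lam * ν / 400000 * (m * k) := by gcongr
    have h2 : (m : ℝ) / 2 * (ν * lam * k / 32) ≤ N * (ν * lam * k / 32) := by gcongr
    have h3 : 0 ≤ lam * ν * (m * k) := by positivity
    nlinarith
  have hb0 := le_rankConst_sq
  set b : ℝ := Real.exp 2 * (166 * boxConst ^ 2) with hb
  have hbnn : 0 ≤ b := by positivity
  calc _ ≤ Real.exp (lam * ν * m * k / 512 + 2 * N) *
      (boxConst ^ 2 * (166 * ρ ^ 2 * Real.exp (-(ν * lam * k / 32)))) ^ N *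
      (2 * Real.exp (96 * c₀ * m * k)) := by gcongr
    _ = 2 * (Real.exp (lam * ν * m * k / 512 + 2 * N + 96 * c₀ * m * k -
        N * (ν * lam * k / 32)) * (166 * boxConst ^ 2 * ρ ^ 2) ^ N) := by
        have : (boxConst ^ 2 * (166 * ρ ^ 2 * Real.exp (-(ν * lam * k / 32)))) ^ N =
            (166 * boxConst ^ 2 * ρ ^ 2) ^ N * Real.exp (-(N * (ν * lam * k / 32))) := by
          rw [← mul_neg, Real.exp_nat_mul, ← mul_pow]
          congr 1
          ring
        rw [this, sub_eq_add_neg, Real.exp_add _ (-(_ : ℝ)), Real.exp_add _ (96 * c₀ * m * k)]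
        ring
    _ ≤ 2 * (Real.exp (2 * N - c₀ * m * k / 4) * (166 * boxConst ^ 2 * ρ ^ 2) ^ N) := by
        gcongr
    _ = 2 * Real.exp (-(c₀ * m * k / 4)) * (b * ρ ^ 2) ^ N := by
        have : (b * ρ ^ 2) ^ N = Real.exp (2 * N) * (166 * boxConst ^ 2 * ρ ^ 2) ^ N := by
          rw [mul_comm 2 (N : ℝ), Real.exp_nat_mul, ← mul_pow, hb]
          congr 1
          ring
        rw [this, sub_eq_add_neg, Real.exp_add]
        ring
    _ ≤ 2 * Real.exp (-(c₀ * m * k / 4)) * (1 / 4 * ((rankConst * τ) ^ 2) ^ N) := by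
        gcongr
        calc (b * ρ ^ 2) ^ N ≤ (1 / 4 * (rankConst * τ) ^ 2) ^ N := by
              refine pow_le_pow_left₀ (by positivity) ?_ N
              rw [mul_pow, ← mul_assoc]
              refine mul_le_mul ?_ (pow_le_pow_left₀ hρ.le hρτ 2) (by positivity) (by positivity)
              linarith
          _ = (1 / 4) ^ N * ((rankConst * τ) ^ 2) ^ N := mul_pow _ _ _
          _ ≤ 1 / 4 * ((rankConst * τ) ^ 2) ^ N := by
              gcongr
              exact pow_le_of_le_one (by norm_num) (by norm_num) (by omega)
    _ = _ := by
        rw [pow_mul]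
        ring

/-- The exponent `2 d N` is split between `c₀ m k / 4 ≤ d N` and `τ ^ (2 N) ≥ exp (-d N / 4)`. The
summand `2` of `rankConst` supplies the factor absorbing the constants. -/
theorem tail_term_le (hc₀ : 0 < c₀) (hc : c₀ ≤ 1 / 2) (hm : m = N + d) (hN : 1 ≤ N) (hkd : k ≤ d)
    (hd : (d : ℝ) ≤ 2 * c₀ ^ 2 * m) {τ : ℝ} (hτ : Real.exp (-(d / 8)) ≤ τ) :
    Real.exp (-(2 * d * N)) ≤
      1 / 2 * (Real.exp (-(c₀ * m * k / 4)) * (rankConst * τ) ^ (2 * N)) := by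
  have hm0 : (0 : ℝ) ≤ m := m.cast_nonneg
  have hd0 : (0 : ℝ) ≤ d := d.cast_nonneg
  have hmR : (m : ℝ) = N + d := by rw [hm]; push_cast; rfl
  have hkR : (k : ℝ) ≤ d := by exact_mod_cast hkd
  have hNm : (m : ℝ) / 2 ≤ N := by
    have h1 : c₀ ^ 2 ≤ 1 / 4 := by nlinarith
    have : 2 * c₀ ^ 2 * m ≤ m / 2 := by nlinarith
    linarith
  have h1 : c₀ * m * k / 4 ≤ d * N := by
    calc c₀ * m * k / 4 ≤ 1 / 2 * (2 * N) * d / 4 := by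
          gcongr
          linarith
      _ ≤ d * N := by nlinarith [mul_nonneg hd0 (N.cast_nonneg : (0 : ℝ) ≤ N)]
  have h2 : Real.exp (-(d * N / 4)) * 4 ≤ (rankConst * τ) ^ (2 * N) := by
    calc Real.exp (-(d * N / 4)) * 4 ≤ Real.exp (-(d / 8)) ^ (2 * N) * 2 ^ (2 * N) := by
          gcongr
          · rw [← Real.exp_nat_mul]
            refine Real.exp_le_exp.2 (le_of_eq ?_)
            push_cast
            ring
          · calc (4 : ℝ) = 2 ^ (2 * 1) := by norm_num
              _ ≤ 2 ^ (2 * N) := pow_le_pow_right₀ (by norm_num) (by omega)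
      _ = (2 * Real.exp (-(d / 8))) ^ (2 * N) := by rw [mul_pow]; ring
      _ ≤ _ := by
          have h3 := two_le_rankConst
          have h4 := (Real.exp_pos (-((d : ℝ) / 8))).le
          exact pow_le_pow_left₀ (by positivity) (mul_le_mul h3 hτ h4 (by linarith)) _
  calc Real.exp (-(2 * d * N)) ≤ Real.exp (-(c₀ * m * k / 4)) * Real.exp (-(d * N / 4)) := by
        rw [← Real.exp_add]
        refine Real.exp_le_exp.2 ?_
        nlinarith [mul_nonneg hd0 (N.cast_nonneg : (0 : ℝ) ≤ N)]
    _ ≤ Real.exp (-(c₀ * m * k / 4)) * (Real.exp (-(d * N / 4)) * 4) * (1 / 2) := by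
        nlinarith [mul_pos (Real.exp_pos (-(c₀ * m * k / 4))) (Real.exp_pos (-(d * N / 4)))]
    _ ≤ Real.exp (-(c₀ * m * k / 4)) * ((rankConst * τ) ^ (2 * N)) * (1 / 2) := by gcongr
    _ = _ := by ring

end Numeric

/-! ### Assembly. -/

theorem rowsLaw_rank_le {T ν c₀ γ : ℝ} {m N d k : ℕ} (hT : 1 ≤ T) (hν : ν ≤ 1 / 4) (hc₀ : 0 < c₀)
    (hc : c₀ ≤ 1 / 10 ^ 9 * (T ^ 4)⁻¹ * ν) (hm : m = N + d) (hN : 1 ≤ N) (hd1 : 1 ≤ d) (hkd : k ≤ d)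
    (hd : (d : ℝ) ≤ 2 * c₀ ^ 2 * m) {ρ τ : ℝ} (hρ : 0 < ρ) (hρτ : ρ ≤ τ)
    (hτ : Real.exp (-(d / 8)) ≤ τ) (hγ0 : 0 < γ) (hγ : 3456 ≤ ν * γ ^ 2)
    {M : Fin N → Fin d → Measure ℝ} (hM : ∀ j i, IsSubG (M j i) (2 * T)) {Y : Fin d → ℝ}
    (hY : ∀ j, ∀ θ : ℝ, |θ| ≤ 1 →
      |θ| ≤ ρ * Real.exp (1 / γ ^ 2 * ∑ i, latticeEnergy (M j i) (θ * Y i)))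
    {q : ℝ} (hq : q ≤ m / 32) :
    rowsLaw ν M (smallOn (Fin d) N k ((c₀ * √m / 16) ^ 2) ∩ blockBall Y q) ≤
      ENNReal.ofReal (Real.exp (-(c₀ * m * k / 4)) * (rankConst * τ) ^ (2 * N)) := by
  have hT4 : 1 ≤ T ^ 4 := one_le_pow₀ hT
  have hTi : (T ^ 4)⁻¹ ≤ 1 := inv_le_one_of_one_le₀ hT4
  have hTi0 : 0 < (T ^ 4)⁻¹ := by positivity
  have hν0 : 0 < ν := by
    by_contra hcon
    rw [not_lt] at hcon
    nlinarith [mul_nonneg hTi0.le (neg_nonneg.2 hcon)]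
  have hc01 : c₀ ≤ 1 / 2 := by nlinarith
  have : Nonempty (Fin d) := ⟨⟨0, hd1⟩⟩
  set B := smallOn (Fin d) N k ((c₀ * √m / 16) ^ 2) with hB
  -- `L` is the Hilbert–Schmidt threshold for parameter `2 T`. The radius `r` is chosen so that the
  -- perturbation costs at most `c₀² m k / 128`, the same as the singular value term, and `lam` so
  -- that `128 (2 T)⁴ lam = 1`.
  set L : ℝ := 2 * (2 * T) ^ 2 * (2 * d) * N with hL
  set r : ℝ := c₀ / (64 * T) with hr
  have hr0 : 0 < r := by positivity
  have hr1 : r ≤ 1 / 2 := by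
    rw [hr, div_le_iff₀ (by positivity)]
    linarith
  set lam : ℝ := 1 / (2048 * T ^ 4) with hlam
  have hlam0 : 0 < lam := by positivity
  have t1 := rowsLaw_hilbertSchmidt_ge hM (by linarith) hν0.le (by linarith)
  have t2 := rowsLaw_smallOn_le (T := 2 * T) hM (by linarith) hν0 (by linarith) hlam0
    (by rw [hlam]; refine le_of_eq ?_; field_simp; norm_num) hρ hγ0 hγ hY (k := k) hr0 hr1
    ((c₀ * √m / 16) ^ 2) L q
  rw [Fintype.card_fin] at t1 t2
  have hdR : (0 : ℝ) < d := by exact_mod_cast hd1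
  have hS : 2 * k * (c₀ * √m / 16) ^ 2 + 4 * r ^ 2 * k * L / (2 * d) ≤ c₀ ^ 2 * m * k / 64 := by
    have h1 : 4 * r ^ 2 * k * L / (2 * d) = c₀ ^ 2 * N * k / 128 := by
      rw [hr, hL]
      field_simp
      ring
    have h2 : (c₀ * √m / 16) ^ 2 = c₀ ^ 2 * m / 256 := by
      rw [div_pow, mul_pow, Real.sq_sqrt m.cast_nonneg]
      norm_num
    have h3 : c₀ ^ 2 * N * k ≤ c₀ ^ 2 * m * k := by
      have : (N : ℝ) ≤ m := by
        rw [hm]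
        push_cast
        linarith
      gcongr
    rw [h1, h2]
    linarith
  have n1 := tail_term_le hc₀ hc01 hm hN hkd hd hτ
  have n2 := main_term_le hT hν hc₀ hc hm hN hd hρ hρτ hS hq
  set R : ℝ := Real.exp (-(c₀ * m * k / 4)) * (rankConst * τ) ^ (2 * N) with hR
  have hR0 : 0 ≤ R := mul_nonneg (Real.exp_pos _).le (by rw [pow_mul]; positivity)
  have hsub : B ∩ blockBall Y q ⊆ {h | L ≤ ∑ j, ∑ i, h j i ^ 2} ∪
      ((B ∩ {h | ∑ j, ∑ i, h j i ^ 2 ≤ L}) ∩ blockBall Y q) := by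
    rintro h ⟨h1, h2⟩
    rcases le_total L (∑ j, ∑ i, h j i ^ 2) with h3 | h3
    · exact Or.inl h3
    · exact Or.inr ⟨⟨h1, h3⟩, h2⟩
  calc _ ≤ _ := measure_mono hsub
    _ ≤ _ := measure_union_le _ _
    _ ≤ ENNReal.ofReal (1 / 2 * R) + ENNReal.ofReal (1 / 2 * R) := by
        refine add_le_add (t1.trans (ENNReal.ofReal_le_ofReal n1)) (t2.trans ?_)
        rw [← ENNReal.ofReal_div_of_pos (by positivity)]
        refine ENNReal.ofReal_le_ofReal (le_trans (le_of_eq ?_) n2)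
        rw [div_eq_mul_inv _ ((r / 2) ^ (k * (2 * d)) / 2), inv_div, div_eq_mul_inv 2]
    _ = _ := by
        rw [← ENNReal.ofReal_add (by positivity) (by positivity)]
        congr 1
        ring

theorem MemG.sparseLaw_pairLaw {Ω : Type*} [MeasurableSpace Ω] {P : Measure Ω}
    [IsProbabilityMeasure P] {d : ℕ} {T ν : ℝ} {ξ : Ω → Fin d → ℝ} (h : MemG P T ξ) (h0 : 0 ≤ ν)
    (h1 : ν ≤ 1) : sparseLaw ν (pairLaw P ξ) =
      Measure.pi fun i => lazyLaw ν
        (Sum.elim (fun i => P.map fun ω => ξ ω i) (fun i => P.map fun ω => ξ ω i) i) := by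
  have hp : ∀ i, IsProbabilityMeasure (P.map fun ω => ξ ω i) := fun i =>
    Measure.isProbabilityMeasure_map (h.memS2 i).aemeasurable
  have hp' : ∀ i, IsProbabilityMeasure
      (Sum.elim (fun i => P.map fun ω => ξ ω i) (fun i => P.map fun ω => ξ ω i) i) := by
    rintro (i | i) <;> exact hp i
  have hξ : P.map ξ = Measure.pi fun i => P.map fun ω => ξ ω i :=
    h.indep.map_fun_eq_pi_map fun i => (h.memS2 i).aemeasurable
  rw [pairLaw_eq_pi P ξ _ hξ, sparseLaw_pi h0 h1]

theorem map_eq_rowsLaw {Ω Ω' : Type*} [MeasurableSpace Ω] [MeasurableSpace Ω'] {P : Measure Ω}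
    [IsProbabilityMeasure P] {P' : Measure Ω'} [IsProbabilityMeasure P'] {N d : ℕ} {T ν : ℝ}
    {ξ : Fin N → Ω' → Fin d → ℝ} (hξ : ∀ j, MemG P' T (ξ j)) (h0 : 0 ≤ ν) (h1 : ν ≤ 1)
    {H : Ω → Matrix (Fin N) (Fin d ⊕ Fin d) ℝ} (hind : iIndepFun (fun j ω => (H ω).row j) P)
    (hlaw : ∀ j, HasLaw (fun ω => (H ω).row j) (sparseLaw ν (pairLaw P' (ξ j))) P) :
    P.map (fun ω j => (H ω).row j) = rowsLaw ν fun j i => P'.map fun ω => ξ j ω i := by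
  rw [hind.map_fun_eq_pi_map fun j => (hlaw j).aemeasurable, rowsLaw]
  congr 1
  ext1 j
  rw [(hlaw j).map_eq, (hξ j).sparseLaw_pairLaw h0 h1]

/-- `sigma` is one-based and the library's sequence zero-based, so the index `2 d - k + 1` refers to
entry `2 d - k`, exactly where the `k` smallest begin. -/
theorem mem_smallOn_of_sigma_le {N d k : ℕ} (hk : k ≤ d)
    (A : Matrix (Fin N) (Fin d ⊕ Fin d) ℝ) {s : ℝ} (h : sigma A (2 * d - k + 1) ≤ s) :
    (fun j => A.row j) ∈ smallOn (Fin d) N k (s ^ 2) := by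
  obtain ⟨W, hW, hs⟩ := exists_orthonormal_norm_le_of_singularValues_le
    (Matrix.toEuclideanLin A) (n := 2 * d) (k := k) (by simp [two_mul]) (by omega) (s := s) h
  refine ⟨W, hW, fun l => ?_⟩
  have h1 := pow_le_pow_left₀ (norm_nonneg _) (hs l) 2
  refine le_trans (le_of_eq ?_) h1
  rw [EuclideanSpace.norm_sq_eq]
  refine Finset.sum_congr rfl fun j _ => ?_
  rw [Real.norm_eq_abs, sq_abs]
  simp [Matrix.toLpLin_apply, PiLp.inner_apply, Matrix.mulVec, dotProduct, mul_comm]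

theorem mem_blockBall_of_norm_le {N d : ℕ} (A : Matrix (Fin N) (Fin d ⊕ Fin d) ℝ)
    (X : EuclideanSpace ℝ (Fin d)) {b : ℝ} (h1 : ‖WithLp.toLp 2 (A.toCols₁ *ᵥ X)‖ ≤ b)
    (h2 : ‖WithLp.toLp 2 (A.toCols₂ *ᵥ X)‖ ≤ b) (r : ℝ) :
    (fun j => A.row j) ∈ blockBall (fun i => r * X i) (2 * r ^ 2 * b ^ 2) := by
  have h1' := pow_le_pow_left₀ (norm_nonneg _) h1 2
  have h2' := pow_le_pow_left₀ (norm_nonneg _) h2 2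
  rw [EuclideanSpace.norm_sq_eq] at h1' h2'
  simp only [Real.norm_eq_abs, sq_abs, Matrix.mulVec, dotProduct, Matrix.toCols₁_apply,
    Matrix.toCols₂_apply] at h1' h2'
  show ∑ j, ((∑ i, A j (Sum.inl i) * (r * X i)) ^ 2 + (∑ i, A j (Sum.inr i) * (r * X i)) ^ 2) ≤ _
  have e : ∀ f : Fin d → ℝ, (∑ i, f i * (r * X i)) ^ 2 = r ^ 2 * (∑ i, f i * X i) ^ 2 := by
    intro f
    rw [← mul_pow, Finset.mul_sum]
    congr 1
    exact Finset.sum_congr rfl fun i _ => by ring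
  simp only [e, Finset.sum_add_distrib, ← Finset.mul_sum]
  nlinarith [mul_le_mul_of_nonneg_left h1' (sq_nonneg r),
    mul_le_mul_of_nonneg_left h2' (sq_nonneg r)]

end MixedRank

theorem mainTheorem11 :
    ∃ c c' D C : ℝ, 0 < c ∧ 0 < c' ∧ 0 < D ∧ 0 < C ∧
      ∀ (T t α ν c₀ γ : ℝ) (n m k d : ℕ),
        1 ≤ T → 0 < t → m ≤ n → d ≤ m → k ≤ d → 0 < α → α < 1 → ν ≤ 1 / 4 →
        0 < c₀ → c₀ ≤ c * (T ^ 4)⁻¹ * ν →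
        D * T ^ 2 * ν ^ (-(1 / 2) : ℝ) ≤ γ →
        (d : ℝ) ≤ 2 * c₀ ^ 2 * m →
        c' * α * γ⁻¹ * Real.exp (-(d / 8)) ≤ t →
      ∀ (X : EuclideanSpace ℝ (Fin d)), 32 * √n * c₀⁻¹ * t⁻¹ ≤ ‖X‖ →
      ∀ {Ω' : Type*} [MeasurableSpace Ω'] (P' : Measure Ω') [IsProbabilityMeasure P']
        (ξ : Fin (m - d) → Ω' → Fin d → ℝ),
        iIndepFun ξ P' →
        (∀ j, MixedRank.MemG P' T (ξ j)) →
        (∀ j, 16 < MixedRank.RlogD P' γ α (ξ j) ((c₀ / (32 * √n)) • X)) →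
      ∀ {Ω : Type*} [MeasurableSpace Ω] (P : Measure Ω) [IsProbabilityMeasure P]
        (H : Ω → Matrix (Fin (m - d)) (Fin d ⊕ Fin d) ℝ),
        iIndepFun (fun j ω => (H ω).row j) P →
        (∀ j, HasLaw (fun ω => (H ω).row j)
          (MixedRank.sparseLaw ν (MixedRank.pairLaw P' (ξ j))) P) →
        P.real {ω | MixedRank.sigma (H ω) (2 * d - k + 1) ≤ c₀ * √m / 16 ∧
            ‖WithLp.toLp 2 ((H ω).toCols₁ *ᵥ X)‖ ≤ m ∧
            ‖WithLp.toLp 2 ((H ω).toCols₂ *ᵥ X)‖ ≤ m} ≤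
          Real.exp (-(c₀ * m * k / 4)) * (C * γ / α * t) ^ (2 * m - 2 * d) := by
  -- `D = 64` gives `ν γ² ≥ 64² T⁴ = 4096 T⁴`, above the `3456` required by the row estimate.
  refine ⟨1 / 10 ^ 9, 1, 64, MixedRank.rankConst, by norm_num, one_pos, by norm_num,
    by linarith [MixedRank.two_le_rankConst], ?_⟩
  intro T t α ν c₀ γ n m k d hT ht hmn hdm hkd hα0 hα1 hν hc₀ hc hγ hd ht' X hX Ω' _ P' _ ξ _ hG
    hR Ω _ P _ H hind hlaw
  have hT4 : 1 ≤ T ^ 4 := one_le_pow₀ hT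
  have hTi : (T ^ 4)⁻¹ ≤ 1 := inv_le_one_of_one_le₀ hT4
  have hTi0 : 0 < (T ^ 4)⁻¹ := by positivity
  have hν0 : 0 < ν := by
    by_contra hcon
    rw [not_lt] at hcon
    nlinarith [mul_nonneg hTi0.le (neg_nonneg.2 hcon)]
  have hc01 : c₀ ≤ 1 / 2 := by nlinarith
  have hν2 : 0 < ν ^ (-(1 / 2) : ℝ) := Real.rpow_pos_of_pos hν0 _
  have hγ0 : 0 < γ := lt_of_lt_of_le (by positivity) hγ
  have hγ2 : 3456 ≤ ν * γ ^ 2 := by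
    have h1 : (ν ^ (-(1 / 2) : ℝ)) ^ 2 = ν⁻¹ := by
      rw [← Real.rpow_natCast, ← Real.rpow_mul hν0.le]
      norm_num
      exact Real.rpow_neg_one ν
    calc (3456 : ℝ) ≤ 4096 * T ^ 4 := by linarith
      _ = ν * (64 * T ^ 2 * ν ^ (-(1 / 2) : ℝ)) ^ 2 := by
          rw [mul_pow, mul_pow, h1]
          field_simp
          norm_num
      _ ≤ ν * γ ^ 2 := by gcongr
  have hmd : (d : ℝ) ≤ m / 2 := by
    have h1 : c₀ ^ 2 ≤ 1 / 4 := by nlinarith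
    have h2 : (0 : ℝ) ≤ m := m.cast_nonneg
    nlinarith
  -- If `m = 0`, then `d = k = 0` and the right-hand side is `1`. Otherwise `d ≤ m / 2` leaves at
  -- least one row, and `X ≠ 0` forces `d ≥ 1`.
  rcases Nat.eq_zero_or_pos m with hm0 | hm0
  · subst hm0
    obtain rfl : d = 0 := by omega
    obtain rfl : k = 0 := by omega
    simp
  have hmR : (0 : ℝ) < m := by exact_mod_cast hm0
  have hN1 : 1 ≤ m - d := by
    have : (d : ℝ) < m := by linarith
    have : d < m := by exact_mod_cast this
    omega
  have hnR : (0 : ℝ) < n := hmR.trans_le (by exact_mod_cast hmn)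
  have hmnR : (m : ℝ) ≤ n := by exact_mod_cast hmn
  have hX0 : 0 < ‖X‖ := lt_of_lt_of_le (by positivity) hX
  have hd1 : 1 ≤ d := by
    rcases Nat.eq_zero_or_pos d with h | h
    · subst h
      rw [Subsingleton.elim X 0, norm_zero] at hX0
      exact absurd hX0 (lt_irrefl 0)
    · exact h
  set r : ℝ := c₀ / (32 * √n) with hr
  have hr0 : 0 < r := by positivity
  have hY : 1 / t ≤ ‖r • X‖ := by
    rw [norm_smul, Real.norm_of_nonneg hr0.le]
    calc 1 / t = r * (32 * √n * c₀⁻¹ * t⁻¹) := by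
          rw [hr]
          field_simp
      _ ≤ _ := by gcongr
  have hY0 : 0 < ‖r • X‖ := lt_of_lt_of_le (by positivity) hY
  -- The lower bound on `‖X‖` amounts to `‖r X‖ ≥ 1 / t`, which converts the LCD scale `ρ` into the
  -- `γ t / α` of the conclusion.
  have hρτ : γ / (α * ‖r • X‖) ≤ γ / α * t := by
    rw [← div_div, div_le_iff₀ hY0, mul_assoc]
    refine le_mul_of_one_le_right (by positivity) ?_
    rwa [div_le_iff₀' ht] at hY
  have hτ : Real.exp (-(d / 8)) ≤ γ / α * t := by
    calc Real.exp (-(d / 8)) = γ / α * (1 * α * γ⁻¹ * Real.exp (-(d / 8))) := by field_simp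
      _ ≤ _ := by gcongr
  have hq : 2 * r ^ 2 * (m : ℝ) ^ 2 ≤ m / 32 := by
    have h1 : r ^ 2 = c₀ ^ 2 / (1024 * n) := by
      rw [hr, div_pow, mul_pow, Real.sq_sqrt hnR.le]
      norm_num
    have h2 : c₀ ^ 2 ≤ 1 := by nlinarith
    rw [h1]
    calc 2 * (c₀ ^ 2 / (1024 * n)) * (m : ℝ) ^ 2 ≤ 2 * (1 / (1024 * n)) * ((m : ℝ) * n) := by
          rw [pow_two (m : ℝ)]
          gcongr
      _ = m / 512 := by
          field_simp
          norm_num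
      _ ≤ m / 32 := by gcongr; norm_num
  have key := MixedRank.rowsLaw_rank_le hT hν hc₀ hc (by omega : m = (m - d) + d) hN1 hd1 hkd hd
    (by positivity) hρτ hτ hγ0 hγ2 (fun j i => ((hG j).memS2 i).isSubG hT)
    (fun j θ hθ => MixedRank.abs_le_of_lt_RlogD (fun i => ((hG j).memS2 i).aemeasurable)
      hγ0 hα0 hY0 (hR j) hθ) hq
  rw [← MixedRank.map_eq_rowsLaw hG hν0.le (by linarith) hind hlaw] at key
  have hmeas : AEMeasurable (fun ω j => (H ω).row j) P :=
    aemeasurable_pi_lambda _ fun j => (hlaw j).aemeasurable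
  have hfin : P {ω | MixedRank.sigma (H ω) (2 * d - k + 1) ≤ c₀ * √m / 16 ∧
      ‖WithLp.toLp 2 ((H ω).toCols₁ *ᵥ X)‖ ≤ m ∧ ‖WithLp.toLp 2 ((H ω).toCols₂ *ᵥ X)‖ ≤ m} ≤
      ENNReal.ofReal (Real.exp (-(c₀ * m * k / 4)) *
        (MixedRank.rankConst * (γ / α * t)) ^ (2 * (m - d))) := by
    -- Only the inequality `P (f⁻¹ A) ≤ (P.map f) A` is needed, so measurability of the event plays
    -- no role.
    refine le_trans (measure_mono ?_) ((Measure.le_map_apply hmeas _).trans key)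
    rintro ω ⟨h1, h2, h3⟩
    exact ⟨MixedRank.mem_smallOn_of_sigma_le hkd (H ω) h1,
      MixedRank.mem_blockBall_of_norm_le (H ω) X h2 h3 r⟩
  have hC := MixedRank.two_le_rankConst
  have hexp : 2 * m - 2 * d = 2 * (m - d) := by omega
  have hbase : MixedRank.rankConst * γ / α * t = MixedRank.rankConst * (γ / α * t) := by ring
  rw [hexp, hbase]
  exact ENNReal.toReal_le_of_le_ofReal (by positivity) hfin
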